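/- **Theorem 5.1.** The following decision problem is in PSPACE. An *iterated Boolean game with DFA goals* $G$ consists of a finite set of agents $\Omega=\{0,\dots,k-1\}$, a nonempty finite action alphabet $\Sigma_i$ for each agent $i$, and, for each agent $i$, a goal DFA $A^i$ over the alphabet of decisions $\Sigma=\Sigma_0\times\dots\times\Sigma_{k-1}$. A strategy profile is a mapping $\pi:\Sigma^*\to\Sigma$; its primary trace is the sequence $t\in\Sigma^\omega$ with $t_n=\pi(t_0\cdots t_{n-1})$ for all $n\ge 0$. A trace $t\in\Sigma^\omega$ satisfies $A^i$ if $A^i$ accepts $t_0\cdots t_n$ for some $n\ge 0$. For an agent $j$, a trace $t$ other than the primary trace is $j$-deviant if, for every $n$, the decisions $t_n$ and $\pi(t_0\cdots t_{n-1})$ agree in the components of all agents $i\ne j$. For $W\subseteq\Omega$, $\pi$ is a $W$-NE strategy profile if its primary trace satisfies $A^i$ precisely for the agents $i\in W$, and for every $j\in\Omega\setminus W$ no $j$-deviant trace satisfies $A^j$. *Input:* an iterated Boolean game $G$ with DFA goals, given by the sizes of the alphabets and the goal DFAs with explicitly listed transition tables over $\Sigma$, and a set $W\subseteq\Omega$,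 encoded as a bit string. *Question:* does $G$ have a $W$-NE strategy profile? That is, the language of all encodings of pairs $(G,W)$ such that $G$ has a $W$-NE strategy profile is decided by a deterministic Turing machine that halts on every bit string $x$ and uses space at most $p(|x|)$, for some polynomial $p$. -/

import Mathlib

namespace IteratedGames

/-! ### Iterated Boolean games with DFA goals

Agents are indexed by `ι`; agent `i` has the action alphabet `A i`.  A decision is a tuple of
actions, and since the states of the game are the decisions and the transition function is
`τ (s, d) = d`, a history is a finite list of decisions (oldest first) and a trace is an
infinite sequence of decisions. -/

section Games

variable {ι : Type*} {A : ι → Type*}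

/-- A decision: one action for every agent, i.e. a letter of `Σ = ∏ i, Σ_i`. -/
abbrev Decision (A : ι → Type*) := ∀ i, A i

/-- A strategy profile, as a mapping `Σ* → Σ` (its `i`-th component is the strategy of agent
`i`, a mapping `Σ* → Σ_i`). -/
abbrev Profile (A : ι → Type*) := List (Decision A) → Decision A

/-- The prefix `t 0, …, t (n - 1)` of a trace. -/
def tracePrefix (t : ℕ → Decision A) (n : ℕ) : List (Decision A) :=
  (List.range n).map t

/-- The history of length `n` that arises when all agents follow `π`. -/
def primaryHistory (π : Profile A) : ℕ → List (Decision A)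
  | 0 => []
  | n + 1 => primaryHistory π n ++ [π (primaryHistory π n)]

/-- The primary trace of `π`: `t 0 = π ε` and `t n = π (t 0, …, t (n - 1))`. -/
def primaryTrace (π : Profile A) (n : ℕ) : Decision A :=
  π (primaryHistory π n)

/-- A trace satisfies a DFA if the DFA accepts `t 0, …, t n` for some `n ≥ 0`. -/
def TraceSatisfies {Q : Type*} (M : DFA (Decision A) Q) (t : ℕ → Decision A) : Prop :=
  ∃ n, tracePrefix t (n + 1) ∈ M.accepts

/-- A `j`-deviant trace of `π`: a trace other than the primary one in which, at each step, all
agents except possibly `j` act as `π` prescribes for the current history. -/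
def IsDeviantTrace (π : Profile A) (j : ι) (t : ℕ → Decision A) : Prop :=
  (∀ n, ∀ i, i ≠ j → t n i = π (tracePrefix t n) i) ∧ t ≠ primaryTrace π

/-- `π` is a `W`-NE strategy profile for the goals `goal i`: the primary trace satisfies
precisely the goals of the agents in `W`, and no `j`-deviant trace, for `j ∉ W`, satisfies the
goal of `j`. -/
def IsWNE {Q : ι → Type*} (goal : ∀ i, DFA (Decision A) (Q i)) (W : Set ι)
    (π : Profile A) : Prop :=
  (∀ i, TraceSatisfies (goal i) (primaryTrace π) ↔ i ∈ W) ∧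
  ∀ j, j ∉ W → ∀ t, IsDeviantTrace π j t → ¬ TraceSatisfies (goal j) t

end Games

/-! ### Instances of the decision problem and their encoding as bit strings -/

/-- A finite iBG with DFA goals.  The agents are `0, …, k - 1`; alphabets and state sets are
initial segments `{0, …, n - 1}` of the natural numbers (disjointness of the alphabets plays no
role for tuples of actions, where the position tells whose action it is). -/
structure IBG where
  /-- the number of agents -/
  k : ℕ
  /-- the size of the alphabet of each agent -/
  actions : Fin k → ℕ
  actions_pos : ∀ i, 0 < actions i
  /-- the number of states of the goal automaton of each agent -/
  states : Fin k → ℕ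
  /-- the goal automata, over the alphabet of all decisions -/
  goal : ∀ i, DFA (Decision fun j => Fin (actions j)) (Fin (states i))

/-- The indicator `1` / `0` of a proposition. -/
noncomputable def indicator (p : Prop) : ℕ :=
  open Classical in if p then 1 else 0

/-- A DFA over decisions as a list of numbers: the number of states, the initial state, the
indicator vector of the accepting states, and the full transition table, row by row, where the
letters of a row are listed in mixed radix order (the action of agent `0` varies fastest). -/
noncomputable def dfaData {k m : ℕ} {a : Fin k → ℕ}
    (M : DFA (Decision fun j => Fin (a j)) (Fin m)) : List ℕ :=
  [m, (M.start : ℕ)] ++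
  (List.ofFn fun q : Fin m => indicator (q ∈ M.accept)) ++
  (List.ofFn fun q : Fin m =>
    List.ofFn fun l : Fin (∏ j, a j) => (M.step q (finPiFinEquiv.symm l) : ℕ)).flatten

/-- A pair `(G, W)` as a list of numbers: the number of agents, the alphabet sizes, the goal
automata, and the indicator vector of `W`. -/
noncomputable def instanceData (G : IBG) (W : Set (Fin G.k)) : List ℕ :=
  [G.k] ++ List.ofFn G.actions ++
  (List.ofFn fun i => dfaData (G.goal i)).flatten ++
  (List.ofFn fun i => indicator (i ∈ W))

/-- A list of numbers as a bit string; each `n` becomes the block `1ⁿ0`. -/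
def bitsOfNats (l : List ℕ) : List Bool :=
  l.flatMap fun n => List.replicate n true ++ [false]

/-- The bit string that encodes `(G, W)`.  Every number in `instanceData G W` is at most the
length of that list, so unary blocks are at most polynomially longer than binary ones. -/
noncomputable def encodeInstance (G : IBG) (W : Set (Fin G.k)) : List Bool :=
  bitsOfNats (instanceData G W)

/-- The `W`-NE existence problem: the set of all encodings of pairs `(G, W)` such that `G` has
a `W`-NE strategy profile. -/
def WNEExistence : Set (List Bool) :=
  {x | ∃ (G : IBG) (W : Set (Fin G.k)), x = encodeInstance G W ∧ ∃ π, IsWNE G.goal W π}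

/-! ### Polynomial space -/

/-- The space used by a configuration of a (deterministic, multi-stack) Turing machine: the
total number of symbols on its stacks, the input stack included. -/
def cfgSpace (tm : Turing.FinTM2) (c : tm.Cfg) : ℕ :=
  letI := tm.kFin
  ∑ k, (c.stk k).length

/-- A language `L` of bit strings is in PSPACE: there are a deterministic Turing machine with
finite stack alphabets, input and output alphabet `{0, 1}`, and a polynomial `p`, such that on
every input `x` the machine halts with the single symbol `1` on its output stack if `x ∈ L` and
the single symbol `0` if `x ∉ L`, and on the way never uses more than `p |x|` space. -/
def InPSPACE (L : Set (List Bool)) : Prop :=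
  ∃ (M : Turing.TM2ComputableAux Bool Bool) (p : Polynomial ℕ),
    (∀ k, Finite (M.tm.Γ k)) ∧
    ∀ x : List Bool,
      (∃ c : M.tm.Cfg,
        StateTransition.Reaches M.tm.step
          (Turing.initList M.tm (x.map M.inputAlphabet.symm)) c ∧
        c.l = none ∧
        ∃ b : Bool, c.stk M.tm.k₁ = [M.outputAlphabet.symm b] ∧ (b = true ↔ x ∈ L)) ∧
      ∀ c : M.tm.Cfg,
        StateTransition.Reaches M.tm.step
          (Turing.initList M.tm (x.map M.inputAlphabet.symm)) c →
        cfgSpace M.tm c ≤ p.eval x.length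

end IteratedGames

/-! Call a state of the goal DFA of agent `j` safe if the other agents can keep `j` away from
accepting states from there on. A `W`-NE strategy profile exists iff some trace satisfies the goals
of all agents in `W` and, for every `j ∉ W` and at every time, each action of `j`, the prescribed
one included, leads to a safe state of the DFA of `j` (`exists_isWNE_iff`). Given such a trace, the
profile follows it; once a single agent has left it, the others punish that agent by decisions that
preserve safety.

Along a trace only the tuple of DFA states matters, with a mark for the goals already reached. Hence
the trace can be replaced by a lasso in a finite graph of tuples (`exists_trace_iff`). The graph may
have exponentially many vertices, but a vertex has a code of polynomial length and an edge is tested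
in polynomial space. Savitch's recursion over midpoints then decides reachability
(`PolySpace.reflTransGen`), and safety is decided by running through all sets of states.

The machines come from an algebra of functions. `PolySpace` says that a function is computed by a
structured stack program in polynomial space; programs compile to `TM2` machines (`Run.reaches`).
The class is closed under composition, pairing, case distinction and loops with small states. Time
is unrestricted, so arithmetic may proceed by counting and bounded quantifiers by exhaustive search.
Bijective base two identifies bit strings with natural numbers, which turns the language into the
predicate `ValidN ∧ WinN` on numbers (`mem_WNEExistence_iff`); this predicate is assembled from
operations under which the class is closed, and `PolySpace.inPSPACE` turns it into a machine. -/

namespace IteratedGames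

open Turing Relation

/-! ### Structured stack programs and their compilation to Turing machines -/

section Cmd

variable {K : Type} {Γ : K → Type}

/-- Structured programs on a family of stacks. -/
inductive Cmd (Γ : K → Type) : Type
  | skip : Cmd Γ
  | push (k : K) (a : Γ k) : Cmd Γ
  | pop (k : K) : Cmd Γ
  | seq (p q : Cmd Γ) : Cmd Γ
  | ite (k : K) (t : Option (Γ k) → Bool) (p q : Cmd Γ) : Cmd Γ
  | loop (k : K) (t : Option (Γ k) → Bool) (p : Cmd Γ) : Cmd Γ

infixr:60 " ;; " => Cmd.seq

variable [DecidableEq K] [Fintype K]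

/-- The total number of symbols on all stacks. -/
def stSize (s : ∀ k, List (Γ k)) : ℕ := ∑ k, (s k).length

/-- `Run B c s s'`: started with the stacks `s`, the program `c` terminates with the stacks `s'`
and there are never more than `B` symbols on the stacks. -/
inductive Run (B : ℕ) : Cmd Γ → (∀ k, List (Γ k)) → (∀ k, List (Γ k)) → Prop
  | skip {s} : stSize s ≤ B → Run B .skip s s
  | push {s k a} : stSize s ≤ B → stSize (Function.update s k (a :: s k)) ≤ B →
      Run B (.push k a) s (Function.update s k (a :: s k))
  | pop {s k} : stSize s ≤ B → stSize (Function.update s k (s k).tail) ≤ B →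
      Run B (.pop k) s (Function.update s k (s k).tail)
  | seq {p q s s' s''} : Run B p s s' → Run B q s' s'' → Run B (p ;; q) s s''
  | ite_true {k t p q s s'} : t (s k).head? = true → Run B p s s' → Run B (.ite k t p q) s s'
  | ite_false {k t p q s s'} : t (s k).head? = false → Run B q s s' → Run B (.ite k t p q) s s'
  | loop_true {k t p s s' s''} : t (s k).head? = true → Run B p s s' →
      Run B (.loop k t p) s' s'' → Run B (.loop k t p) s s''
  | loop_false {k t p s} : t (s k).head? = false → stSize s ≤ B → Run B (.loop k t p) s s

theorem Run.size_left {B : ℕ} {c : Cmd Γ} {s s' : ∀ k, List (Γ k)} (h : Run B c s s') :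
    stSize s ≤ B := by
  induction h <;> assumption

theorem Run.size_right {B : ℕ} {c : Cmd Γ} {s s' : ∀ k, List (Γ k)} (h : Run B c s s') :
    stSize s' ≤ B := by
  induction h <;> assumption

theorem Run.mono {B B' : ℕ} {c : Cmd Γ} {s s' : ∀ k, List (Γ k)} (h : Run B c s s')
    (hB : B ≤ B') : Run B' c s s' := by
  induction h with
  | skip h => exact .skip (h.trans hB)
  | push h h' => exact .push (h.trans hB) (h'.trans hB)
  | pop h h' => exact .pop (h.trans hB) (h'.trans hB)
  | seq _ _ ih ih' => exact .seq ih ih'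
  | ite_true h _ ih => exact .ite_true h ih
  | ite_false h _ ih => exact .ite_false h ih
  | loop_true h _ _ ih ih' => exact .loop_true h ih ih'
  | loop_false h h' => exact .loop_false h (h'.trans hB)

/-- The labels of the compiled program. -/
def Lbl : Cmd Γ → Type
  | .skip => Unit
  | .push _ _ => Unit
  | .pop _ => Unit
  | .seq p q => Lbl p ⊕ Lbl q
  | .ite _ _ p q => Option (Lbl p ⊕ Lbl q)
  | .loop _ _ p => Option (Lbl p)

/-- The label at which the compiled program starts. -/
def entry : (c : Cmd Γ) → Lbl c
  | .skip => ()
  | .push _ _ => ()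
  | .pop _ => ()
  | .seq p _ => Sum.inl (entry p)
  | .ite _ _ _ _ => none
  | .loop _ _ _ => none

instance lblFintype : (c : Cmd Γ) → Fintype (Lbl c)
  | .skip => inferInstanceAs (Fintype Unit)
  | .push _ _ => inferInstanceAs (Fintype Unit)
  | .pop _ => inferInstanceAs (Fintype Unit)
  | .seq p q =>
    letI := lblFintype p
    letI := lblFintype q
    inferInstanceAs (Fintype (Lbl p ⊕ Lbl q))
  | .ite _ _ p q =>
    letI := lblFintype p
    letI := lblFintype q
    inferInstanceAs (Fintype (Option (Lbl p ⊕ Lbl q)))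
  | .loop _ _ p =>
    letI := lblFintype p
    inferInstanceAs (Fintype (Option (Lbl p)))

/-- The statements of the compiled program, where `e` embeds its labels in the labels of the
machine and `x` is the label of the continuation. -/
def code {Λ : Type} : (c : Cmd Γ) → (Lbl c → Λ) → Λ → Lbl c → TM2.Stmt Γ Λ Bool
  | .skip, _, x, _ => .goto fun _ => x
  | .push k a, _, x, _ => .push k (fun _ => a) (.goto fun _ => x)
  | .pop k, _, x, _ => .pop k (fun v _ => v) (.goto fun _ => x)
  | .seq p q, e, _, .inl l => code p (fun l => e (.inl l)) (e (.inr (entry q))) l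
  | .seq _ q, e, x, .inr l => code q (fun l => e (.inr l)) x l
  | .ite k t p q, e, _, none => .peek k (fun _ o => t o)
      (.branch id (.goto fun _ => e (some (.inl (entry p))))
        (.goto fun _ => e (some (.inr (entry q)))))
  | .ite _ _ p _, e, x, some (.inl l) => code p (fun l => e (some (.inl l))) x l
  | .ite _ _ _ q, e, x, some (.inr l) => code q (fun l => e (some (.inr l))) x l
  | .loop k t p, e, x, none => .peek k (fun _ o => t o)
      (.branch id (.goto fun _ => e (some (entry p))) (.goto fun _ => x))
  | .loop _ _ p, e, _, some l => code p (fun l => e (some l)) (e none) l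

/-- Machine steps between configurations of size at most `B`. -/
def SmallStep {Λ : Type} (m : Λ → TM2.Stmt Γ Λ Bool) (B : ℕ) (a b : TM2.Cfg Γ Λ Bool) : Prop :=
  b ∈ TM2.step m a ∧ stSize a.stk ≤ B ∧ stSize b.stk ≤ B

/-- The label embedding and the continuation label vary, so that the induction applies to
subprograms inside a larger machine. The Boolean register may hold anything on entry, because every
branch is preceded by a `peek` that overwrites it. -/
theorem Run.reaches {Λ : Type} {m : Λ → TM2.Stmt Γ Λ Bool} {B : ℕ} {c : Cmd Γ}
    {s s' : ∀ k, List (Γ k)} (h : Run B c s s') (e : Lbl c → Λ) (x : Λ)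
    (hm : ∀ l, m (e l) = code c e x l) (v : Bool) :
    ∃ v', ReflTransGen (SmallStep m B) ⟨some (e (entry c)), v, s⟩ ⟨some x, v', s'⟩ := by
  induction h generalizing x v with
  | skip h =>
    refine ⟨v, .single ⟨?_, h, h⟩⟩
    simp [TM2.step, hm, code]
  | push h h' =>
    refine ⟨v, .single ⟨?_, h, h'⟩⟩
    simp [TM2.step, hm, code]
  | pop h h' =>
    refine ⟨v, .single ⟨?_, h, h'⟩⟩
    simp [TM2.step, hm, code]
  | @seq p q _ _ _ _ _ ih ih' =>
    obtain ⟨v', h₁⟩ := ih (fun l => e (.inl l)) (e (.inr (entry q))) (fun l => hm (.inl l)) v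
    obtain ⟨v'', h₂⟩ := ih' (fun l => e (.inr l)) x (fun l => hm (.inr l)) v'
    exact ⟨v'', h₁.trans h₂⟩
  | @ite_true k t p q s s' ht h ih =>
    obtain ⟨v', h₁⟩ := ih (fun l => e (some (.inl l))) x (fun l => hm (some (.inl l))) true
    refine ⟨v', .head ⟨?_, h.size_left, h.size_left⟩ h₁⟩
    simp [TM2.step, entry, hm none, code, ht]
  | @ite_false k t p q s s' ht h ih =>
    obtain ⟨v', h₁⟩ := ih (fun l => e (some (.inr l))) x (fun l => hm (some (.inr l))) false
    refine ⟨v', .head ⟨?_, h.size_left, h.size_left⟩ h₁⟩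
    simp [TM2.step, entry, hm none, code, ht]
  | @loop_true k t p s s' s'' ht h _ ih ih' =>
    obtain ⟨v', h₁⟩ := ih (fun l => e (some l)) (e none) (fun l => hm (some l)) true
    obtain ⟨v'', h₂⟩ := ih' e x hm v'
    refine ⟨v'', .head ⟨?_, h.size_left, h.size_left⟩ (h₁.trans h₂)⟩
    simp [TM2.step, entry, hm none, code, ht]
  | @loop_false k t p s ht h =>
    refine ⟨false, .single ⟨?_, h, h⟩⟩
    simp [TM2.step, entry, hm none, code, ht]

/-- The machine that runs `c` and halts. -/
def machine (c : Cmd Γ) : Option (Lbl c) → TM2.Stmt Γ (Option (Lbl c)) Bool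
  | none => .halt
  | some l => code c some none l

theorem Run.machine_reaches {B : ℕ} {c : Cmd Γ} {s s' : ∀ k, List (Γ k)} (h : Run B c s s')
    (v : Bool) : ∃ v', ReflTransGen (SmallStep (machine c) B)
      ⟨some (some (entry c)), v, s⟩ ⟨none, v', s'⟩ := by
  obtain ⟨v', h'⟩ := h.reaches (m := machine c) some none (fun l => rfl) v
  refine ⟨v', h'.tail ⟨by simp [TM2.step, machine], ?_⟩⟩
  have : stSize s' ≤ B := by
    rcases h'.cases_tail with h₀ | ⟨_, _, h₁⟩
    · simp at h₀
    · exact h₁.2.2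
  exact ⟨this, this⟩

/-- The machine is deterministic and `b` has halted, so everything reachable from `a` lies on the
given run. -/
theorem SmallStep.size_le {Λ : Type} {m : Λ → TM2.Stmt Γ Λ Bool} {B : ℕ}
    {a b c : TM2.Cfg Γ Λ Bool} (h : ReflTransGen (SmallStep m B) a b) (hb : b.l = none)
    (hbB : stSize b.stk ≤ B) (hc : ReflTransGen (fun a b => b ∈ TM2.step m a) a c) :
    stSize c.stk ≤ B := by
  induction h using ReflTransGen.head_induction_on with
  | refl =>
    rcases hc.cases_head with rfl | ⟨d, hd, _⟩
    · exact hbB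
    · obtain ⟨l, v, s⟩ := b
      obtain rfl : l = none := hb
      simp [TM2.step] at hd
  | head h₁ _ ih =>
    rcases hc.cases_head with rfl | ⟨d, hd, hdc⟩
    · exact h₁.2.1
    · have := h₁.1
      rw [Option.mem_def] at this hd
      rw [this] at hd
      exact ih ((Option.some.inj hd) ▸ hdc)

end Cmd

open Function

/-! ### Bookkeeping of the space on the stacks -/

section StSize

variable {K : Type} {Γ : K → Type} [DecidableEq K] [Fintype K]

/-- The additive form avoids truncated subtraction and can be passed to `omega`. -/
theorem stSize_update (s : ∀ k, List (Γ k)) (k : K) (l : List (Γ k)) :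
    stSize (update s k l) + (s k).length = stSize s + l.length := by
  unfold stSize
  rw [← Finset.add_sum_erase _ _ (Finset.mem_univ k), ← Finset.add_sum_erase (a := k) _
    (fun i => (s i).length) (Finset.mem_univ k)]
  rw [Finset.sum_congr rfl (g := fun i => (s i).length)]
  · simp; omega
  · intro i hi
    rw [update_of_ne (Finset.ne_of_mem_erase hi)]

theorem Run.skip' {B : ℕ} {s s' : ∀ k, List (Γ k)} (h : stSize s ≤ B) (hs : s = s') :
    Run B .skip s s' := hs ▸ .skip h

theorem Run.push' {B : ℕ} {s s' : ∀ k, List (Γ k)} {k : K} {a : Γ k} (h : stSize s + 1 ≤ B)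
    (hs : update s k (a :: s k) = s') : Run B (.push k a) s s' := by
  subst hs
  refine .push (by omega) ?_
  have := stSize_update s k (a :: s k)
  simp at this; omega

theorem Run.pop' {B : ℕ} {s s' : ∀ k, List (Γ k)} {k : K} (h : stSize s ≤ B)
    (hs : update s k (s k).tail = s') : Run B (.pop k) s s' := by
  subst hs
  refine .pop h ?_
  have := stSize_update s k (s k).tail
  simp at this; omega

end StSize

/-! ### The stacks of the machine and their contents -/

/-- The alphabets of the stacks: bits on the input stack `inl false` and the output stack
`inl true`, bits and a separator `none` on the three working stacks. -/
def SymT : Bool ⊕ Fin 3 → Type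
  | .inl _ => Bool
  | .inr _ => Option Bool

/-- The stacks with given contents. -/
def stk (i o : List Bool) (f : Fin 3 → List (Option Bool)) : ∀ k, List (SymT k)
  | .inl false => i
  | .inl true => o
  | .inr j => f j

theorem stk_inr (i o : List Bool) (f : Fin 3 → List (Option Bool)) (j : Fin 3) :
    stk i o f (.inr j) = f j := rfl

theorem update_stk_inr (i o : List Bool) (f : Fin 3 → List (Option Bool)) (j : Fin 3)
    (l : List (Option Bool)) :
    update (β := fun k => List (SymT k)) (stk i o f) (.inr j) l = stk i o (update f j l) := by
  funext k
  rcases k with (_ | _) | k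
  · exact update_of_ne (β := fun k => List (SymT k)) (by simp) _ _
  · exact update_of_ne (β := fun k => List (SymT k)) (by simp) _ _
  · by_cases h : k = j
    · subst h
      exact (update_self (β := fun k => List (SymT k)) _ _ _).trans (update_self k l f).symm
    · have e : f k = update f j l k := (update_of_ne h l f).symm
      exact (update_of_ne (β := fun k => List (SymT k)) (by simpa using h) _ _).trans e

/-- The total number of symbols on the working stacks. -/
def fsize (f : Fin 3 → List (Option Bool)) : ℕ := ∑ j, (f j).length

theorem stSize_stk (i o : List Bool) (f : Fin 3 → List (Option Bool)) :
    stSize (stk i o f) = i.length + o.length + fsize f := by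
  unfold stSize
  rw [Fintype.sum_sum_type, Fintype.sum_bool]
  exact congrArg (· + fsize f) (Nat.add_comm o.length i.length)

theorem fsize_update (f : Fin 3 → List (Option Bool)) (j : Fin 3) (l : List (Option Bool)) :
    fsize (update f j l) + (f j).length = fsize f + l.length := by
  have := stSize_update (stk [] [] f) (.inr j) l
  rw [update_stk_inr, stSize_stk, stSize_stk, stk_inr] at this
  change 0 + 0 + fsize _ + (f j).length = 0 + 0 + fsize f + l.length at this
  omega

/-- Programs for this machine. -/
abbrev CmdS := Cmd SymT

/-- Push a symbol on a working stack. -/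
def pushS (j : Fin 3) (a : Option Bool) : CmdS := .push (.inr j) a

/-- Pop a symbol from a working stack. -/
def popS (j : Fin 3) : CmdS := .pop (.inr j)

/-- Branch on the top symbol of a working stack. -/
def iteS (j : Fin 3) (t : Option (Option Bool) → Bool) (p q : CmdS) : CmdS := .ite (.inr j) t p q

/-- Loop while the top symbol of a working stack passes a test. -/
def loopS (j : Fin 3) (t : Option (Option Bool) → Bool) (p : CmdS) : CmdS := .loop (.inr j) t p

section Primitives

variable {B : ℕ} {i o : List Bool} {f f' : Fin 3 → List (Option Bool)} {j : Fin 3}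

theorem run_pushS {a : Option Bool} (h : i.length + o.length + fsize f + 1 ≤ B)
    (hf : update f j (a :: f j) = f') : Run B (pushS j a) (stk i o f) (stk i o f') :=
  .push' (by rw [stSize_stk]; exact h) (by rw [← hf]; exact update_stk_inr i o f j _)

theorem run_popS (h : i.length + o.length + fsize f ≤ B)
    (hf : update f j (f j).tail = f') : Run B (popS j) (stk i o f) (stk i o f') :=
  .pop' (by rw [stSize_stk]; exact h) (by rw [← hf]; exact update_stk_inr i o f j _)

end Primitives

/-- The contents of a stack that holds a list of words, each followed by a separator. -/
def encW (L : List (List Bool)) : List (Option Bool) :=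
  L.flatMap fun w => w.map some ++ [none]

@[simp] theorem encW_nil : encW [] = [] := rfl

@[simp] theorem encW_cons (w : List Bool) (L : List (List Bool)) :
    encW (w :: L) = w.map some ++ none :: encW L := by
  simp [encW]

@[simp] theorem encW_append (L L' : List (List Bool)) :
    encW (L ++ L') = encW L ++ encW L' := by
  simp [encW]

/-- The working stacks with lists of words. -/
def wrd (F : Fin 3 → List (List Bool)) (j : Fin 3) : List (Option Bool) := encW (F j)

/-- The stacks with lists of words on the working stacks. -/
def wst (F : Fin 3 → List (List Bool)) : ∀ k, List (SymT k) := stk [] [] (wrd F)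

theorem stSize_wst (F : Fin 3 → List (List Bool)) : stSize (wst F) = fsize (wrd F) := by
  simp [wst, stSize_stk]

theorem update_wrd (F : Fin 3 → List (List Bool)) (j : Fin 3) (L : List (List Bool)) :
    update (wrd F) j (encW L) = wrd (update F j L) := by
  funext i
  by_cases h : i = j
  · subst h; simp [wrd]
  · simp [wrd, h]

theorem fsize_wrd_update (F : Fin 3 → List (List Bool)) (j : Fin 3) (L : List (List Bool)) :
    fsize (wrd (update F j L)) + (encW (F j)).length = fsize (wrd F) + (encW L).length := by
  have := fsize_update (wrd F) j (encW L)
  rwa [update_wrd] at this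

/-! ### Moving and copying words -/

/-- The top symbol is a bit. -/
def isBit : Option (Option Bool) → Bool
  | some (some _) => true
  | _ => false

/-- The top symbol is the bit `b`. -/
def isThe (b : Bool) : Option (Option Bool) → Bool
  | some (some b') => b' == b
  | _ => false

/-- The stack is nonempty. -/
def isTop : Option (Option Bool) → Bool
  | some _ => true
  | none => false

/-- Run `p b`, where `b` is the top bit of stack `i`. -/
def caseBit (i : Fin 3) (p : Bool → CmdS) : CmdS := iteS i (isThe true) (p true) (p false)

/-- The command `pop` discards the symbol it removes, so a program can remember a bit only by
branching on it beforehand. -/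
theorem run_caseBit {B : ℕ} {i : Fin 3} {p : Bool → CmdS} {f : Fin 3 → List (Option Bool)}
    {x y : List Bool} {b : Bool} {A : List (Option Bool)} (hf : f i = some b :: A)
    {s' : ∀ k, List (SymT k)} (h : Run B (p b) (stk x y f) s') :
    Run B (caseBit i p) (stk x y f) s' := by
  have : (stk x y f (.inr i)).head? = some (some b) := by rw [stk_inr, hf]; rfl
  cases b
  · exact .ite_false (by rw [this]; rfl) h
  · exact .ite_true (by rw [this]; rfl) h

/-- Move bits from stack `i` to stack `j` while there are some. -/
def mvBits (i j : Fin 3) : CmdS := loopS i isBit (caseBit i fun b => popS i ;; pushS j (some b))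

/-- Move the top word of stack `i` to stack `j` (which reverses it). -/
def mv (i j : Fin 3) : CmdS := pushS j none ;; mvBits i j ;; popS i

/-- Raw stack contents are needed here, because in the middle of a move the stacks do not hold lists
of complete words. -/
theorem run_mvBits {i j : Fin 3} (hij : i ≠ j) {B : ℕ} (w : List Bool) (A : List (Option Bool))
    (f : Fin 3 → List (Option Bool)) (hf : f i = w.map some ++ A)
    (hA : isBit A.head? = false) (hB : fsize f ≤ B) :
    Run B (mvBits i j) (stk [] [] f)
      (stk [] [] (update (update f i A) j (w.reverse.map some ++ f j))) := by
  induction w generalizing f with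
  | nil =>
    simp only [List.map_nil, List.nil_append] at hf
    have : f = update (update f i A) j (([] : List Bool).reverse.map some ++ f j) := by
      rw [← hf]; simp
    rw [← this]
    refine .loop_false (by rw [stk_inr, hf]; exact hA) (by rw [stSize_stk]; simpa using hB)
  | cons b w ih =>
    let f₁ := update f i (w.map some ++ A)
    let f₂ := update f₁ j (some b :: f j)
    have hsz₁ : fsize f₁ + 1 = fsize f := by
      have := fsize_update f i (w.map some ++ A)
      rw [hf] at this; simp at this; simp only [f₁]; omega
    have h₁j : f₁ j = f j := update_of_ne hij.symm _ _
    have hsz₂ : fsize f₂ = fsize f := by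
      have := fsize_update f₁ j (some b :: f j)
      rw [h₁j] at this; simp at this; simp only [f₂]; omega
    refine .loop_true (s' := stk [] [] f₂) (by rw [stk_inr, hf]; rfl) ?_ ?_
    · refine run_caseBit (by rw [hf]; rfl) (.seq (run_popS (f' := f₁) (by simpa using hB) ?_)
        (run_pushS (by simp; omega) ?_))
      · rw [hf]; rfl
      · rw [h₁j]
    · have := ih f₂ (by simp [f₂, f₁, hij]) (by omega)
      rw [show update (update f i A) j ((b :: w).reverse.map some ++ f j) =
        update (update f₂ i A) j (w.reverse.map some ++ f₂ j) from ?_]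
      · exact this
      funext k
      by_cases hk : k = j
      · subst hk; simp [f₂]
      · by_cases hk' : k = i
        · subst hk'; simp [hk]
        · simp [hk, hk', f₁, f₂]

/-- The extra unit of space is the new separator, which is pushed before the old one is popped. -/
theorem run_mv {i j : Fin 3} (hij : i ≠ j) {B : ℕ} {F : Fin 3 → List (List Bool)}
    {w : List Bool} {A : List (List Bool)} (hF : F i = w :: A) (hB : fsize (wrd F) + 1 ≤ B) :
    Run B (mv i j) (wst F) (wst (update (update F i A) j (w.reverse :: F j))) := by
  let f₁ := update (wrd F) j (none :: wrd F j)
  have hsz₁ : fsize f₁ = fsize (wrd F) + 1 := by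
    have := fsize_update (wrd F) j (none :: wrd F j)
    simp at this; simp only [f₁]; omega
  have h₁i : f₁ i = w.map some ++ none :: encW A := by
    simp [f₁, hij, wrd, hF]
  have h₂ := run_mvBits hij w (none :: encW A) f₁ h₁i rfl (B := B) (by omega)
  refine .seq (run_pushS (f' := f₁) (by simpa using hB) rfl) (.seq h₂ (run_popS ?_ ?_))
  · have e₁ := fsize_update f₁ i (none :: encW A)
    have e₂ := fsize_update (update f₁ i (none :: encW A)) j (w.reverse.map some ++ f₁ j)
    rw [update_of_ne hij.symm] at e₂
    rw [h₁i] at e₁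
    simp only [List.length_append, List.length_map, List.length_cons, List.length_reverse,
      List.length_nil] at e₁ e₂ ⊢
    omega
  · funext k
    by_cases hk : k = j
    · subst hk; simp [f₁, wrd, hij.symm]
    · by_cases hk' : k = i
      · subst hk'; simp [wrd, hk]
      · simp [hk, hk', f₁, wrd]

theorem fsize_mv {i j : Fin 3} (hij : i ≠ j) {F : Fin 3 → List (List Bool)}
    {w : List Bool} {A : List (List Bool)} (hF : F i = w :: A) :
    fsize (wrd (update (update F i A) j (w.reverse :: F j))) = fsize (wrd F) := by
  have e₁ := fsize_wrd_update F i A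
  have e₂ := fsize_wrd_update (update F i A) j (w.reverse :: F j)
  rw [update_of_ne hij.symm] at e₂
  rw [hF] at e₁
  simp at e₁ e₂
  omega

/-- Move `n` words from stack `i` to stack `j`. -/
def mvN (i j : Fin 3) : ℕ → CmdS
  | 0 => .skip
  | n + 1 => mv i j ;; mvN i j n

/-- Moving reverses the order of the words as well as each word; a second move undoes both. -/
theorem run_mvN {i j : Fin 3} (hij : i ≠ j) {B : ℕ} (ws : List (List Bool))
    {F : Fin 3 → List (List Bool)} {A : List (List Bool)} (hF : F i = ws ++ A)
    (hB : fsize (wrd F) + 1 ≤ B) :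
    Run B (mvN i j ws.length) (wst F)
      (wst (update (update F i A) j ((ws.map List.reverse).reverse ++ F j))) := by
  induction ws generalizing F with
  | nil =>
    refine .skip' (by rw [stSize_wst]; omega) ?_
    rw [List.nil_append] at hF
    rw [← hF]; simp
  | cons w ws ih =>
    have h₁ := run_mv hij (w := w) (A := ws ++ A) hF hB
    have e₁ := fsize_mv hij (w := w) (A := ws ++ A) hF
    have h₂ := ih (F := update (update F i (ws ++ A)) j (w.reverse :: F j))
      (by rw [update_of_ne hij, update_self]) (by omega)
    refine .seq h₁ ?_
    convert h₂ using 2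
    funext k
    by_cases hk : k = j
    · subst hk; simp
    · by_cases hk' : k = i
      · subst hk'; simp [hk]
      · simp [hk, hk']

/-! ### Copying words -/

/-- Move the top word of stack `i` to the stacks `j` and `k`. -/
def cp (i j k : Fin 3) : CmdS :=
  pushS j none ;; pushS k none ;;
    (loopS i isBit (caseBit i fun b => popS i ;; pushS j (some b) ;; pushS k (some b))) ;; popS i

theorem run_cpBits {i j k : Fin 3} (hij : i ≠ j) (hik : i ≠ k) (hjk : j ≠ k) {B : ℕ}
    (w : List Bool) (A : List (Option Bool)) (f : Fin 3 → List (Option Bool))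
    (hf : f i = w.map some ++ A) (hA : isBit A.head? = false) (hB : fsize f + w.length ≤ B) :
    Run B (loopS i isBit (caseBit i fun b => popS i ;; pushS j (some b) ;; pushS k (some b)))
      (stk [] [] f) (stk [] [] (update (update (update f i A) j (w.reverse.map some ++ f j)) k
        (w.reverse.map some ++ f k))) := by
  induction w generalizing f with
  | nil =>
    simp only [List.map_nil, List.nil_append] at hf
    have : f = update (update (update f i A) j (([] : List Bool).reverse.map some ++ f j)) k
        (([] : List Bool).reverse.map some ++ f k) := by
      rw [← hf]; simp
    rw [← this]
    refine .loop_false (by rw [stk_inr, hf]; exact hA) (by rw [stSize_stk]; simpa using hB)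
  | cons b w ih =>
    let f₁ := update f i (w.map some ++ A)
    let f₂ := update f₁ j (some b :: f j)
    let f₃ := update f₂ k (some b :: f k)
    have hsz₁ : fsize f₁ + 1 = fsize f := by
      have := fsize_update f i (w.map some ++ A)
      rw [hf] at this; simp at this; simp only [f₁]; omega
    have h₁j : f₁ j = f j := update_of_ne hij.symm _ _
    have hsz₂ : fsize f₂ = fsize f := by
      have := fsize_update f₁ j (some b :: f j)
      rw [h₁j] at this; simp at this; simp only [f₂]; omega
    have h₂k : f₂ k = f k := by simp [f₂, f₁, hjk.symm, hik.symm]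
    have hsz₃ : fsize f₃ = fsize f + 1 := by
      have := fsize_update f₂ k (some b :: f k)
      rw [h₂k] at this; simp at this; simp only [f₃]; omega
    simp only [List.length_cons] at hB
    refine .loop_true (s' := stk [] [] f₃) (by rw [stk_inr, hf]; rfl) ?_ ?_
    · refine run_caseBit (by rw [hf]; rfl) (.seq (run_popS (f' := f₁) (by simp; omega) ?_)
        (.seq (run_pushS (f' := f₂) (by simp; omega) ?_) (run_pushS (by simp; omega) ?_)))
      · rw [hf]; rfl
      · rw [h₁j]
      · rw [h₂k]
    · have := ih f₃ (by simp [f₃, f₂, f₁, hij, hik]) (by omega)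
      rw [show update (update (update f i A) j ((b :: w).reverse.map some ++ f j)) k
          ((b :: w).reverse.map some ++ f k) =
        update (update (update f₃ i A) j (w.reverse.map some ++ f₃ j)) k
          (w.reverse.map some ++ f₃ k) from ?_]
      · exact this
      funext l
      by_cases hk : l = k
      · subst hk; simp [f₃]
      · by_cases hj : l = j
        · subst hj; simp [hk, f₃, f₂]
        · by_cases hi : l = i
          · subst hi; simp [hj, hk]
          · simp [hk, hj, hi, f₁, f₂, f₃]

theorem run_cp {i j k : Fin 3} (hij : i ≠ j) (hik : i ≠ k) (hjk : j ≠ k) {B : ℕ}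
    {F : Fin 3 → List (List Bool)} {w : List Bool} {A : List (List Bool)} (hF : F i = w :: A)
    (hB : fsize (wrd F) + w.length + 2 ≤ B) :
    Run B (cp i j k) (wst F)
      (wst (update (update (update F i A) j (w.reverse :: F j)) k (w.reverse :: F k))) := by
  let f₁ := update (wrd F) j (none :: wrd F j)
  let f₂ := update f₁ k (none :: wrd F k)
  have hsz₁ : fsize f₁ = fsize (wrd F) + 1 := by
    have := fsize_update (wrd F) j (none :: wrd F j)
    simp at this; simp only [f₁]; omega
  have h₁k : f₁ k = wrd F k := by simp [f₁, hjk.symm]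
  have hsz₂ : fsize f₂ = fsize (wrd F) + 2 := by
    have := fsize_update f₁ k (none :: wrd F k)
    rw [h₁k] at this; simp at this; simp only [f₂]; omega
  have h₂i : f₂ i = w.map some ++ none :: encW A := by
    simp [f₁, f₂, hij, hik, wrd, hF]
  have h₃ := run_cpBits hij hik hjk w (none :: encW A) f₂ h₂i rfl (B := B) (by omega)
  have e : ∀ {s s'}, Run B (loopS i isBit (caseBit i fun b => popS i ;; pushS j (some b) ;;
      pushS k (some b))) s (stk [] [] s') → fsize s' ≤ B := by
    intro s s' h
    simpa [stSize_stk] using h.size_right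
  refine .seq (run_pushS (f' := f₁) (by simp; omega) rfl) (.seq (run_pushS (f' := f₂)
    (by simp; omega) (by rw [h₁k])) (.seq h₃ (run_popS (by simpa using e h₃) ?_)))
  funext l
  by_cases hk : l = k
  · subst hk; simp [f₂, wrd, hik.symm, hjk]
  · by_cases hj : l = j
    · subst hj; simp [f₁, f₂, wrd, hij.symm, hk]
    · by_cases hi : l = i
      · subst hi; simp [wrd, hk, hj]
      · simp [hk, hj, hi, f₁, f₂, wrd]

theorem fsize_cp {i j k : Fin 3} (hij : i ≠ j) (hik : i ≠ k) (hjk : j ≠ k)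
    {F : Fin 3 → List (List Bool)} {w : List Bool} {A : List (List Bool)} (hF : F i = w :: A) :
    fsize (wrd (update (update (update F i A) j (w.reverse :: F j)) k (w.reverse :: F k))) =
      fsize (wrd F) + w.length + 1 := by
  have e₁ := fsize_wrd_update F i A
  have e₂ := fsize_wrd_update (update F i A) j (w.reverse :: F j)
  have e₃ := fsize_wrd_update (update (update F i A) j (w.reverse :: F j)) k (w.reverse :: F k)
  rw [update_of_ne hij.symm] at e₂
  rw [update_of_ne hjk.symm, update_of_ne hik.symm] at e₃
  rw [hF] at e₁
  simp at e₁ e₂ e₃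
  omega

/-- Move `n` words from stack `i` to the stacks `j` and `k`. -/
def cpN (i j k : Fin 3) : ℕ → CmdS
  | 0 => .skip
  | n + 1 => cp i j k ;; cpN i j k n

theorem run_cpN {i j k : Fin 3} (hij : i ≠ j) (hik : i ≠ k) (hjk : j ≠ k) {B : ℕ}
    (ws : List (List Bool)) {F : Fin 3 → List (List Bool)} {A : List (List Bool)}
    (hF : F i = ws ++ A) (hB : fsize (wrd F) + (encW ws).length + 1 ≤ B) :
    Run B (cpN i j k ws.length) (wst F)
      (wst (update (update (update F i A) j ((ws.map List.reverse).reverse ++ F j)) k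
        ((ws.map List.reverse).reverse ++ F k))) := by
  induction ws generalizing F with
  | nil =>
    refine .skip' (by rw [stSize_wst]; omega) ?_
    rw [List.nil_append] at hF
    rw [← hF]; simp
  | cons w ws ih =>
    simp only [encW_cons, List.length_append, List.length_cons, List.length_map] at hB
    have h₁ := run_cp hij hik hjk (w := w) (A := ws ++ A) hF (B := B) (by omega)
    have e₁ := fsize_cp hij hik hjk (w := w) (A := ws ++ A) hF
    have h₂ := ih (F := update (update (update F i (ws ++ A)) j (w.reverse :: F j)) k
      (w.reverse :: F k)) (by rw [update_of_ne hik, update_of_ne hij, update_self]) (by omega)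
    refine .seq h₁ ?_
    convert h₂ using 2
    funext l
    by_cases hk : l = k
    · subst hk; simp
    · by_cases hj : l = j
      · subst hj; simp [hk]
      · by_cases hi : l = i
        · subst hi; simp [hj, hk]
        · simp [hk, hj, hi]

theorem fsize_triple (a b c : List (List Bool)) :
    fsize (wrd ![a, b, c]) = (encW a).length + (encW b).length + (encW c).length := by
  simp [fsize, wrd, Fin.sum_univ_three]

/-- Copy `n` words from the data stack to the auxiliary stack. -/
def save (n : ℕ) : CmdS := mvN 0 2 n ;; cpN 2 0 1 n

/-- Move `n` words from the auxiliary stack to the data stack. -/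
def restore (n : ℕ) : CmdS := mvN 1 2 n ;; mvN 2 0 n

/-- Move `n` words from the data stack to the auxiliary stack. -/
def stash (n : ℕ) : CmdS := mvN 0 2 n ;; mvN 2 1 n

theorem length_encW_reverse (ws : List (List Bool)) :
    (encW (ws.map List.reverse).reverse).length = (encW ws).length := by
  induction ws with
  | nil => rfl
  | cons w ws ih => simp [ih]; omega

theorem map_reverse_reverse (ws : List (List Bool)) :
    ((ws.map List.reverse).reverse.map List.reverse).reverse = ws := by
  simp

/-- The detour through stack `2` reverses the words twice, so both copies end up in the original
orientation. -/
theorem run_save {B : ℕ} (ws l r : List (List Bool))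
    (hB : 2 * (encW ws).length + (encW l).length + (encW r).length + 1 ≤ B) :
    Run B (save ws.length) (wst ![ws ++ l, r, []]) (wst ![ws ++ l, ws ++ r, []]) := by
  have h₁ := run_mvN (i := 0) (j := 2) (by decide) (B := B) ws (F := ![ws ++ l, r, []]) (A := l)
    rfl (by rw [fsize_triple]; simp; omega)
  have e₁ : update (update ![ws ++ l, r, []] 0 l) 2 ((ws.map List.reverse).reverse ++
      (![ws ++ l, r, []] : Fin 3 → List (List Bool)) 2) =
      ![l, r, (ws.map List.reverse).reverse] := by
    funext k; fin_cases k <;> simp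
  rw [e₁] at h₁
  have h₂ := run_cpN (i := 2) (j := 0) (k := 1) (by decide) (by decide) (by decide) (B := B)
    (ws.map List.reverse).reverse (F := ![l, r, (ws.map List.reverse).reverse]) (A := [])
    (by simp) (by rw [fsize_triple, length_encW_reverse]; omega)
  rw [map_reverse_reverse] at h₂
  refine .seq h₁ ?_
  convert h₂ using 1
  · simp
  · congr 1
    funext k; fin_cases k <;> simp

theorem run_restore {B : ℕ} (ws l r : List (List Bool))
    (hB : (encW ws).length + (encW l).length + (encW r).length + 1 ≤ B) :
    Run B (restore ws.length) (wst ![l, ws ++ r, []]) (wst ![ws ++ l, r, []]) := by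
  have h₁ := run_mvN (i := 1) (j := 2) (by decide) (B := B) ws (F := ![l, ws ++ r, []]) (A := r)
    rfl (by rw [fsize_triple]; simp; omega)
  have e₁ : update (update ![l, ws ++ r, []] 1 r) 2 ((ws.map List.reverse).reverse ++
      (![l, ws ++ r, []] : Fin 3 → List (List Bool)) 2) =
      ![l, r, (ws.map List.reverse).reverse] := by
    funext k; fin_cases k <;> simp
  rw [e₁] at h₁
  have h₂ := run_mvN (i := 2) (j := 0) (by decide) (B := B)
    (ws.map List.reverse).reverse (F := ![l, r, (ws.map List.reverse).reverse]) (A := [])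
    (by simp) (by rw [fsize_triple, length_encW_reverse]; omega)
  rw [map_reverse_reverse] at h₂
  refine .seq h₁ ?_
  convert h₂ using 1
  · simp
  · congr 1
    funext k; fin_cases k <;> simp

theorem run_stash {B : ℕ} (ws l r : List (List Bool))
    (hB : (encW ws).length + (encW l).length + (encW r).length + 1 ≤ B) :
    Run B (stash ws.length) (wst ![ws ++ l, r, []]) (wst ![l, ws ++ r, []]) := by
  have h₁ := run_mvN (i := 0) (j := 2) (by decide) (B := B) ws (F := ![ws ++ l, r, []]) (A := l)
    rfl (by rw [fsize_triple]; simp; omega)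
  have e₁ : update (update ![ws ++ l, r, []] 0 l) 2 ((ws.map List.reverse).reverse ++
      (![ws ++ l, r, []] : Fin 3 → List (List Bool)) 2) =
      ![l, r, (ws.map List.reverse).reverse] := by
    funext k; fin_cases k <;> simp
  rw [e₁] at h₁
  have h₂ := run_mvN (i := 2) (j := 1) (by decide) (B := B)
    (ws.map List.reverse).reverse (F := ![l, r, (ws.map List.reverse).reverse]) (A := [])
    (by simp) (by rw [fsize_triple, length_encW_reverse]; omega)
  rw [map_reverse_reverse] at h₂
  refine .seq h₁ ?_
  convert h₂ using 1
  · simp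
  · congr 1
    funext k; fin_cases k <;> simp

/-- Remove `n` words from the data stack. -/
def drops : ℕ → CmdS
  | 0 => .skip
  | n + 1 => (loopS 0 isBit (popS 0)) ;; popS 0 ;; drops n

theorem wrd_triple (D R T : List (List Bool)) : wrd ![D, R, T] = ![encW D, encW R, encW T] := by
  funext k; fin_cases k <;> rfl

theorem fsize_triple' (a b c : List (Option Bool)) :
    fsize ![a, b, c] = a.length + b.length + c.length := by
  simp [fsize, Fin.sum_univ_three]

theorem run_dropBits {B : ℕ} (w : List Bool) (A r t : List (Option Bool))
    (hA : isBit A.head? = false)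
    (hB : w.length + A.length + r.length + t.length ≤ B) :
    Run B (loopS 0 isBit (popS 0)) (stk [] [] ![w.map some ++ A, r, t]) (stk [] [] ![A, r, t]) := by
  induction w with
  | nil => exact .loop_false hA (by rw [stSize_stk, fsize_triple']; simpa using hB)
  | cons b w ih =>
    simp only [List.length_cons] at hB
    refine .loop_true rfl (run_popS (f' := ![w.map some ++ A, r, t]) ?_ ?_) (ih (by omega))
    · rw [fsize_triple']; simp; omega
    · funext k; fin_cases k <;> simp

theorem run_drops {B : ℕ} (ws l r : List (List Bool))
    (hB : (encW ws).length + (encW l).length + (encW r).length ≤ B) :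
    Run B (drops ws.length) (wst ![ws ++ l, r, []]) (wst ![l, r, []]) := by
  induction ws with
  | nil => exact .skip' (by rw [stSize_wst, fsize_triple]; simpa using hB) rfl
  | cons w ws ih =>
    simp only [encW_cons, List.length_append, List.length_cons, List.length_map] at hB
    refine .seq ?_ (.seq (run_popS (f' := wrd ![ws ++ l, r, []]) (i := []) (o := [])
      (f := ![none :: encW (ws ++ l), encW r, []]) ?_ ?_) (ih (by omega)))
    · have := run_dropBits w (none :: encW (ws ++ l)) (encW r) (encW []) rfl (B := B)
        (by simp; omega)
      unfold wst
      rw [wrd_triple]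
      simpa using this
    · rw [fsize_triple']; simp; omega
    · rw [wrd_triple]
      funext k; fin_cases k <;> simp

/-! ### Numbers in bijective base two -/

/-- The successor in bijective base two, where the digits `false` and `true` have the values
`1` and `2`, least significant digit first. -/
def incW : List Bool → List Bool
  | [] => [false]
  | false :: w => true :: w
  | true :: w => false :: incW w

/-- The value of a word in bijective base two. -/
def val : List Bool → ℕ
  | [] => 0
  | b :: w => 2 * val w + (if b then 2 else 1)

/-- The word of a number in bijective base two. -/
def word (n : ℕ) : List Bool := incW^[n] []

theorem val_incW (w : List Bool) : val (incW w) = val w + 1 := by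
  induction w with
  | nil => rfl
  | cons b w ih => cases b <;> simp [incW, val, ih]; omega

@[simp] theorem val_word (n : ℕ) : val (word n) = n := by
  induction n with
  | zero => rfl
  | succ n ih => rw [word, iterate_succ_apply', ← word, val_incW, ih]

/-- The parity of the value determines the lowest digit, and zero has only the empty word. Without a
digit zero there are no leading zeros, so every bit string is the word of exactly one number; in
particular no input is lost when it is read as a number. -/
theorem val_injective : Injective val := by
  intro v w h
  induction v generalizing w with
  | nil =>
    cases w with
    | nil => rfl
    | cons b w => cases b <;> simp [val] at h
  | cons a v ih =>
    cases w with
    | nil => cases a <;> simp [val] at h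
    | cons b w =>
      have : a = b ∧ val v = val w := by
        cases a <;> cases b <;> simp [val] at h ⊢ <;> omega
      rw [this.1, ih this.2]

@[simp] theorem word_val (w : List Bool) : word (val w) = w := val_injective (val_word _)

@[simp] theorem word_zero : word 0 = [] := rfl

theorem word_succ (n : ℕ) : word (n + 1) = incW (word n) := by
  rw [word, iterate_succ_apply', ← word]

theorem word_eq_nil {n : ℕ} : word n = [] ↔ n = 0 := by
  constructor
  · intro h
    rw [← val_word n, h]; rfl
  · rintro rfl; rfl

theorem two_pow_length_le (w : List Bool) : 2 ^ w.length ≤ val w + 1 := by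
  induction w with
  | nil => simp [val]
  | cons b w ih => cases b <;> simp [val, pow_succ] <;> omega

theorem lt_two_pow_length (w : List Bool) : val w + 1 < 2 ^ (w.length + 1) := by
  induction w with
  | nil => simp [val]
  | cons b w ih => cases b <;> simp [val, pow_succ] at ih ⊢ <;> omega

/-- The length of the word of a number. -/
def len (n : ℕ) : ℕ := (word n).length

/-- Together with `lt_two_pow_len` this pins `len n` down as the integer part of the binary
logarithm of `n + 1`; the estimates of lengths rest on it. -/
theorem two_pow_len_le (n : ℕ) : 2 ^ len n ≤ n + 1 := by
  simpa [len] using two_pow_length_le (word n)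

theorem lt_two_pow_len (n : ℕ) : n + 1 < 2 ^ (len n + 1) := by
  simpa [len] using lt_two_pow_length (word n)

@[simp] theorem len_val (w : List Bool) : len (val w) = w.length := by simp [len]

theorem len_lt_of_lt {n k : ℕ} (h : n + 1 < 2 ^ k) : len n < k :=
  (Nat.pow_lt_pow_iff_right (by norm_num : 1 < 2)).1 ((two_pow_len_le n).trans_lt h)

theorem len_mono {m n : ℕ} (h : m ≤ n) : len m ≤ len n :=
  Nat.lt_succ_iff.1 (len_lt_of_lt ((Nat.succ_le_succ h).trans_lt (lt_two_pow_len n)))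

theorem len_le (n : ℕ) : len n ≤ n :=
  Nat.lt_succ_iff.1 (len_lt_of_lt (by
    rw [pow_succ]; have := Nat.lt_two_pow_self (n := n); omega))

theorem incW_replicate (a : ℕ) (w : List Bool) :
    incW (List.replicate a true ++ w) = List.replicate a false ++ incW w := by
  induction a with
  | zero => rfl
  | succ a ih => simp [List.replicate_succ, incW, ih]

theorem exists_replicate (b : Bool) (w : List Bool) :
    ∃ a w', w = List.replicate a b ++ w' ∧ (w' = [] ∨ ∃ v, w' = (!b) :: v) := by
  induction w with
  | nil => exact ⟨0, [], rfl, .inl rfl⟩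
  | cons c w ih =>
    by_cases h : c = b
    · subst h
      obtain ⟨a, w', rfl, hw⟩ := ih
      exact ⟨a + 1, w', rfl, hw⟩
    · refine ⟨0, c :: w, rfl, .inr ⟨w, ?_⟩⟩
      cases b <;> cases c <;> simp_all

/-! ### Successor and predecessor on the data stack -/

/-- Remove the leading digits `b` of the top word and count them on the third stack. -/
def unload (b : Bool) : CmdS := loopS 0 (isThe b) (popS 0 ;; pushS 2 (some (!b)))

/-- Put back the digits `b` that are counted on the third stack. -/
def reload (b : Bool) : CmdS := loopS 2 isTop (popS 2 ;; pushS 0 (some b))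

/-- Increment the number on top of the data stack. -/
def inc : CmdS :=
  unload true ;; (iteS 0 (isThe false) (popS 0 ;; pushS 0 (some true)) (pushS 0 (some false))) ;;
    reload false

/-- Decrement the number on top of the data stack. -/
def dec : CmdS :=
  unload false ;; (iteS 0 (isThe true) (popS 0 ;; pushS 0 (some false)) (popS 2)) ;; reload true

/-- The leading run of equal digits is exactly what a carry changes. It is counted in unary on the
third stack; `c` is the count so far. -/
theorem run_unload {B : ℕ} (b : Bool) (a c : ℕ) (A r : List (Option Bool))
    (hA : isThe b A.head? = false) (hB : a + c + A.length + r.length ≤ B) :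
    Run B (unload b) (stk [] [] ![List.replicate a (some b) ++ A, r, List.replicate c (some !b)])
      (stk [] [] ![A, r, List.replicate (a + c) (some !b)]) := by
  induction a generalizing c with
  | zero =>
    rw [Nat.zero_add]
    exact .loop_false hA (by rw [stSize_stk, fsize_triple']; simp; omega)
  | succ a ih =>
    have h := ih (c + 1) (by omega)
    rw [show a + (c + 1) = a + 1 + c by omega] at h
    refine .loop_true (by cases b <;> rfl) (.seq (run_popS
      (f' := ![List.replicate a (some b) ++ A, r, List.replicate c (some !b)]) ?_ ?_)
      (run_pushS ?_ ?_)) h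
    · rw [fsize_triple']; simp; omega
    · funext k; fin_cases k <;> simp [List.replicate_succ]
    · rw [fsize_triple']; simp; omega
    · funext k; fin_cases k <;> simp [List.replicate_succ]

theorem run_reload {B : ℕ} (b b' : Bool) (a : ℕ) (A r : List (Option Bool))
    (hB : a + A.length + r.length ≤ B) :
    Run B (reload b) (stk [] [] ![A, r, List.replicate a (some b')])
      (stk [] [] ![List.replicate a (some b) ++ A, r, []]) := by
  induction a generalizing A with
  | zero => exact .loop_false rfl (by rw [stSize_stk, fsize_triple']; simp; omega)
  | succ a ih =>
    have h := ih (some b :: A) (by simp; omega)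
    rw [show List.replicate a (some b) ++ some b :: A = List.replicate (a + 1) (some b) ++ A by
      rw [List.replicate_succ']; simp] at h
    refine .loop_true rfl (.seq (run_popS (f' := ![A, r, List.replicate a (some b')]) ?_ ?_)
      (run_pushS (f' := ![some b :: A, r, List.replicate a (some b')]) ?_ ?_)) h
    · rw [fsize_triple']; simp; omega
    · funext k; fin_cases k <;> simp [List.replicate_succ]
    · rw [fsize_triple']; simp; omega
    · funext k; fin_cases k <;> simp

/-- A carry turns the leading digits `true` into `false` and then raises the next digit, or appends
a new `false` when the word is exhausted. -/
theorem run_inc_word {B : ℕ} (w : List Bool) (A r : List (Option Bool))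
    (hB : w.length + A.length + r.length + 2 ≤ B) :
    Run B inc (stk [] [] ![w.map some ++ none :: A, r, []])
      (stk [] [] ![(incW w).map some ++ none :: A, r, []]) := by
  obtain ⟨a, w', rfl, hw⟩ := exists_replicate true w
  simp only [List.length_append, List.length_replicate] at hB
  have h₁ := run_unload (B := B) true a 0 (w'.map some ++ none :: A) r
    (by rcases hw with rfl | ⟨v, rfl⟩ <;> rfl) (by simp; omega)
  have h₃ := run_reload (B := B) false (!true) a ((incW w').map some ++ none :: A) r
    (by rcases hw with rfl | ⟨v, rfl⟩ <;> simp [incW] at hB ⊢ <;> omega)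
  rw [incW_replicate]
  simp only [List.map_append, List.map_replicate, List.append_assoc]
  refine .seq h₁ (.seq ?_ h₃)
  rcases hw with rfl | ⟨v, rfl⟩
  · refine .ite_false rfl (run_pushS ?_ ?_)
    · rw [fsize_triple']; simp at hB ⊢; omega
    · funext k; fin_cases k <;> simp [incW]
  · refine .ite_true rfl (.seq
      (run_popS (f' := ![v.map some ++ none :: A, r, List.replicate a (some false)]) ?_ ?_)
      (run_pushS ?_ ?_))
    · rw [fsize_triple']; simp at hB ⊢; omega
    · funext k; fin_cases k <;> simp
    · rw [fsize_triple']; simp at hB ⊢; omega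
    · funext k; fin_cases k <;> simp [incW]

theorem run_dec_word {B : ℕ} (w : List Bool) (A r : List (Option Bool))
    (hB : w.length + A.length + r.length + 2 ≤ B) :
    Run B dec (stk [] [] ![(incW w).map some ++ none :: A, r, []])
      (stk [] [] ![w.map some ++ none :: A, r, []]) := by
  obtain ⟨a, w', rfl, hw⟩ := exists_replicate true w
  simp only [List.length_append, List.length_replicate] at hB
  rw [incW_replicate]
  rcases hw with rfl | ⟨v, rfl⟩
  · have h₁ := run_unload (B := B) false (a + 1) 0 (none :: A) r rfl (by simp at hB ⊢; omega)
    have h₃ := run_reload (B := B) true (!false) a (none :: A) r (by simp at hB ⊢; omega)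
    have e₁ : (List.replicate a false ++ incW []).map some ++ none :: A =
      List.replicate (a + 1) (some false) ++ none :: A := by
        rw [List.replicate_succ']; simp [incW]
    have e₂ : (List.replicate a true ++ []).map some ++ none :: A =
      List.replicate a (some true) ++ none :: A := by simp
    rw [e₁, e₂]
    -- All `a + 1` digits are `false`, so the word becomes shorter by one: a mark is removed from
    -- the third stack before the digits are put back.
    refine .seq h₁ (.seq (.ite_false rfl (run_popS ?_ ?_)) h₃)
    · rw [fsize_triple']; simp at hB ⊢; omega
    · funext k; fin_cases k <;> simp [List.replicate_succ]
  · have h₁ := run_unload (B := B) false a 0 (some true :: (v.map some ++ none :: A)) r rfl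
      (by simp at hB ⊢; omega)
    have h₃ := run_reload (B := B) true (!false) a (some false :: (v.map some ++ none :: A)) r
      (by simp at hB ⊢; omega)
    have e₁ : (List.replicate a false ++ incW ((!true) :: v)).map some ++ none :: A =
      List.replicate a (some false) ++ some true :: (v.map some ++ none :: A) := by simp [incW]
    have e₂ : (List.replicate a true ++ (!true) :: v).map some ++ none :: A =
      List.replicate a (some true) ++ some false :: (v.map some ++ none :: A) := by simp
    rw [e₁, e₂]
    refine .seq h₁ (.seq (.ite_true rfl (.seq
      (run_popS (f' := ![v.map some ++ none :: A, r, List.replicate a (some true)]) ?_ ?_)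
      (run_pushS ?_ ?_))) h₃)
    · rw [fsize_triple']; simp at hB ⊢; omega
    · funext k; fin_cases k <;> simp
    · rw [fsize_triple']; simp at hB ⊢; omega
    · funext k; fin_cases k <;> simp

/-- Here the third stack is empty and popping it has no effect, which gives the truncated
predecessor of zero. -/
theorem run_dec_nil {B : ℕ} (A r : List (Option Bool)) (hB : A.length + r.length + 1 ≤ B) :
    Run B dec (stk [] [] ![none :: A, r, []]) (stk [] [] ![none :: A, r, []]) := by
  refine .seq (run_unload (B := B) false 0 0 (none :: A) r rfl (by simp; omega)) (.seq
    (.ite_false rfl (run_popS ?_ ?_)) (run_reload (B := B) true true 0 (none :: A) r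
      (by simp; omega)))
  · rw [fsize_triple']; simp; omega
  · funext k; fin_cases k <;> simp

/-! ### Stacks of numbers -/

/-- The number of symbols that a list of numbers takes on a stack. -/
def nsize (l : List ℕ) : ℕ := (encW (l.map word)).length

@[simp] theorem nsize_nil : nsize [] = 0 := rfl

@[simp] theorem nsize_cons (n : ℕ) (l : List ℕ) : nsize (n :: l) = len n + 1 + nsize l := by
  simp [nsize, len]; omega

@[simp] theorem nsize_append (l l' : List ℕ) : nsize (l ++ l') = nsize l + nsize l' := by
  simp [nsize]

/-- The configuration with the numbers `l` on the data stack and `r` on the auxiliary stack. -/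
def nst (l r : List ℕ) : ∀ k, List (SymT k) := wst ![l.map word, r.map word, []]

theorem stSize_nst (l r : List ℕ) : stSize (nst l r) = nsize l + nsize r := by
  rw [nst, stSize_wst, fsize_triple]; rfl

theorem nst_cons (n : ℕ) (l r : List ℕ) : nst (n :: l) r =
    stk [] [] ![(word n).map some ++ none :: encW (l.map word), encW (r.map word), []] := by
  rw [nst, wst, wrd_triple]; simp

section Ops

variable {B : ℕ} (x l r : List ℕ)

theorem Run.save (hB : 2 * nsize x + nsize l + nsize r + 1 ≤ B) :
    Run B (save x.length) (nst (x ++ l) r) (nst (x ++ l) (x ++ r)) := by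
  have := run_save (B := B) (x.map word) (l.map word) (r.map word) hB
  simpa [nst] using this

theorem Run.restore (hB : nsize x + nsize l + nsize r + 1 ≤ B) :
    Run B (restore x.length) (nst l (x ++ r)) (nst (x ++ l) r) := by
  have := run_restore (B := B) (x.map word) (l.map word) (r.map word) hB
  simpa [nst] using this

theorem Run.stash (hB : nsize x + nsize l + nsize r + 1 ≤ B) :
    Run B (stash x.length) (nst (x ++ l) r) (nst l (x ++ r)) := by
  have := run_stash (B := B) (x.map word) (l.map word) (r.map word) hB
  simpa [nst] using this

theorem Run.drops (hB : nsize x + nsize l + nsize r ≤ B) :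
    Run B (drops x.length) (nst (x ++ l) r) (nst l r) := by
  have := run_drops (B := B) (x.map word) (l.map word) (r.map word) hB
  simpa [nst] using this

/-- Zero is the empty word, so its whole encoding is one separator. -/
theorem Run.zero (hB : nsize l + nsize r + 1 ≤ B) :
    Run B (pushS 0 none) (nst l r) (nst (0 :: l) r) := by
  rw [nst_cons, nst, wst, wrd_triple]
  refine run_pushS ?_ ?_
  · rw [fsize_triple']; simpa [nsize] using hB
  · funext k; fin_cases k <;> simp

theorem Run.inc (n : ℕ) (hB : nsize (n :: l) + nsize r + 1 ≤ B) :
    Run B inc (nst (n :: l) r) (nst ((n + 1) :: l) r) := by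
  rw [nst_cons, nst_cons, word_succ]
  exact run_inc_word _ _ _ (by simp [nsize] at hB ⊢; omega)

theorem Run.dec (n : ℕ) (hB : nsize (n :: l) + nsize r + 1 ≤ B) :
    Run B dec (nst (n :: l) r) (nst ((n - 1) :: l) r) := by
  rw [nst_cons, nst_cons]
  cases n with
  | zero => exact run_dec_nil _ _ (by simp [nsize] at hB ⊢; omega)
  | succ n =>
    rw [word_succ]
    refine run_dec_word _ _ _ ?_
    have := len_mono (Nat.le_succ n)
    simp [nsize, len] at hB this ⊢; omega

end Ops

open Polynomial

/-! ### Functions computable in polynomial space -/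

/-- Types whose elements are encoded by a fixed number of natural numbers. -/
class Enc (α : Type) where
  /-- the number of natural numbers -/
  arity : ℕ
  /-- the encoding -/
  enc : α → List ℕ
  length_enc : ∀ a, (enc a).length = arity

/-- The number of symbols that the encoding of `a` takes. -/
def esz {α : Type} [Enc α] (a : α) : ℕ := nsize (Enc.enc a)

instance : Enc ℕ := ⟨1, fun n => [n], fun _ => rfl⟩

/-- With truth values among the encoded types, predicates are functions like any other, and
`PolySpace` covers decision procedures too. -/
noncomputable instance : Enc Prop := ⟨1, fun p => [indicator p], fun _ => rfl⟩

instance {α β : Type} [Enc α] [Enc β] : Enc (α × β) :=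
  ⟨Enc.arity α + Enc.arity β, fun x => Enc.enc x.1 ++ Enc.enc x.2, fun x => by
    rw [List.length_append, Enc.length_enc, Enc.length_enc]⟩

theorem enc_nat (n : ℕ) : Enc.enc n = [n] := rfl

theorem enc_prop (p : Prop) : Enc.enc p = [indicator p] := rfl

theorem enc_mk {α β : Type} [Enc α] [Enc β] (a : α) (b : β) :
    Enc.enc (a, b) = Enc.enc a ++ Enc.enc b := rfl

theorem esz_nat (n : ℕ) : esz n = len n + 1 := by simp [esz, enc_nat]

theorem esz_mk {α β : Type} [Enc α] [Enc β] (a : α) (b : β) : esz (a, b) = esz a + esz b := by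
  simp [esz, enc_mk]

theorem indicator_true {p : Prop} (h : p) : indicator p = 1 := by simp [indicator, h]

theorem indicator_false {p : Prop} (h : ¬ p) : indicator p = 0 := by simp [indicator, h]

theorem indicator_le (p : Prop) : indicator p ≤ 1 := by
  unfold indicator; split <;> simp

theorem indicator_eq_one {p : Prop} : indicator p = 1 ↔ p := by
  by_cases h : p <;> simp [indicator, h]

theorem indicator_eq_zero {p : Prop} : indicator p = 0 ↔ ¬ p := by
  by_cases h : p <;> simp [indicator, h]

theorem eval_mono (p : ℕ[X]) : Monotone fun n => p.eval n := by
  intro m n h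
  simp only [eval_eq_sum, Polynomial.sum]
  exact Finset.sum_le_sum fun i _ => Nat.mul_le_mul_left _ (Nat.pow_le_pow_left h i)

section

variable {α β γ σ : Type} [Enc α] [Enc β] [Enc γ] [Enc σ]

/-- `f` is computed by a program whose space is bounded by a polynomial in the size of the
argument (apart from the space for the rest of the stacks, which the program does not touch). -/
@[fun_prop]
def PolySpace (f : α → β) : Prop :=
  ∃ (c : CmdS) (p : ℕ[X]), ∀ x l r, Run (p.eval (esz x) + nsize l + nsize r) c
    (nst (Enc.enc x ++ l) r) (nst (Enc.enc (f x) ++ l) r)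

theorem PolySpace.of_enc_eq {f : α → β} {g : α → γ} (hf : PolySpace f)
    (h : ∀ x, Enc.enc (g x) = Enc.enc (f x)) : PolySpace g := by
  obtain ⟨c, p, H⟩ := hf
  exact ⟨c, p, fun x l r => by rw [h]; exact H x l r⟩

/-- The result is on the stacks at the end of the run, so the space bound also bounds its size. This
is what makes polynomial bounds compose. -/
theorem PolySpace.exists_esz_le {f : α → β} (hf : PolySpace f) :
    ∃ p : ℕ[X], ∀ x, esz (f x) ≤ p.eval (esz x) := by
  obtain ⟨c, p, H⟩ := hf
  refine ⟨p, fun x => ?_⟩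
  have := (H x [] []).size_right
  simpa [stSize_nst, esz] using this

@[fun_prop]
theorem PolySpace.id : PolySpace fun x : α => x :=
  ⟨.skip, X, fun x l r => .skip (by rw [stSize_nst, eval_X]; simp [esz])⟩

@[fun_prop]
theorem PolySpace.comp {g : β → γ} {f : α → β} (hg : PolySpace g) (hf : PolySpace f) :
    PolySpace fun x => g (f x) := by
  obtain ⟨c, p, H⟩ := hf
  obtain ⟨d, q, H'⟩ := hg
  refine ⟨c ;; d, p + q.comp p, fun x l r => ?_⟩
  have h₁ := (H x [] []).size_right
  have h₂ : q.eval (esz (f x)) ≤ q.eval (p.eval (esz x)) :=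
    eval_mono q (by simpa [stSize_nst, esz] using h₁)
  simp only [eval_add, eval_comp]
  exact .seq ((H x l r).mono (by omega)) ((H' (f x) l r).mono (by omega))

/-- Push a number on the data stack. -/
def pushNat : ℕ → CmdS
  | 0 => pushS 0 none
  | n + 1 => pushNat n ;; inc

/-- Push a list of numbers on the data stack. -/
def pushList : List ℕ → CmdS
  | [] => .skip
  | n :: l => pushList l ;; pushNat n

theorem run_pushNat {B : ℕ} (n : ℕ) (l r : List ℕ) (hB : len n + nsize l + nsize r + 2 ≤ B) :
    Run B (pushNat n) (nst l r) (nst (n :: l) r) := by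
  induction n with
  | zero => exact Run.zero l r (by omega)
  | succ n ih =>
    have : len n ≤ len (n + 1) := len_mono (Nat.le_succ n)
    exact .seq (ih (by omega)) (Run.inc l r n (by simp at *; omega))

theorem run_pushList {B : ℕ} (x l r : List ℕ) (hB : nsize x + nsize l + nsize r + 1 ≤ B) :
    Run B (pushList x) (nst l r) (nst (x ++ l) r) := by
  induction x with
  | nil => exact .skip (by rw [stSize_nst]; omega)
  | cons n x ih =>
    simp only [nsize_cons] at hB
    exact .seq (ih (by omega)) (run_pushNat n _ r (by simp; omega))

@[fun_prop]
theorem PolySpace.const (b : β) : PolySpace fun _ : α => b := by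
  refine ⟨drops (Enc.arity α) ;; pushList (Enc.enc b), X + C (esz b + 1), fun x l r => ?_⟩
  simp only [eval_add, eval_X, eval_C]
  rw [← Enc.length_enc x]
  exact .seq (Run.drops _ l r (by simp [esz])) (run_pushList _ l r (by simp [esz]; omega))

-- A copy of the argument waits on the auxiliary stack while `g` is computed. The second component
-- comes first, because the first one has to lie on top.
@[fun_prop]
theorem PolySpace.prodMk {f : α → β} {g : α → γ} (hf : PolySpace f) (hg : PolySpace g) :
    PolySpace fun x => (f x, g x) := by
  obtain ⟨c, p, H⟩ := hf
  obtain ⟨d, q, H'⟩ := hg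
  refine ⟨save (Enc.arity α) ;; d ;; restore (Enc.arity α) ;; c, 2 * X + 1 + p + q,
    fun x l r => ?_⟩
  have h₁ := (H' x [] []).size_right
  simp only [stSize_nst, nsize_append, nsize_nil] at h₁
  rw [← Enc.length_enc x, enc_mk, List.append_assoc]
  simp only [eval_add, eval_mul, eval_ofNat, eval_X, eval_one]
  refine .seq (Run.save _ l r (by simp [esz]; omega)) (.seq ((H' x l _).mono
    (by simp [esz]; omega)) (.seq (Run.restore _ _ r (by simp [esz] at *; omega))
      ((H x _ r).mono (by simp [esz] at *; omega))))

@[fun_prop]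
theorem PolySpace.fst {f : α → β × γ} (hf : PolySpace f) : PolySpace fun x => (f x).1 := by
  have : PolySpace fun x : β × γ => x.1 := by
    refine ⟨stash (Enc.arity β) ;; drops (Enc.arity γ) ;; restore (Enc.arity β), X + 1,
      fun x l r => ?_⟩
    obtain ⟨a, b⟩ := x
    rw [esz_mk, enc_mk, List.append_assoc, ← Enc.length_enc a, ← Enc.length_enc b]
    simp only [eval_add, eval_X, eval_one]
    exact .seq (Run.stash _ _ r (by simp [esz]; omega)) (.seq (Run.drops _ _ _
      (by simp [esz]; omega)) (Run.restore _ _ r (by simp [esz])))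
  exact this.comp hf

@[fun_prop]
theorem PolySpace.snd {f : α → β × γ} (hf : PolySpace f) : PolySpace fun x => (f x).2 := by
  have : PolySpace fun x : β × γ => x.2 := by
    refine ⟨drops (Enc.arity β), X, fun x l r => ?_⟩
    obtain ⟨a, b⟩ := x
    rw [esz_mk, enc_mk, List.append_assoc, ← Enc.length_enc a]
    simp only [eval_X]
    exact Run.drops _ _ _ (by simp [esz]; omega)
  exact this.comp hf

theorem isBit_nst (n : ℕ) (l r : List ℕ) :
    isBit (nst (n :: l) r (.inr 0)).head? = decide (n ≠ 0) := by
  rw [nst_cons, stk_inr, Matrix.cons_val_zero]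
  rcases h : word n with _ | ⟨b, w⟩
  · obtain rfl := word_eq_nil.1 h
    rfl
  · have : n ≠ 0 := fun h' => by simp [h'] at h
    rw [decide_eq_true this]
    rfl

@[fun_prop]
theorem PolySpace.ite {c : α → Prop} [∀ x, Decidable (c x)] {f g : α → β} (hc : PolySpace c)
    (hf : PolySpace f) (hg : PolySpace g) : PolySpace fun x => if c x then f x else g x := by
  obtain ⟨d, o, H₀⟩ := hc
  obtain ⟨d₁, p, H₁⟩ := hf
  obtain ⟨d₂, q, H₂⟩ := hg
  refine ⟨save (Enc.arity α) ;; d ;; iteS 0 isBit (drops 1 ;; restore (Enc.arity α) ;; d₁)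
    (drops 1 ;; restore (Enc.arity α) ;; d₂), 2 * X + 1 + o + p + q, fun x l r => ?_⟩
  have h₁ := (H₀ x [] []).size_right
  simp only [stSize_nst, nsize_append, nsize_nil] at h₁
  rw [← Enc.length_enc x]
  simp only [eval_add, eval_mul, eval_ofNat, eval_X, eval_one]
  refine .seq (Run.save _ l r (by simp [esz]; omega)) (.seq ((H₀ x l _).mono
    (by simp [esz]; omega)) ?_)
  have hd : Run (2 * esz x + 1 + o.eval (esz x) + p.eval (esz x) + q.eval (esz x) + nsize l +
      nsize r) (IteratedGames.drops 1) (nst (Enc.enc (c x) ++ l) (Enc.enc x ++ r))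
      (nst l (Enc.enc x ++ r)) :=
    Run.drops (Enc.enc (c x)) _ _ (by simp [esz] at *; omega)
  have hr : Run (2 * esz x + 1 + o.eval (esz x) + p.eval (esz x) + q.eval (esz x) + nsize l +
      nsize r) (IteratedGames.restore (Enc.enc x).length) (nst l (Enc.enc x ++ r))
      (nst (Enc.enc x ++ l) r) := Run.restore _ _ r (by simp [esz] at *; omega)
  by_cases h : c x
  · rw [if_pos h]
    refine .ite_true ?_ (.seq hd (.seq hr ((H₁ x l r).mono (by omega))))
    exact (isBit_nst _ l _).trans (by simp [indicator, h])
  · rw [if_neg h]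
    refine .ite_false ?_ (.seq hd (.seq hr ((H₂ x l r).mono (by omega))))
    exact (isBit_nst _ l _).trans (by simp [indicator, h])

/-- Only the sizes of the visited states are restricted, not their number, so loops may run
exponentially long. The chain in `H` supplies both termination and result. -/
theorem PolySpace.while {f i : β → α} {h : α → α} {c : α → Prop} (hi : PolySpace i)
    (hh : PolySpace h) (hc : PolySpace c) (q : ℕ[X])
    (H : ∀ x, ReflTransGen (fun s s' => c s ∧ s' = h s ∧ esz s' ≤ q.eval (esz x))
      (i x) (f x) ∧ ¬ c (f x)) : PolySpace f := by
  obtain ⟨e, u, Hi⟩ := hi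
  obtain ⟨t, p, Ht⟩ := hc.prodMk PolySpace.id
  obtain ⟨d, o, Hd⟩ := hh
  -- At each test the truth value of the guard lies above the state; the body uncovers the state,
  -- replaces it and evaluates the guard again.
  refine ⟨e ;; t ;; loopS 0 isBit (drops 1 ;; d ;; t) ;; drops 1,
    u + p.comp (q + u) + o.comp (q + u),
    fun x l r => ?_⟩
  simp only [eval_add, eval_comp]
  -- The bound `q` concerns only the states after the initial one; `i x` is bounded by the space `u`
  -- of its own program.
  set Q := q.eval (esz x) + u.eval (esz x) with hQ
  have hp : ∀ s : α, esz s ≤ Q → p.eval (esz s) ≤ p.eval Q := fun s hs => eval_mono p hs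
  have ho : ∀ s : α, esz s ≤ Q → o.eval (esz s) ≤ o.eval Q := fun s hs => eval_mono o hs
  have hsz : ∀ s : α, esz s ≤ Q → nsize (Enc.enc (c s, s)) ≤ p.eval Q := fun s hs => by
    have h₁ := (Ht s [] []).size_right
    simp only [stSize_nst, nsize_append, nsize_nil] at h₁
    have := hp s hs
    omega
  have hdrop : ∀ s : α, esz s ≤ Q → Run (u.eval (esz x) + p.eval Q + o.eval Q + nsize l + nsize r)
      (IteratedGames.drops 1) (nst (Enc.enc (c s, s) ++ l) r) (nst (Enc.enc s ++ l) r) := by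
    intro s hs
    have := hsz s hs
    rw [enc_mk] at this
    rw [enc_mk, List.append_assoc]
    exact Run.drops (Enc.enc (c s)) _ r (by simp at *; omega)
  obtain ⟨h₁, h₂⟩ := H x
  have key : ∀ s, ReflTransGen (fun s s' => c s ∧ s' = h s ∧ esz s' ≤ q.eval (esz x)) s (f x) →
      esz s ≤ Q → Run (u.eval (esz x) + p.eval Q + o.eval Q + nsize l + nsize r)
        (loopS 0 isBit (IteratedGames.drops 1 ;; d ;; t)) (nst (Enc.enc (c s, s) ++ l) r)
        (nst (Enc.enc (c (f x), f x) ++ l) r) := by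
    intro s hs
    induction hs using ReflTransGen.head_induction_on with
    | refl =>
      intro hs
      have := hsz _ hs
      refine .loop_false ?_ (by rw [stSize_nst, nsize_append]; omega)
      exact (isBit_nst _ _ _).trans (by simp [indicator, h₂])
    | @head s s' hss _ ih =>
      intro hs
      obtain ⟨hcs, rfl, hs'⟩ := hss
      have hs'' : esz (h s) ≤ Q := by omega
      refine .loop_true ?_ (.seq (hdrop s hs) (.seq ((Hd s l r).mono ?_)
        ((Ht (h s) l r).mono ?_))) (ih hs'')
      · exact (isBit_nst _ _ _).trans (by simp [indicator, hcs])
      · have := ho s hs; omega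
      · have := hp _ hs''; omega
  have hx : esz (i x) ≤ Q := by
    have := (Hi x [] []).size_right
    simp only [stSize_nst, nsize_append, nsize_nil] at this
    simp only [esz] at *
    omega
  have hfx : esz (f x) ≤ Q := by
    rcases h₁.cases_tail with h₀ | ⟨_, _, _, _, h₀⟩
    · have : esz (f x) = esz (i x) := by rw [h₀]
      omega
    · omega
  exact .seq ((Hi x l r).mono (by omega)) (.seq ((Ht (i x) l r).mono
    (by have := hp _ hx; omega)) (.seq (key _ h₁ hx) (hdrop _ hfx)))

theorem PolySpace.succ {f : α → ℕ} (hf : PolySpace f) : PolySpace fun x => f x + 1 := by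
  have : PolySpace fun n : ℕ => n + 1 := by
    refine ⟨inc, X + 1, fun x l r => Run.inc l r x ?_⟩
    simp [esz, enc_nat]
  exact this.comp hf

theorem PolySpace.pred {f : α → ℕ} (hf : PolySpace f) : PolySpace fun x => f x - 1 := by
  have : PolySpace fun n : ℕ => n - 1 := by
    refine ⟨dec, X + 1, fun x l r => Run.dec l r x ?_⟩
    simp [esz, enc_nat]
  exact this.comp hf

theorem PolySpace.ne_zero {f : α → ℕ} (hf : PolySpace f) : PolySpace fun x => f x ≠ 0 := by
  have : PolySpace fun n : ℕ => n ≠ 0 := by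
    refine ⟨iteS 0 isBit (drops 1 ;; pushNat 1) .skip, X + 3, fun x l r => ?_⟩
    have hl : len 1 = 1 := rfl
    by_cases h : x = 0
    · subst h
      refine .ite_false (isBit_nst _ _ _) (.skip' ?_ ?_)
      · rw [stSize_nst]; simp [esz, enc_nat]
      · simp [enc_nat, enc_prop, indicator]
    · refine .ite_true ((isBit_nst _ _ _).trans (by simpa using h)) (.seq
        (Run.drops [x] l r (by simp [esz, enc_nat])) ?_)
      rw [enc_prop, indicator_true h]
      exact run_pushNat 1 l r (by simp [esz, enc_nat, hl]; omega)
  exact this.comp hf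

end

/-! ### Bounded loops -/

section

variable {α β γ σ : Type} [Enc α] [Enc β] [Enc γ] [Enc σ]

theorem nsize_le {l : List ℕ} {B : ℕ} (h : ∀ n ∈ l, n ≤ B) : nsize l ≤ l.length * (len B + 1) := by
  induction l with
  | nil => simp
  | cons n l ih =>
    have h₁ := len_mono (h n (by simp))
    have h₂ := ih fun m hm => h m (by simp [hm])
    rw [nsize_cons, List.length_cons, Nat.succ_mul]
    omega

theorem esz_le {s : σ} {B : ℕ} (h : ∀ n ∈ Enc.enc s, n ≤ B) :
    esz s ≤ Enc.arity σ * (len B + 1) := by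
  rw [← Enc.length_enc s]; exact nsize_le h

theorem PolySpace.whileCtx {f i : β → σ} {h : β × σ → σ} {c : β × σ → Prop} (hi : PolySpace i)
    (hh : PolySpace h) (hc : PolySpace c) (q : ℕ[X])
    (H : ∀ x, ReflTransGen (fun s s' => c (x, s) ∧ s' = h (x, s) ∧ esz s' ≤ q.eval (esz x))
      (i x) (f x) ∧ ¬ c (x, f x)) : PolySpace f := by
  have := PolySpace.while (f := fun x => (x, f x)) (i := fun x => (x, i x))
    (h := fun z => (z.1, h z)) (c := c) (by fun_prop) (by fun_prop) hc (X + q) fun x =>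
      ⟨(H x).1.lift (fun s => (x, s)) fun s s' ⟨h₁, h₂, h₃⟩ => ⟨h₁, by rw [h₂], by
        rw [esz_mk]; simpa using h₃⟩, (H x).2⟩
  exact this.snd

/-- A state is a fixed number of numbers, each no longer than `B x`, and `B x` has polynomial length
because it is computed in polynomial space. -/
theorem PolySpace.whileBounded {f i : β → σ} {h : β × σ → σ} {c : β × σ → Prop} {B : β → ℕ}
    (hi : PolySpace i) (hh : PolySpace h) (hc : PolySpace c) (hB : PolySpace B)
    (H : ∀ x, ReflTransGen (fun s s' => c (x, s) ∧ s' = h (x, s) ∧ ∀ n ∈ Enc.enc s', n ≤ B x)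
      (i x) (f x) ∧ ¬ c (x, f x)) : PolySpace f := by
  obtain ⟨p, hp⟩ := hB.exists_esz_le
  refine PolySpace.whileCtx hi hh hc (C (Enc.arity σ) * p) fun x =>
    ⟨ReflTransGen.mono ?_ _ _ (H x).1, (H x).2⟩
  rintro s s' ⟨h₁, h₂, h₃⟩
  refine ⟨h₁, h₂, (esz_le h₃).trans ?_⟩
  rw [eval_mul, eval_C, ← esz_nat]
  exact Nat.mul_le_mul_left _ (hp x)

theorem PolySpace.iterate {h : β → σ → σ} {i : β → σ} {n : β → ℕ}
    (hh : PolySpace fun z : β × σ => h z.1 z.2) (hi : PolySpace i) (hn : PolySpace n) (q : ℕ[X])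
    (H : ∀ x, ∀ j ≤ n x, esz ((h x)^[j] (i x)) ≤ q.eval (esz x)) :
    PolySpace fun x => (h x)^[n x] (i x) := by
  obtain ⟨p, hp⟩ := hn.exists_esz_le
  have hh' : PolySpace fun z : β × ℕ × σ => h z.1 z.2.2 :=
    hh.comp (f := fun z : β × ℕ × σ => (z.1, z.2.2)) (by fun_prop)
  have := PolySpace.whileCtx (f := fun x => (0, (h x)^[n x] (i x))) (i := fun x => (n x, i x))
    (h := fun z : β × ℕ × σ => (z.2.1 - 1, h z.1 z.2.2)) (c := fun z => z.2.1 ≠ 0)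
    (by fun_prop) (PolySpace.prodMk (PolySpace.pred (by fun_prop)) hh')
    (PolySpace.ne_zero (by fun_prop)) (p + q) fun x => ⟨?_, by simp⟩
  · exact this.snd
  · have key : ∀ j ≤ n x, ReflTransGen (fun s s' : ℕ × σ => s.1 ≠ 0 ∧ s' = (s.1 - 1, h x s.2) ∧
        esz s' ≤ (p + q).eval (esz x)) (n x, i x) (n x - j, (h x)^[j] (i x)) := by
      intro j hj
      induction j with
      | zero => exact .refl
      | succ j ih =>
        refine (ih (by omega)).tail ⟨by simp; omega, ?_, ?_⟩
        · rw [iterate_succ_apply', Nat.sub_sub]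
        · rw [esz_mk, eval_add]
          have h₁ := hp x
          have h₂ := H x (j + 1) hj
          have h₃ := len_mono (Nat.sub_le (n x) (j + 1))
          rw [esz_nat] at h₁ ⊢
          omega
    simpa using key (n x) le_rfl

/-- The step function sees its index, so the iterated state is the pair of index and value. -/
theorem PolySpace.rec_poly {g : β → ℕ → σ → σ} {i : β → σ} {n : β → ℕ}
    (hg : PolySpace fun z : β × ℕ × σ => g z.1 z.2.1 z.2.2) (hi : PolySpace i) (hn : PolySpace n)
    (q : ℕ[X])
    (H : ∀ x, ∀ j ≤ n x, esz (Nat.rec (i x) (g x) j : σ) ≤ q.eval (esz x)) :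
    PolySpace fun x => (Nat.rec (i x) (g x) (n x) : σ) := by
  obtain ⟨p, hp⟩ := hn.exists_esz_le
  have key : ∀ x j, (fun s : ℕ × σ => (s.1 + 1, g x s.1 s.2))^[j] (0, i x) =
      (j, Nat.rec (i x) (g x) j) := by
    intro x j
    induction j with
    | zero => rfl
    | succ j ih => rw [iterate_succ_apply', ih]
  have := PolySpace.iterate (h := fun x (s : ℕ × σ) => (s.1 + 1, g x s.1 s.2))
    (i := fun x => (0, i x)) (n := n) (PolySpace.prodMk (PolySpace.succ (by fun_prop)) hg)
    (by fun_prop) hn (p + q) fun x j hj => by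
      rw [key, esz_mk, eval_add]
      have h₁ := hp x
      have h₂ := H x j hj
      have h₃ := len_mono hj
      rw [esz_nat] at h₁ ⊢
      omega
  exact this.snd.of_enc_eq fun x => by rw [key]

theorem PolySpace.rec_bounded {g : β → ℕ → σ → σ} {i : β → σ} {n : β → ℕ} {B : β → ℕ}
    (hg : PolySpace fun z : β × ℕ × σ => g z.1 z.2.1 z.2.2) (hi : PolySpace i) (hn : PolySpace n)
    (hB : PolySpace B)
    (H : ∀ x, ∀ j ≤ n x, ∀ m ∈ Enc.enc (Nat.rec (i x) (g x) j : σ), m ≤ B x) :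
    PolySpace fun x => (Nat.rec (i x) (g x) (n x) : σ) := by
  obtain ⟨p, hp⟩ := hB.exists_esz_le
  refine PolySpace.rec_poly hg hi hn (C (Enc.arity σ) * p) fun x j hj =>
    (esz_le (H x j hj)).trans ?_
  rw [eval_mul, eval_C, ← esz_nat]
  exact Nat.mul_le_mul_left _ (hp x)

/-! ### Arithmetic -/

attribute [fun_prop] PolySpace.succ PolySpace.pred

theorem len_add_le (a b : ℕ) : len (a + b) ≤ len a + len b + 1 := by
  refine Nat.lt_succ_iff.1 (len_lt_of_lt ?_)
  have h₁ := lt_two_pow_len a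
  have h₂ := lt_two_pow_len b
  calc a + b + 1 < (a + 1 + 1) * (b + 1 + 1) := by ring_nf; omega
    _ ≤ 2 ^ (len a + 1) * 2 ^ (len b + 1) := Nat.mul_le_mul h₁ h₂
    _ = _ := by rw [← pow_add]; congr 1; omega

theorem len_mul_le (a b : ℕ) : len (a * b) ≤ len a + len b + 1 := by
  refine Nat.lt_succ_iff.1 (len_lt_of_lt ?_)
  have h₁ := lt_two_pow_len a
  have h₂ := lt_two_pow_len b
  calc a * b + 1 < (a + 1 + 1) * (b + 1 + 1) := by ring_nf; omega
    _ ≤ 2 ^ (len a + 1) * 2 ^ (len b + 1) := Nat.mul_le_mul h₁ h₂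
    _ = _ := by rw [← pow_add]; congr 1; omega

theorem len_two_pow_le (a : ℕ) : len (2 ^ a) ≤ a + 1 := by
  refine Nat.lt_succ_iff.1 (len_lt_of_lt ?_)
  have := Nat.lt_two_pow_self (n := a)
  rw [pow_succ, pow_succ]; omega

-- Repeated increments take exponentially many steps in the length of the second summand, which
-- costs no space.
@[fun_prop]
theorem PolySpace.add {f g : β → ℕ} (hf : PolySpace f) (hg : PolySpace g) :
    PolySpace fun x => f x + g x := by
  have : PolySpace fun x : ℕ × ℕ => x.1 + x.2 := by
    have := PolySpace.rec_poly (β := ℕ × ℕ) (σ := ℕ) (g := fun _ _ a => a + 1) (i := fun x => x.1)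
      (n := fun x => x.2) (by fun_prop) (by fun_prop) (by fun_prop) X fun x j hj => ?_
    · refine this.of_enc_eq fun x => congrArg _ ?_
      obtain ⟨a, b⟩ := x
      induction b with
      | zero => rfl
      | succ b ih => simp only [] at ih ⊢; omega
    · have e : (Nat.rec x.1 (fun _ a => a + 1) j : ℕ) = x.1 + j := by
        clear hj
        induction j with
        | zero => rfl
        | succ j ih => simp only [ih]; omega
      obtain ⟨a, b⟩ := x
      rw [e, esz_mk, esz_nat, esz_nat, esz_nat, eval_X]
      have h₁ := len_add_le a j
      have h₂ := len_mono hj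
      simp only [] at h₁ h₂ ⊢
      omega
  exact this.comp (f := fun x => (f x, g x)) (by fun_prop)

@[fun_prop]
theorem PolySpace.sub {f g : β → ℕ} (hf : PolySpace f) (hg : PolySpace g) :
    PolySpace fun x => f x - g x := by
  have e : ∀ a j : ℕ, (Nat.rec a (fun _ a => a - 1) j : ℕ) = a - j := by
    intro a j
    induction j with
    | zero => rfl
    | succ j ih => simp only [ih]; omega
  have := PolySpace.rec_bounded (σ := ℕ) (g := fun _ _ a => a - 1) (i := f) (n := g) (B := f)
    (by fun_prop) hf hg hf fun x j hj m hm => by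
      rw [e, enc_nat] at hm; simp at hm; omega
  exact this.of_enc_eq fun x => congrArg _ (e _ _).symm

@[fun_prop]
theorem PolySpace.mul {f g : β → ℕ} (hf : PolySpace f) (hg : PolySpace g) :
    PolySpace fun x => f x * g x := by
  have e : ∀ a j : ℕ, (Nat.rec 0 (fun _ s => s + a) j : ℕ) = a * j := by
    intro a j
    induction j with
    | zero => rfl
    | succ j ih => simp only [ih]; ring
  have : PolySpace fun x : ℕ × ℕ => x.1 * x.2 := by
    have := PolySpace.rec_poly (β := ℕ × ℕ) (σ := ℕ) (g := fun x _ s => s + x.1)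
      (i := fun x => 0) (n := fun x => x.2) (by fun_prop) (by fun_prop) (by fun_prop) X
      fun x j hj => ?_
    · exact this.of_enc_eq fun x => congrArg _ (e _ _).symm
    · obtain ⟨a, b⟩ := x
      rw [e, esz_mk, esz_nat, esz_nat, esz_nat, eval_X]
      have h₁ := len_mul_le a j
      have h₂ := len_mono hj
      simp only [] at h₁ h₂ ⊢
      omega
  exact this.comp (f := fun x => (f x, g x)) (by fun_prop)

theorem PolySpace.iff_indicator {p : β → Prop} :
    PolySpace p ↔ PolySpace fun x => indicator (p x) :=
  ⟨fun h => h.of_enc_eq fun _ => rfl, fun h => h.of_enc_eq fun _ => rfl⟩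

theorem PolySpace.congr {f g : β → γ} (hf : PolySpace f) (h : ∀ x, g x = f x) : PolySpace g :=
  (funext h : g = f) ▸ hf

@[fun_prop]
theorem PolySpace.not {p : β → Prop} (hp : PolySpace p) : PolySpace fun x => ¬ p x := by
  have : PolySpace fun x => 1 - indicator (p x) :=
    PolySpace.sub (by fun_prop) (PolySpace.iff_indicator.1 hp)
  refine this.of_enc_eq fun x => ?_
  rw [enc_prop, enc_nat]
  by_cases h : p x <;> simp [indicator, h]

@[fun_prop]
theorem PolySpace.and {p q : β → Prop} (hp : PolySpace p) (hq : PolySpace q) :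
    PolySpace fun x => p x ∧ q x := by
  have : PolySpace fun x => indicator (p x) * indicator (q x) :=
    PolySpace.mul (PolySpace.iff_indicator.1 hp) (PolySpace.iff_indicator.1 hq)
  refine this.of_enc_eq fun x => ?_
  rw [enc_prop, enc_nat]
  by_cases h : p x <;> by_cases h' : q x <;> simp [indicator, h, h']

@[fun_prop]
theorem PolySpace.or {p q : β → Prop} (hp : PolySpace p) (hq : PolySpace q) :
    PolySpace fun x => p x ∨ q x :=
  (hp.not.and hq.not).not.congr fun x => propext (by tauto)

@[fun_prop]
theorem PolySpace.imp {p q : β → Prop} (hp : PolySpace p) (hq : PolySpace q) :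
    PolySpace fun x => p x → q x :=
  (hp.not.or hq).congr fun x => propext (by tauto)

@[fun_prop]
theorem PolySpace.lt {f g : β → ℕ} (hf : PolySpace f) (hg : PolySpace g) :
    PolySpace fun x => f x < g x :=
  (hg.sub hf).ne_zero.congr fun x => propext (by omega)

@[fun_prop]
theorem PolySpace.le {f g : β → ℕ} (hf : PolySpace f) (hg : PolySpace g) :
    PolySpace fun x => f x ≤ g x :=
  (hg.lt hf).not.congr fun x => propext (by omega)

@[fun_prop]
theorem PolySpace.eq {f g : β → ℕ} (hf : PolySpace f) (hg : PolySpace g) :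
    PolySpace fun x => f x = g x :=
  ((hf.le hg).and (hg.le hf)).congr fun x => propext (by omega)

-- Exhaustive search: the loop carries only a counter and one truth value, so a bound with
-- polynomially many digits is affordable although it allows exponentially many candidates.
@[fun_prop]
theorem PolySpace.exists_lt {b : β → ℕ} {p : β → ℕ → Prop} (hb : PolySpace b)
    (hp : PolySpace fun z : β × ℕ => p z.1 z.2) : PolySpace fun x => ∃ y, y < b x ∧ p x y := by
  have e : ∀ x j, (Nat.rec False (fun i a => a ∨ p x i) j : Prop) = ∃ y, y < j ∧ p x y := by
    intro x j
    induction j with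
    | zero => simp
    | succ j ih =>
      simp only [ih]
      refine propext ⟨?_, ?_⟩
      · rintro (⟨y, hy, h⟩ | h)
        · exact ⟨y, by omega, h⟩
        · exact ⟨j, by omega, h⟩
      · rintro ⟨y, hy, h⟩
        rcases Nat.lt_succ_iff_lt_or_eq.1 hy with hy | rfl
        · exact .inl ⟨y, hy, h⟩
        · exact .inr h
  have hp' : PolySpace fun z : β × ℕ × Prop => p z.1 z.2.1 :=
    hp.comp (f := fun z : β × ℕ × Prop => (z.1, z.2.1)) (by fun_prop)
  have := PolySpace.rec_bounded (σ := Prop) (g := fun x i a => a ∨ p x i) (i := fun _ => False)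
    (n := b) (B := fun _ => 1) (by fun_prop) (by fun_prop) hb (by fun_prop) fun x j hj m hm => by
      rw [enc_prop] at hm
      simp only [List.mem_singleton] at hm
      rw [hm]; exact indicator_le _
  exact this.congr fun x => (e _ _).symm

@[fun_prop]
theorem PolySpace.forall_lt {b : β → ℕ} {p : β → ℕ → Prop} (hb : PolySpace b)
    (hp : PolySpace fun z : β × ℕ => p z.1 z.2) : PolySpace fun x => ∀ y, y < b x → p x y :=
  (PolySpace.exists_lt hb (p := fun x y => ¬ p x y) (by fun_prop)).not.congr fun x =>
    propext (by push Not; rfl)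

@[fun_prop]
theorem PolySpace.nat_min {f g : β → ℕ} (hf : PolySpace f) (hg : PolySpace g) :
    PolySpace fun x => min (f x) (g x) :=
  (PolySpace.ite (hf.le hg) hf hg).congr fun x => by rw [Nat.min_def]

@[fun_prop]
theorem PolySpace.div {f g : β → ℕ} (hf : PolySpace f) (hg : PolySpace g) :
    PolySpace fun x => f x / g x := by
  -- The quotient is approached from below; `a` rounds suffice since `a / b ≤ a`. The test `0 < b`
  -- produces the value `0` for division by zero.
  have e : ∀ a b j : ℕ, (Nat.rec 0 (fun _ s => if 0 < b ∧ (s + 1) * b ≤ a then s + 1 else s) j : ℕ)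
      = min j (a / b) := by
    intro a b j
    induction j with
    | zero => simp
    | succ j ih =>
      simp only [ih]
      rcases Nat.eq_zero_or_pos b with rfl | hb
      · simp
      · simp only [hb, true_and, ← Nat.le_div_iff_mul_le hb]
        split <;> omega
  have := PolySpace.rec_bounded (σ := ℕ)
    (g := fun x _ s => if 0 < g x ∧ (s + 1) * g x ≤ f x then s + 1 else s) (i := fun _ => 0)
    (n := f) (B := f) (by fun_prop) (by fun_prop) hf hf fun x j hj m hm => by
      rw [e, enc_nat] at hm; simp at hm; omega
  refine this.congr fun x => ?_
  rw [e, Nat.min_eq_right (Nat.div_le_self _ _)]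

@[fun_prop]
theorem PolySpace.mod {f g : β → ℕ} (hf : PolySpace f) (hg : PolySpace g) :
    PolySpace fun x => f x % g x :=
  (hf.sub (hg.mul (hf.div hg))).congr fun _ => Nat.mod_eq_sub _ _

end

/-! ### Folds over words and digits -/

section

variable {α β γ σ : Type} [Enc α] [Enc β] [Enc γ] [Enc σ]

/-- The number whose word is the tail of the word of `n`. -/
def tailNum (n : ℕ) : ℕ := (n - 1) / 2

/-- The lowest digit contributes `1` or `2`, and both disappear under `n ↦ (n - 1) / 2`. With
`val_mod_two` this reads words off numbers by arithmetic alone. -/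
theorem tailNum_val (w : List Bool) : tailNum (val w) = val w.tail := by
  cases w with
  | nil => rfl
  | cons b w => cases b <;> (simp [tailNum, val]; try omega)

theorem val_mod_two (b : Bool) (w : List Bool) : val (b :: w) % 2 = 0 ↔ b = true := by
  cases b <;> simp [val, Nat.add_mod]

theorem val_eq_zero {w : List Bool} : val w = 0 ↔ w = [] := by
  cases w with
  | nil => simp [val]
  | cons b w => cases b <;> simp [val]

theorem val_drop_le (w : List Bool) (j : ℕ) : val (w.drop j) ≤ val w := by
  induction j generalizing w with
  | zero => simp
  | succ j ih =>
    cases w with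
    | nil => simp
    | cons b w => exact (ih w).trans (by cases b <;> simp [val] <;> omega)

@[fun_prop]
theorem PolySpace.tailNum {f : β → ℕ} (hf : PolySpace f) :
    PolySpace fun x => tailNum (f x) := by
  unfold IteratedGames.tailNum; fun_prop

@[fun_prop]
theorem PolySpace.len {f : β → ℕ} (hf : PolySpace f) : PolySpace fun x => len (f x) := by
  have e : ∀ w : List Bool, ∀ j, (Nat.rec (val w, 0)
      (fun _ s => (IteratedGames.tailNum s.1, if s.1 = 0 then s.2 else s.2 + 1)) j : ℕ × ℕ) =
      (val (w.drop j), min j w.length) := by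
    intro w j
    induction j with
    | zero => simp
    | succ j ih =>
      simp only [ih, tailNum_val, List.tail_drop, val_eq_zero, List.drop_eq_nil_iff,
        Prod.mk.injEq, true_and]
      split <;> omega
  have := PolySpace.rec_bounded (σ := ℕ × ℕ) (i := fun x => (f x, 0)) (n := f) (B := f)
    (g := fun _ _ s => (IteratedGames.tailNum s.1, if s.1 = 0 then s.2 else s.2 + 1))
    (by fun_prop) (by fun_prop) hf hf fun x j hj m hm => by
      have h := e (word (f x)) j
      rw [val_word] at h
      rw [h, enc_mk, enc_nat, enc_nat] at hm
      simp only [List.cons_append, List.nil_append, List.mem_cons, List.not_mem_nil,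
        or_false] at hm
      rcases hm with rfl | rfl
      · exact (val_drop_le _ _).trans (val_word _).le
      · omega
  refine this.snd.congr fun x => ?_
  have h := e (word (f x)) (f x)
  rw [val_word] at h
  rw [h]
  exact (Nat.min_eq_right (len_le (f x))).symm

/-- The loop state is the unread rest of the word, as a number, with the accumulator. The hypothesis
`H` on all words of bounded length covers in particular the prefixes that occur. -/
theorem PolySpace.foldl {g : β → Prop → σ → σ} {i : β → σ} {n B : β → ℕ}
    (hg : PolySpace fun z : β × Prop × σ => g z.1 z.2.1 z.2.2) (hi : PolySpace i)
    (hn : PolySpace n) (hB : PolySpace B)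
    (H : ∀ x (w : List Bool), w.length ≤ IteratedGames.len (n x) →
      ∀ m ∈ Enc.enc (w.foldl (fun s (b : Bool) => g x (b = true) s) (i x)), m ≤ B x) :
    PolySpace fun x => (word (n x)).foldl (fun s (b : Bool) => g x (b = true) s) (i x) := by
  have e : ∀ x (w : List Bool), ∀ j ≤ w.length, (Nat.rec (val w, i x)
      (fun _ s => (IteratedGames.tailNum s.1, g x (s.1 % 2 = 0) s.2)) j : ℕ × σ) =
      (val (w.drop j), (w.take j).foldl (fun s (b : Bool) => g x (b = true) s) (i x)) := by
    intro x w j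
    induction j with
    | zero => simp
    | succ j ih =>
      intro hj
      have h₁ : w.drop j = w[j] :: w.drop (j + 1) := List.drop_eq_getElem_cons hj
      simp only [ih (by omega)]
      rw [h₁, tailNum_val, List.take_succ_eq_append_getElem hj, List.foldl_append, val_mod_two]
      rfl
  have hg' : PolySpace fun z : β × ℕ × ℕ × σ => g z.1 (z.2.2.1 % 2 = 0) z.2.2.2 :=
    hg.comp (f := fun z : β × ℕ × ℕ × σ => (z.1, z.2.2.1 % 2 = 0, z.2.2.2)) (by fun_prop)
  have := PolySpace.rec_bounded (σ := ℕ × σ) (i := fun x => (n x, i x))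
    (n := fun x => IteratedGames.len (n x)) (B := fun x => n x + B x)
    (g := fun x _ s => (IteratedGames.tailNum s.1, g x (s.1 % 2 = 0) s.2))
    (by fun_prop) (by fun_prop) (by fun_prop) (by fun_prop) fun x j hj m hm => by
      have h := e x (word (n x)) j hj
      rw [val_word] at h
      rw [h, enc_mk, enc_nat] at hm
      rcases List.mem_append.1 hm with hm | hm
      · simp only [List.mem_singleton] at hm
        have := val_drop_le (word (n x)) j
        rw [val_word] at this
        omega
      · have := H x _ (by rw [List.length_take]; exact (min_le_left _ _).trans hj) m hm
        omega
  refine this.snd.congr fun x => ?_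
  have h := e x (word (n x)) (IteratedGames.len (n x)) le_rfl
  rw [val_word] at h
  rw [h]
  simp [IteratedGames.len]

-- A power of two is short only if its exponent is small in value; a product of two lengths is
-- polynomial in the size of the input, an arbitrary computed number is not.
@[fun_prop]
theorem PolySpace.two_pow_len_mul_len {f g : β → ℕ} (hf : PolySpace f) (hg : PolySpace g) :
    PolySpace fun x => 2 ^ (IteratedGames.len (f x) * IteratedGames.len (g x)) := by
  obtain ⟨p, hp⟩ := hf.exists_esz_le
  obtain ⟨q, hq⟩ := hg.exists_esz_le
  have e : ∀ j : ℕ, (Nat.rec 1 (fun _ s => s + s) j : ℕ) = 2 ^ j := by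
    intro j
    induction j with
    | zero => rfl
    | succ j ih => simp only [ih, pow_succ]; omega
  have := PolySpace.rec_poly (σ := ℕ) (i := fun x : β => 1)
    (n := fun x => IteratedGames.len (f x) * IteratedGames.len (g x)) (g := fun _ _ s => s + s)
    (by fun_prop) (by fun_prop) (by fun_prop) (p * q + 2) fun x j hj => by
      rw [e, esz_nat, eval_add, eval_mul, eval_ofNat]
      have h₁ := hp x
      have h₂ := hq x
      rw [esz_nat] at h₁ h₂
      have := Nat.mul_le_mul (Nat.le_of_succ_le h₁) (Nat.le_of_succ_le h₂)
      have := len_two_pow_le j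
      omega
  exact this.congr fun x => (e _).symm

/-- The digit of `u` with index `i` in base `M`. -/
def dig (M u i : ℕ) : ℕ := u / M ^ i % M

@[fun_prop]
theorem PolySpace.dig {f g h : β → ℕ} (hf : PolySpace f) (hg : PolySpace g) (hh : PolySpace h) :
    PolySpace fun x => dig (f x) (g x) (h x) := by
  -- Repeated division never forms `M ^ j`, which could be too long.
  have e : ∀ M u j : ℕ, (Nat.rec u (fun _ s => s / M) j : ℕ) = u / M ^ j := by
    intro M u j
    induction j with
    | zero => simp
    | succ j ih => simp only [ih, pow_succ, Nat.div_div_eq_div_mul]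
  have := PolySpace.rec_bounded (σ := ℕ) (i := g) (n := h) (g := fun x _ s => s / f x) (B := g)
    (by fun_prop) hg hh hg fun x j hj m hm => by
      rw [e, enc_nat] at hm
      simp only [List.mem_singleton] at hm
      rw [hm]; exact Nat.div_le_self _ _
  refine (this.mod hf).congr fun x => ?_
  rw [e, IteratedGames.dig]

theorem exists_dig (M k : ℕ) (f : ℕ → ℕ) (hf : ∀ i < k, f i < M) :
    ∃ u < M ^ k, ∀ i < k, dig M u i = f i := by
  let F : Fin k → Fin M := fun i => ⟨f i, hf i i.2⟩
  refine ⟨finFunctionFinEquiv F, Fin.is_lt _, fun i hi => ?_⟩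
  have := congrArg Fin.val (congrFun (finFunctionFinEquiv.symm_apply_apply F) ⟨i, hi⟩)
  rw [finFunctionFinEquiv_symm_apply_val] at this
  exact this

end

/-! ### Reachability in succinctly given graphs -/

/-- There is a walk of length at most `2 ^ d` between two vertices, by recursion on `d`. -/
def Sav (E : ℕ → ℕ → Prop) (N : ℕ) : ℕ → ℕ → ℕ → Prop
  | 0, u, v => u = v ∨ E u v
  | d + 1, u, v => ∃ w < N, Sav E N d u w ∧ Sav E N d w v

theorem Sav.reflTransGen {E : ℕ → ℕ → Prop} {N d u v : ℕ} (h : Sav E N d u v) :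
    ReflTransGen E u v := by
  induction d generalizing u v with
  | zero =>
    rcases h with rfl | h
    · exact .refl
    · exact .single h
  | succ d ih =>
    obtain ⟨w, _, h₁, h₂⟩ := h
    exact (ih h₁).trans (ih h₂)

theorem exists_walk {V : Type*} {E : V → V → Prop} {u v : V} (h : ReflTransGen E u v) :
    ∃ (n : ℕ) (f : ℕ → V), f 0 = u ∧ f n = v ∧ ∀ i < n, E (f i) (f (i + 1)) := by
  induction h with
  | refl => exact ⟨0, fun _ => u, rfl, rfl, by simp⟩
  | @tail w v _ h ih =>
    obtain ⟨n, f, h₀, hn, hf⟩ := ih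
    refine ⟨n + 1, fun i => if i ≤ n then f i else v, by simpa using h₀, by simp, fun i hi => ?_⟩
    rcases Nat.lt_succ_iff_lt_or_eq.1 hi with hi | rfl
    · simp only [hi.le, if_true, Nat.succ_le_of_lt hi]
      exact hf i hi
    · simpa [hn] using h

/-- A walk of minimal length repeats no vertex among its first `n`, since the part between two
visits could be cut out. -/
theorem exists_short_walk {E : ℕ → ℕ → Prop} {N u v : ℕ} (hE : ∀ a b, E a b → b < N)
    (hu : u < N) (h : ReflTransGen E u v) :
    ∃ (n : ℕ) (f : ℕ → ℕ), n ≤ N ∧ f 0 = u ∧ f n = v ∧ (∀ i < n, E (f i) (f (i + 1))) := by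
  classical
  have hex := exists_walk h
  obtain ⟨f, h₀, hn, hf⟩ := Nat.find_spec hex
  refine ⟨Nat.find hex, f, ?_, h₀, hn, hf⟩
  by_contra! hlt
  set n := Nat.find hex with hn_def
  have hlt' : ∀ i ∈ Finset.range n, f i ∈ Finset.range N := by
    intro i hi
    rw [Finset.mem_range] at hi ⊢
    cases i with
    | zero => rwa [h₀]
    | succ i => exact hE _ _ (hf i (by omega))
  obtain ⟨i, hi, j, hj, hij, he⟩ := Finset.exists_ne_map_eq_of_card_lt_of_maps_to
    (by simpa using hlt) hlt'
  wlog hlt'' : i < j generalizing i j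
  · exact this j hj i hi hij.symm he.symm (by omega)
  rw [Finset.mem_range] at hi hj
  refine Nat.find_min hex (m := n - (j - i)) (by omega)
    ⟨fun k => if k < i then f k else f (k + (j - i)), ?_, ?_, ?_⟩
  · by_cases hi0 : 0 < i
    · simpa [hi0] using h₀
    · obtain rfl : i = 0 := by omega
      simp [← he, h₀]
  · have : ¬ n - (j - i) < i := by omega
    simp only [this, if_false]
    rw [← hn]; congr 1; omega
  · intro k hk
    rcases lt_trichotomy (k + 1) i with h | h | h
    · simp only [h, (by omega : k < i), if_true]
      exact hf k (by omega)
    · have := hf k (by omega)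
      beta_reduce
      rw [if_pos (by omega), if_neg (by omega), show k + 1 + (j - i) = j by omega, ← he, ← h]
      exact this
    · beta_reduce
      rw [if_neg (by omega), if_neg (by omega), show k + 1 + (j - i) = k + (j - i) + 1 by omega]
      exact hf _ (by omega)

theorem sav_of_walk {E : ℕ → ℕ → Prop} {N d n : ℕ} {f : ℕ → ℕ} (hn : n ≤ 2 ^ d)
    (hN : ∀ i ≤ n, f i < N) (hf : ∀ i < n, E (f i) (f (i + 1))) : Sav E N d (f 0) (f n) := by
  induction d generalizing n f with
  | zero =>
    rw [pow_zero] at hn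
    interval_cases n
    · exact .inl rfl
    · exact .inr (hf 0 (by omega))
  | succ d ih =>
    -- A walk with at most `2 ^ d` steps has its endpoint as midpoint, and the second half is empty.
    refine ⟨f (min n (2 ^ d)), hN _ (min_le_left _ _), ih (min_le_right _ _)
      (fun i hi => hN i (by omega)) fun i hi => hf i (by omega), ?_⟩
    have := ih (n := n - min n (2 ^ d)) (f := fun i => f (i + min n (2 ^ d)))
      (by rw [pow_succ] at hn; omega) (fun i hi => hN _ (by omega)) fun i hi => by
        have := hf (i + min n (2 ^ d)) (by omega)
        rwa [show i + min n (2 ^ d) + 1 = i + 1 + min n (2 ^ d) by omega] at this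
    simp only [Nat.zero_add] at this
    rwa [show n - min n (2 ^ d) + min n (2 ^ d) = n by omega] at this

theorem sav_iff {E : ℕ → ℕ → Prop} {N d u v : ℕ} (hE : ∀ a b, E a b → b < N) (hd : N ≤ 2 ^ d)
    (hu : u < N) : Sav E N d u v ↔ ReflTransGen E u v := by
  refine ⟨Sav.reflTransGen, fun h => ?_⟩
  obtain ⟨n, f, hn, rfl, rfl, hf⟩ := exists_short_walk hE hu h
  refine sav_of_walk (hn.trans hd) (fun i hi => ?_) hf
  cases i with
  | zero => exact hu
  | succ i => exact hE _ _ (hf i (by omega))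

/-- Push four digits on a stack in base `b`. -/
def push4 (b S u v w p : ℕ) : ℕ := (((S * b + u) * b + v) * b + w) * b + p

theorem mul_add_div' {S b u : ℕ} (h : u < b) : (S * b + u) / b = S := by
  rw [Nat.add_comm, Nat.add_mul_div_right _ _ (by omega), Nat.div_eq_of_lt h, Nat.zero_add]

/-- The states of the search: the mode (`0`: call, `1`: return false, `2`: return true), the level,
the two vertices, and the stack of the pending calls. -/
abbrev SavState := ℕ × ℕ × ℕ × ℕ × ℕ

/-- One step of the depth first evaluation of `Sav`. -/
noncomputable def savStep (E : ℕ → ℕ → Prop) (N b : ℕ) (s : SavState) : SavState :=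
  open Classical in
  if s.1 = 0 then
    if s.2.1 = 0 then
      (if s.2.2.1 = s.2.2.2.1 ∨ E s.2.2.1 s.2.2.2.1 then 2 else 1, s.2)
    else (0, s.2.1 - 1, s.2.2.1, 0, push4 b s.2.2.2.2 s.2.2.1 s.2.2.2.1 0 0)
  else
    if s.1 = 2 ∧ s.2.2.2.2 % b = 1 then
      (2, s.2.1 + 1, s.2.2.2.2 / b / b / b % b, s.2.2.2.2 / b / b % b, s.2.2.2.2 / b / b / b / b)
    else if s.1 = 2 then
      (0, s.2.1, s.2.2.2.2 / b % b, s.2.2.2.2 / b / b % b, s.2.2.2.2 + 1)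
    else if s.2.2.2.2 / b % b + 1 < N then
      (0, s.2.1, s.2.2.2.2 / b / b / b % b, s.2.2.2.2 / b % b + 1,
        push4 b (s.2.2.2.2 / b / b / b / b) (s.2.2.2.2 / b / b / b % b) (s.2.2.2.2 / b / b % b)
          (s.2.2.2.2 / b % b + 1) 0)
    else
      (1, s.2.1 + 1, s.2.2.2.2 / b / b / b % b, s.2.2.2.2 / b / b % b, s.2.2.2.2 / b / b / b / b)

/-- The mode in which the evaluation returns the truth value of `p`. -/
noncomputable def retMode (p : Prop) : ℕ := open Classical in if p then 2 else 1

section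

variable {E : ℕ → ℕ → Prop} {N b D : ℕ}

/-- The steps of the evaluation up to level `D` that respect the space bound. -/
def SavRel (E : ℕ → ℕ → Prop) (N b D : ℕ) (s s' : SavState) : Prop :=
  ¬ (s.1 ≠ 0 ∧ s.2.1 = D) ∧ s' = savStep E N b s ∧
    ∀ n ∈ Enc.enc s', n ≤ b ^ (4 * D) + D + N + 2

/-- At level `d` there are `D - d` pending calls with four digits each, hence the bound on `S`. -/
theorem bound_of_lt {m d u v S : ℕ} (hm : m ≤ 2) (hd : d ≤ D) (hu : u < N) (hv : v < N)
    (hb : 0 < b) (hS : S < b ^ (4 * (D - d))) :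
    ∀ n ∈ Enc.enc ((m, d, u, v, S) : SavState), n ≤ b ^ (4 * D) + D + N + 2 := by
  intro n hn
  have : b ^ (4 * (D - d)) ≤ b ^ (4 * D) := Nat.pow_le_pow_right hb (by omega)
  simp only [enc_mk, enc_nat, List.cons_append, List.nil_append, List.mem_cons, List.not_mem_nil,
    or_false] at hn
  rcases hn with rfl | rfl | rfl | rfl | rfl <;> omega

theorem push4_lt {d u v S w p : ℕ} (hd : d + 1 ≤ D) (hu : u < b) (hv : v < b) (hw : w < b)
    (hp : p < b) (hS : S < b ^ (4 * (D - (d + 1)))) :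
    push4 b S u v w p < b ^ (4 * (D - d)) := by
  have key : ∀ {k S u : ℕ}, u < b → S < b ^ k → S * b + u < b ^ (k + 1) := by
    intro k S u hu hS
    calc S * b + u < (S + 1) * b := by rw [Nat.succ_mul]; omega
      _ ≤ b ^ k * b := Nat.mul_le_mul_right _ hS
      _ = _ := (pow_succ _ _).symm
  rw [show 4 * (D - d) = 4 * (D - (d + 1)) + 1 + 1 + 1 + 1 by omega]
  exact key hp (key hw (key hv (key hu hS)))

/-- A frame holds the endpoints `u` and `v`, the midpoint `w` on trial and a flag, which is `0`
while the first half is evaluated and `1` during the second. This lemma and the next two are the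
possible reactions to a returned value. -/
theorem savStep_true_one {d u v u' v' w S : ℕ} (hu : u < b) (hv : v < b) (hw : w < b)
    (hb : 1 < b) : savStep E N b (2, d, u', v', push4 b S u v w 1) = (2, d + 1, u, v, S) := by
  simp [savStep, push4, mul_add_div', hu, hv, hw, hb, Nat.mod_eq_of_lt]

theorem savStep_true_zero {d u v u' v' w S : ℕ} (hv : v < b) (hw : w < b)
    (hb : 1 < b) : savStep E N b (2, d, u', v', push4 b S u v w 0) =
      (0, d, w, v, push4 b S u v w 1) := by
  have hb' : 0 < b := by omega
  have h₁ := mul_add_div' (S := ((S * b + u) * b + v) * b + w) hb'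
  simp only [Nat.add_zero] at h₁
  simp [savStep, push4, mul_add_div', hv, hw, h₁, Nat.mod_eq_of_lt]

theorem savStep_false {d u v u' v' w S p : ℕ} (hu : u < b) (hv : v < b) (hw : w < b)
    (hp : p < b) : savStep E N b (1, d, u', v', push4 b S u v w p) =
      if w + 1 < N then (0, d, u, w + 1, push4 b S u v (w + 1) 0) else (1, d + 1, u, v, S) := by
  simp only [savStep]
  unfold push4
  simp [mul_add_div', hu, hv, hw, hp, Nat.mod_eq_of_lt]

/-- By induction on the level, a call returns its truth value with endpoints and stack restored, and
all states in between respect the space bound. -/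
theorem savRel_call (hNb : N < b) (hb : 1 < b) (d : ℕ) (hd : d ≤ D) (u v S : ℕ) (hu : u < N)
    (hv : v < N) (hS : S < b ^ (4 * (D - d))) :
    ReflTransGen (SavRel E N b D) (0, d, u, v, S) (retMode (Sav E N d u v), d, u, v, S) := by
  have hb0 : 0 < b := by omega
  have hret : ∀ p : Prop, retMode p ≤ 2 := fun p => by unfold retMode; split <;> omega
  induction d generalizing u v S with
  | zero =>
    refine .single ⟨by simp, ?_, bound_of_lt (hret _) hd hu hv hb0 hS⟩
    simp only [savStep, retMode, Sav, if_true]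
    congr
  | succ d ih =>
    have ubd : u < b := by omega
    have vbd : v < b := by omega
    -- The trial of one midpoint: `next` takes over after a failure, whatever vertices and flag the
    -- failing half leaves behind.
    have try_mid : ∀ w < N, (¬ (Sav E N d u w ∧ Sav E N d w v) → ∀ u' v' p, p < b →
        ReflTransGen (SavRel E N b D) (1, d, u', v', push4 b S u v w p)
          (retMode (Sav E N (d + 1) u v), d + 1, u, v, S)) →
        ReflTransGen (SavRel E N b D) (0, d, u, w, push4 b S u v w 0)
          (retMode (Sav E N (d + 1) u v), d + 1, u, v, S) := by
      intro w hw next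
      have wbd : w < b := by omega
      refine (ih (by omega) u w (push4 b S u v w 0) hu hw
        (push4_lt hd ubd vbd wbd hb0 hS)).trans ?_
      by_cases hs₁ : Sav E N d u w
      · rw [retMode, if_pos hs₁]
        have hS' := push4_lt hd ubd vbd wbd hb hS
        refine .head ⟨by simp; omega, (savStep_true_zero vbd wbd hb).symm,
          bound_of_lt (by omega) (by omega) (by omega) hv hb0 hS'⟩ ?_
        refine (ih (by omega) w v (push4 b S u v w 1) (by omega) hv hS').trans ?_
        by_cases hs₂ : Sav E N d w v
        · have : Sav E N (d + 1) u v := ⟨w, by omega, hs₁, hs₂⟩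
          rw [retMode, if_pos hs₂, retMode, if_pos this]
          exact .single ⟨by simp; omega, (savStep_true_one ubd vbd wbd hb).symm,
            bound_of_lt (by omega) hd hu hv hb0 hS⟩
        · rw [retMode, if_neg hs₂]
          exact next (fun h => hs₂ h.2) _ _ _ hb
      · rw [retMode, if_neg hs₁]
        exact next (fun h => hs₁ h.1) _ _ _ hb0
    -- Induction on the number `k` of midpoints that remain after `w`.
    have main : ∀ k w, w + k + 1 = N → (∀ w' < w, ¬ (Sav E N d u w' ∧ Sav E N d w' v)) →
        ReflTransGen (SavRel E N b D) (0, d, u, w, push4 b S u v w 0)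
          (retMode (Sav E N (d + 1) u v), d + 1, u, v, S) := by
      intro k
      induction k with
      | zero =>
        refine fun w hw hno => try_mid w (by omega) fun hn u' v' p hp => ?_
        have : ¬ Sav E N (d + 1) u v := by
          rintro ⟨w', hw', h⟩
          rcases Nat.lt_or_ge w' w with h' | h'
          · exact hno w' h' h
          · obtain rfl : w' = w := by omega
            exact hn h
        rw [retMode, if_neg this]
        refine .single ⟨by simp; omega, ?_, bound_of_lt (by omega) hd hu hv hb0 hS⟩
        rw [savStep_false ubd vbd (by omega) hp, if_neg (by omega)]
      | succ k ihk =>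
        refine fun w hw hno => try_mid w (by omega) fun hn u' v' p hp => ?_
        have e : savStep E N b (1, d, u', v', push4 b S u v w p) =
            (0, d, u, w + 1, push4 b S u v (w + 1) 0) := by
          rw [savStep_false ubd vbd (by omega) hp, if_pos (by omega)]
        refine .head ⟨by simp; omega, e.symm, bound_of_lt (by omega) (by omega) hu (by omega) hb0
          (push4_lt hd ubd vbd (by omega) hb0 hS)⟩ (ihk (w + 1) (by omega) fun w' hw' h => ?_)
        rcases Nat.lt_or_ge w' w with h' | h'
        · exact hno w' h' h
        · obtain rfl : w' = w := by omega
          exact hn h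
    refine .head ⟨by simp, ?_, ?_⟩ (main (N - 1) 0 (by omega) (by simp))
    · simp [savStep]
    · exact bound_of_lt (by omega) (by omega) hu (by omega) hb0
        (push4_lt hd ubd vbd (by omega) hb0 hS)

end

theorem len_two_mul_add_one (n : ℕ) : len (2 * n + 1) = len n + 1 := by
  have : 2 * n + 1 = val (false :: word n) := by simp [val]
  rw [this, len_val, List.length_cons, len]

section

variable {β : Type} [Enc β]

/-- Savitch's argument: the recursion depth is logarithmic in the number of vertices and each frame
has four vertices' worth of digits, so the stack has quadratically many bits in the length of `N x`.
-/
theorem PolySpace.reflTransGen {E : β → ℕ → ℕ → Prop} {N u v : β → ℕ}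
    (hE : PolySpace fun z : β × ℕ × ℕ => E z.1 z.2.1 z.2.2) (hN : PolySpace N)
    (hu : PolySpace u) (hv : PolySpace v) (hEN : ∀ x a b, E x a b → a < N x ∧ b < N x) :
    PolySpace fun x => ReflTransGen (E x) (u x) (v x) := by
  classical
  -- `L` is `len (N x) + 1`, so `2 ^ L` exceeds `N x + 1`. It serves as recursion depth and, through
  -- `b = 2 ^ L`, as the number of bits of a stack digit.
  obtain ⟨L, hL, hL1⟩ : ∃ L : β → ℕ, PolySpace L ∧ ∀ x, L x = IteratedGames.len (2 * N x + 1) :=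
    ⟨_, by fun_prop, fun _ => rfl⟩
  obtain ⟨b, hb, hbL⟩ : ∃ b : β → ℕ, PolySpace b ∧ ∀ x, b x = 2 ^ L x := by
    have : PolySpace fun x =>
        2 ^ (IteratedGames.len (2 * N x + 1) * IteratedGames.len 1) := by fun_prop
    exact ⟨_, this, fun x => by rw [hL1, show IteratedGames.len 1 = 1 from rfl, Nat.mul_one]⟩
  have hNb : ∀ x, N x + 1 < b x := fun x => by
    rw [hbL, hL1, len_two_mul_add_one]; exact lt_two_pow_len _
  have hB : PolySpace fun x => b x ^ (4 * L x) + L x + N x + 2 := by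
    obtain ⟨c, hc, hcL⟩ : ∃ c : β → ℕ, PolySpace c ∧ ∀ x, c x = 2 ^ (L x * L x) := by
      have : PolySpace fun x =>
          2 ^ (IteratedGames.len (2 * N x + 1) * IteratedGames.len (2 * N x + 1)) := by fun_prop
      exact ⟨_, this, fun x => by rw [hL1]⟩
    have h₂ : PolySpace fun x => b x ^ (4 * L x) := by
      refine PolySpace.congr (f := fun x => c x * c x * (c x * c x)) (by fun_prop) fun x => ?_
      rw [hbL, hcL, ← pow_mul, ← pow_add, ← pow_add]
      congr 1; ring
    fun_prop
  have hE' : PolySpace fun z : β × SavState => E z.1 z.2.2.2.1 z.2.2.2.2.1 :=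
    hE.comp (f := fun z : β × SavState => (z.1, z.2.2.2.1, z.2.2.2.2.1)) (by fun_prop)
  have hstep : PolySpace fun z : β × SavState => savStep (E z.1) (N z.1) (b z.1) z.2 := by
    unfold savStep push4; fun_prop
  have key := PolySpace.whileBounded (σ := SavState)
    (f := fun x => if u x < N x ∧ v x < N x then
      (retMode (Sav (E x) (N x) (L x) (u x) (v x)), L x, u x, v x, 0) else (1, L x, u x, v x, 0))
    -- Endpoints outside the graph start in a final state, since `savRel_call` applies only to
    -- vertices below `N x`.
    (i := fun x => if u x < N x ∧ v x < N x then (0, L x, u x, v x, 0) else (1, L x, u x, v x, 0))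
    (h := fun z => savStep (E z.1) (N z.1) (b z.1) z.2)
    (c := fun z => ¬ (z.2.1 ≠ 0 ∧ z.2.2.1 = L z.1))
    (B := fun x => b x ^ (4 * L x) + L x + N x + 2) (by fun_prop) hstep (by fun_prop) hB
    fun x => by
      by_cases h : u x < N x ∧ v x < N x
      · rw [if_pos h, if_pos h]
        refine ⟨savRel_call (E := E x) (N := N x) (b := b x) (D := L x)
          (by have := hNb x; omega) (by have := hNb x; omega) (L x) le_rfl
          (u x) (v x) 0 h.1 h.2 (by simp), ?_⟩
        simp only [not_not]
        exact ⟨by unfold retMode; split <;> simp, trivial⟩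
      · rw [if_neg h, if_neg h]
        exact ⟨.refl, by simp⟩
  -- The first disjunct accounts for the empty walk at a number that is not a vertex.
  have : PolySpace fun x => u x = v x ∨ (u x < N x ∧ v x < N x ∧
      (if u x < N x ∧ v x < N x then
        (retMode (Sav (E x) (N x) (L x) (u x) (v x)), L x, u x, v x, 0) else
          ((1, L x, u x, v x, 0) : SavState)).1 = 2) := by
    have := key.fst
    fun_prop
  refine this.congr fun x => propext ⟨fun h => ?_, ?_⟩
  · by_cases huv : u x = v x
    · exact .inl huv
    · have hu' : u x < N x := by
        rcases h.cases_head with h | ⟨_, h, _⟩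
        · exact absurd h huv
        · exact (hEN x _ _ h).1
      have hv' : v x < N x := by
        rcases h.cases_tail with h | ⟨_, _, h⟩
        · exact absurd h.symm huv
        · exact (hEN x _ _ h).2
      refine .inr ⟨hu', hv', ?_⟩
      rw [if_pos ⟨hu', hv'⟩, retMode, if_pos]
      refine (sav_iff (fun a b h => (hEN x a b h).2) ?_ hu').2 h
      rw [← hbL]; have := hNb x; omega
  · rintro (h | ⟨hu', hv', h⟩)
    · rw [h]
    · rw [if_pos ⟨hu', hv'⟩] at h
      have : Sav (E x) (N x) (L x) (u x) (v x) := by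
        by_contra hn
        simp [retMode, hn] at h
      exact this.reflTransGen

end

/-! ### Strategy profiles and traces -/

section Characterization

variable {ι : Type*} {A : ι → Type*}

@[simp] theorem length_tracePrefix (t : ℕ → Decision A) (n : ℕ) :
    (tracePrefix t n).length = n := by simp [tracePrefix]

theorem tracePrefix_succ (t : ℕ → Decision A) (n : ℕ) :
    tracePrefix t (n + 1) = tracePrefix t n ++ [t n] := by
  simp [tracePrefix, List.range_succ]

theorem take_tracePrefix (t : ℕ → Decision A) {m n : ℕ} (h : m ≤ n) :
    (tracePrefix t n).take m = tracePrefix t m := by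
  rw [tracePrefix, ← List.map_take, List.take_range, Nat.min_eq_left h, tracePrefix]

theorem getElem_tracePrefix (t : ℕ → Decision A) {m n : ℕ} (h : m < (tracePrefix t n).length) :
    (tracePrefix t n)[m] = t m := by simp [tracePrefix]

theorem tracePrefix_congr {t t' : ℕ → Decision A} {n : ℕ} (h : ∀ m < n, t m = t' m) :
    tracePrefix t n = tracePrefix t' n :=
  List.map_congr_left fun m hm => h m (List.mem_range.1 hm)

theorem eq_of_tracePrefix_eq {t t' : ℕ → Decision A} {n m : ℕ}
    (h : tracePrefix t n = tracePrefix t' n) (hm : m < n) : t m = t' m := by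
  have h₁ := getElem_tracePrefix t (n := n) (m := m) (by simpa using hm)
  have h₂ := getElem_tracePrefix t' (n := n) (m := m) (by simpa using hm)
  rw [← h₁, ← h₂]
  simp only [h]

theorem primaryHistory_eq (π : Profile A) (n : ℕ) :
    primaryHistory π n = tracePrefix (primaryTrace π) n := by
  induction n with
  | zero => rfl
  | succ n ih => rw [tracePrefix_succ, ← ih]; rfl

theorem primaryTrace_eq (π : Profile A) (n : ℕ) :
    primaryTrace π n = π (tracePrefix (primaryTrace π) n) := by
  rw [← primaryHistory_eq]; rfl

theorem eval_tracePrefix_succ {Q : Type*} (M : DFA (Decision A) Q) (t : ℕ → Decision A) (n : ℕ) :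
    M.eval (tracePrefix t (n + 1)) = M.step (M.eval (tracePrefix t n)) (t n) := by
  rw [tracePrefix_succ, DFA.eval_append_singleton]

/-- In the history `h`, all agents but `j` follow `π`. -/
def Consistent (π : Profile A) (j : ι) (h : List (Decision A)) : Prop :=
  ∀ n (hn : n < h.length), ∀ i, i ≠ j → h[n] i = π (h.take n) i

theorem Consistent.snoc {π : Profile A} {j : ι} {h : List (Decision A)} {d : Decision A}
    (hh : Consistent π j h) (hd : ∀ i, i ≠ j → d i = π h i) : Consistent π j (h ++ [d]) := by
  intro n hn i hi
  rw [List.length_append, List.length_singleton] at hn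
  rcases Nat.lt_succ_iff_lt_or_eq.1 hn with hn | rfl
  · rw [List.getElem_append_left hn, List.take_append_of_le_length hn.le]
    exact hh n hn i hi
  · simpa using hd i hi

/-- Replay `h` and let all agents, `j` included, follow `π` afterwards. -/
theorem Consistent.exists_trace {π : Profile A} {j : ι} {h : List (Decision A)}
    (hh : Consistent π j h) : ∃ t : ℕ → Decision A, tracePrefix t h.length = h ∧
      ∀ n, ∀ i, i ≠ j → t n i = π (tracePrefix t n) i := by
  classical
  let π' : Profile A := fun l => if hl : l.length < h.length then h[l.length] else π l
  let t := primaryTrace π'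
  have ht : ∀ n, t n = π' (tracePrefix t n) := primaryTrace_eq π'
  have ht₁ : ∀ n (hn : n < h.length), t n = h[n] := fun n hn => by
    rw [ht]; simp [π', hn]
  have ht₂ : ∀ n, ¬ n < h.length → t n = π (tracePrefix t n) := fun n hn => by
    rw [ht]; simp [π', hn]
  have hpre : ∀ n ≤ h.length, tracePrefix t n = h.take n := by
    intro n hn
    induction n with
    | zero => simp [tracePrefix]
    | succ n ih =>
      rw [tracePrefix_succ, ih (by omega), ht₁ n (by omega), List.take_succ_eq_append_getElem]
  refine ⟨t, by rw [hpre _ le_rfl, List.take_length], fun n i hi => ?_⟩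
  by_cases hn : n < h.length
  · rw [ht₁ n hn, hpre n hn.le]
    exact hh n hn i hi
  · rw [ht₂ n hn]

variable [DecidableEq ι]

/-- The states of a goal automaton of agent `j` from which the other agents can keep `j` from
ever reaching an accepting state (now included). -/
def safeStates {Q : Type*} (M : DFA (Decision A) Q) (j : ι) : Set Q :=
  {q | ∃ S : Set Q, q ∈ S ∧
    ∀ p ∈ S, p ∉ M.accept ∧ ∃ d : Decision A, ∀ a : A j, M.step p (update d j a) ∈ S}

/-- The safe states form the union of all sets with the closure property, and such a union has it
again. -/
theorem safeStates_spec {Q : Type*} {M : DFA (Decision A) Q} {j : ι} {q : Q}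
    (h : q ∈ safeStates M j) : q ∉ M.accept ∧
      ∃ d : Decision A, ∀ a : A j, M.step q (update d j a) ∈ safeStates M j := by
  obtain ⟨S, hq, hS⟩ := h
  obtain ⟨h₁, d, hd⟩ := hS q hq
  exact ⟨h₁, d, fun a => ⟨S, hd a, hS⟩⟩

variable {Q : ι → Type*} {goal : ∀ i, DFA (Decision A) (Q i)} {W : Set ι}

theorem IsWNE.step_mem_safeStates {π : Profile A} (hπ : IsWNE goal W π) {j : ι} (hj : j ∉ W)
    (n : ℕ) (a : A j) : (goal j).step ((goal j).eval (tracePrefix (primaryTrace π) n))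
      (update (primaryTrace π n) j a) ∈ safeStates (goal j) j := by
  have hcons : ∀ n, Consistent π j (tracePrefix (primaryTrace π) n) := by
    intro n
    induction n with
    | zero => intro n hn; simp at hn
    | succ n ih =>
      rw [tracePrefix_succ]
      exact ih.snoc fun i _ => by rw [primaryTrace_eq]
  -- The states reached by nonempty consistent histories. Such a history extends to a trace that is
  -- `j`-deviant or primary, and neither may satisfy the goal of `j`. The empty history is excluded
  -- because acceptance there does not count.
  refine ⟨{q | ∃ h, h ≠ [] ∧ Consistent π j h ∧ q = (goal j).eval h}, ?_, ?_⟩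
  · refine ⟨tracePrefix (primaryTrace π) n ++ [update (primaryTrace π n) j a], by simp,
      (hcons n).snoc fun i hi => ?_, by rw [DFA.eval_append_singleton]⟩
    rw [update_of_ne hi, primaryTrace_eq]
  · rintro _ ⟨h, hne, hh, rfl⟩
    refine ⟨fun hacc => ?_, π h, fun a => ⟨h ++ [update (π h) j a], by simp,
      hh.snoc fun i hi => by rw [update_of_ne hi], by rw [DFA.eval_append_singleton]⟩⟩
    obtain ⟨t, ht, hdev⟩ := hh.exists_trace
    have hsat : TraceSatisfies (goal j) t := by
      refine ⟨h.length - 1, ?_⟩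
      rw [Nat.sub_add_cancel (List.length_pos_iff.2 hne), ht]
      exact hacc
    by_cases htp : t = primaryTrace π
    · exact hj ((hπ.1 j).1 (htp ▸ hsat))
    · exact hπ.2 j hj t ⟨hdev, htp⟩ hsat

theorem exists_isWNE_of_trace (t : ℕ → Decision A) (hW : ∀ i ∈ W, TraceSatisfies (goal i) t)
    (hsafe : ∀ j ∉ W, ∀ n a, (goal j).step ((goal j).eval (tracePrefix t n)) (update (t n) j a) ∈
      safeStates (goal j) j) : ∃ π, IsWNE goal W π := by
  classical
  -- The agents that act differently at the position where `h` first leaves `t`; on a `j`-deviant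
  -- trace only `j` can be among them.
  let Dev : List (Decision A) → ι → Prop := fun h j =>
    ∃ n, ∃ hn : n < h.length, h.take n = tracePrefix t n ∧ h[n] j ≠ t n j
  have hwit : ∀ j q, ∃ d : Decision A, q ∈ safeStates (goal j) j →
      ∀ a : A j, (goal j).step q (update d j a) ∈ safeStates (goal j) j := by
    intro j q
    by_cases hq : q ∈ safeStates (goal j) j
    · obtain ⟨_, d, hd⟩ := safeStates_spec hq
      exact ⟨d, fun _ => hd⟩
    · exact ⟨t 0, fun h => absurd h hq⟩
  choose wit hwit using hwit
  let π : Profile A := fun h =>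
    if h = tracePrefix t h.length then t h.length
    else if hx : ∃ j, Dev h j then wit hx.choose ((goal hx.choose).eval h) else t 0
  have hπt : ∀ n, π (tracePrefix t n) = t n := by
    intro n; simp [π]
  have hhist : ∀ n, primaryHistory π n = tracePrefix t n := by
    intro n
    induction n with
    | zero => rfl
    | succ n ih => rw [tracePrefix_succ, primaryHistory, ih, hπt]
  have htrace : primaryTrace π = t := by
    funext n
    rw [primaryTrace, hhist, hπt]
  have hnacc : ∀ j ∉ W, ∀ n, (goal j).eval (tracePrefix t (n + 1)) ∉ (goal j).accept := by
    intro j hj n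
    -- The prescribed action of `j` counts as a trivial deviation, so `t` itself stays among safe
    -- states.
    have := hsafe j hj n (t n j)
    rw [update_eq_self] at this
    rw [eval_tracePrefix_succ]
    exact (safeStates_spec this).1
  refine ⟨π, fun i => ?_, ?_⟩
  · rw [htrace]
    refine ⟨fun ⟨n, hn⟩ => ?_, hW i⟩
    by_contra hi
    exact hnacc i hi n hn
  · rintro j hj t' ⟨hdev, hne⟩ ⟨n, hn⟩
    rw [htrace] at hne
    have hex : ∃ n, t' n ≠ t n := by
      by_contra! h
      exact hne (funext h)
    let n₀ := Nat.find hex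
    have hn₀ : t' n₀ ≠ t n₀ := Nat.find_spec hex
    have hlt : ∀ m < n₀, t' m = t m := fun m hm => not_not.1 (Nat.find_min hex hm)
    have hpre : ∀ m ≤ n₀, tracePrefix t' m = tracePrefix t m := fun m hm =>
      tracePrefix_congr fun k hk => hlt k (hk.trans_le hm)
    have hothers : ∀ i, i ≠ j → t' n₀ i = t n₀ i := fun i hi => by
      rw [hdev n₀ i hi, hpre n₀ le_rfl, hπt]
    have hpre' : ∀ m, n₀ < m → tracePrefix t' m ≠ tracePrefix t m := fun m hm h =>
      hn₀ (eq_of_tracePrefix_eq h hm)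
    have hDev : ∀ m, n₀ < m → ∀ i, Dev (tracePrefix t' m) i → i = j := by
      rintro m hm i ⟨k, hk, htake, hki⟩
      rw [getElem_tracePrefix] at hki
      rw [length_tracePrefix] at hk
      rw [take_tracePrefix _ hk.le] at htake
      have hk₀ : k = n₀ := by
        rcases lt_trichotomy k n₀ with h | h | h
        · exact absurd (congrFun (hlt k h) i) hki
        · exact h
        · exact absurd htake (hpre' k h)
      subst hk₀
      by_contra hij
      exact hki (hothers i hij)
    have hDev' : ∀ m, n₀ < m → ∃ i, Dev (tracePrefix t' m) i := by
      intro m hm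
      obtain ⟨i, hi⟩ := Function.ne_iff.1 hn₀
      refine ⟨i, n₀, by simpa using hm, ?_, ?_⟩
      · rw [take_tracePrefix _ hm.le, hpre n₀ le_rfl]
      · rwa [getElem_tracePrefix]
    have hπ' : ∀ m, n₀ < m →
        π (tracePrefix t' m) = wit j ((goal j).eval (tracePrefix t' m)) := by
      intro m hm
      have hx := hDev' m hm
      have hj' := hDev m hm _ hx.choose_spec
      simp only [π, length_tracePrefix, hpre' m hm, if_false, dif_pos hx]
      rw [hj']
    -- The departure at `n₀` leads to a safe state by `hsafe`; from then on the witness decisions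
    -- against `j` preserve safety.
    have hsafe' : ∀ m, n₀ < m → (goal j).eval (tracePrefix t' m) ∈ safeStates (goal j) j := by
      intro m hm
      induction m with
      | zero => omega
      | succ m ih =>
        rw [eval_tracePrefix_succ]
        rcases Nat.lt_succ_iff_lt_or_eq.1 hm with hm | hm
        · have h₁ := hwit j _ (ih hm) (t' m j)
          have h₂ : update (wit j ((goal j).eval (tracePrefix t' m))) j (t' m j) = t' m := by
            funext i
            by_cases hi : i = j
            · subst hi; simp
            · rw [update_of_ne hi, hdev m i hi, hπ' m hm]
          rwa [h₂] at h₁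
        · rw [← hm] at *
          have h₁ := hsafe j hj n₀ (t' n₀ j)
          have h₂ : update (t n₀) j (t' n₀ j) = t' n₀ := by
            funext i
            by_cases hi : i = j
            · subst hi; simp
            · rw [update_of_ne hi, hothers i hi]
          rw [hpre n₀ le_rfl]
          rwa [h₂] at h₁
    rcases Nat.lt_or_ge n₀ (n + 1) with h | h
    · exact (safeStates_spec (hsafe' _ h)).1 hn
    · refine hnacc j hj n ?_
      rw [← hpre _ h]; exact hn

/-- There is a `W`-NE strategy profile iff there is a trace that satisfies the goals of the agents
in `W` and along which every deviation of another agent leads to a safe state. -/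
theorem exists_isWNE_iff : (∃ π, IsWNE goal W π) ↔ ∃ t : ℕ → Decision A,
    (∀ i ∈ W, TraceSatisfies (goal i) t) ∧ ∀ j ∉ W, ∀ n a,
      (goal j).step ((goal j).eval (tracePrefix t n)) (update (t n) j a) ∈
        safeStates (goal j) j :=
  ⟨fun ⟨π, hπ⟩ => ⟨primaryTrace π, fun i hi => (hπ.1 i).2 hi, fun _ hj n a =>
    hπ.step_mem_safeStates hj n a⟩, fun ⟨t, h₁, h₂⟩ => exists_isWNE_of_trace t h₁ h₂⟩

end Characterization

/-! ### Traces and lassos -/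

section Lasso

variable {ι : Type*} {A : ι → Type*} {Q : ι → Type*}

/-- The next state of an automaton that stops (in the state `none`) as soon as it accepts. -/
noncomputable def stopStep {S : Type*} (M : DFA (Decision A) S) (o : Option S) (d : Decision A) :
    Option S :=
  open Classical in o.bind fun q => if M.step q d ∈ M.accept then none else some (M.step q d)

/-- The tuple of states after `n` steps of a trace. -/
noncomputable def vertexAt (goal : ∀ i, DFA (Decision A) (Q i)) (t : ℕ → Decision A) :
    ℕ → ∀ i, Option (Q i)
  | 0, i => some (goal i).start
  | n + 1, i => stopStep (goal i) (vertexAt goal t n i) (t n)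

variable {goal : ∀ i, DFA (Decision A) (Q i)}

theorem vertexAt_of_not_accept {t : ℕ → Decision A} {i : ι} {n : ℕ}
    (h : ∀ m < n, (goal i).eval (tracePrefix t (m + 1)) ∉ (goal i).accept) :
    vertexAt goal t n i = some ((goal i).eval (tracePrefix t n)) := by
  induction n with
  | zero => rfl
  | succ n ih =>
    have h₁ := h n (by omega)
    rw [vertexAt, ih fun m hm => h m (by omega)]
    rw [eval_tracePrefix_succ] at h₁ ⊢
    simp [stopStep, h₁]

/-- The value `none` is absorbing, so it records that the goal has been reached. The initial state
is not tested, in accordance with satisfaction on nonempty prefixes. -/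
theorem vertexAt_eq_none_iff {t : ℕ → Decision A} {i : ι} {n : ℕ} : vertexAt goal t n i = none ↔
    ∃ m < n, (goal i).eval (tracePrefix t (m + 1)) ∈ (goal i).accept := by
  induction n with
  | zero => simp [vertexAt]
  | succ n ih =>
    by_cases h : ∃ m < n, (goal i).eval (tracePrefix t (m + 1)) ∈ (goal i).accept
    · obtain ⟨m, hm, h'⟩ := h
      rw [vertexAt, ih.2 ⟨m, hm, h'⟩]
      exact ⟨fun _ => ⟨m, by omega, h'⟩, fun _ => rfl⟩
    · push Not at h
      rw [vertexAt, vertexAt_of_not_accept h]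
      by_cases h' : (goal i).eval (tracePrefix t (n + 1)) ∈ (goal i).accept
      · refine ⟨fun _ => ⟨n, by omega, h'⟩, fun _ => ?_⟩
        rw [eval_tracePrefix_succ] at h'
        simp [stopStep, h']
      · have h'' := h'
        rw [eval_tracePrefix_succ] at h''
        simp only [stopStep, Option.bind_some, h'', if_false, reduceCtorEq, false_iff]
        rintro ⟨m, hm, hm'⟩
        rcases Nat.lt_succ_iff_lt_or_eq.1 hm with hm | rfl
        · exact h m hm hm'
        · exact h' hm'

/-- Every vertex from which `u` can be reached has a successor of the same kind. -/
theorem exists_path_of_transGen {V : Type*} {E : V → V → Prop} {u : V} (h : TransGen E u u) :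
    ∃ f : ℕ → V, f 0 = u ∧ ∀ n, E (f n) (f (n + 1)) := by
  have hnext : ∀ v : {v // ReflTransGen E v u}, ∃ w : {w // ReflTransGen E w u}, E v w := by
    rintro ⟨v, hv⟩
    rcases hv.cases_head with rfl | ⟨w, hvw, hwu⟩
    · obtain ⟨w, hvw, hwu⟩ := TransGen.head'_iff.1 h
      exact ⟨⟨w, hwu⟩, hvw⟩
    · exact ⟨⟨w, hwu⟩, hvw⟩
  choose g hg using hnext
  refine ⟨fun n => (g^[n] ⟨u, .refl⟩ : {v // ReflTransGen E v u}), rfl, fun n => ?_⟩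
  beta_reduce
  rw [iterate_succ_apply']
  exact hg _

theorem exists_path_of_reflTransGen {V : Type*} {E : V → V → Prop} {u v : V}
    (h : ReflTransGen E v u) (hu : ∃ f : ℕ → V, f 0 = u ∧ ∀ n, E (f n) (f (n + 1))) :
    ∃ f : ℕ → V, f 0 = v ∧ (∀ n, E (f n) (f (n + 1))) ∧ ∃ n, f n = u := by
  induction h using ReflTransGen.head_induction_on with
  | refl =>
    obtain ⟨f, h₀, hf⟩ := hu
    exact ⟨f, h₀, hf, 0, h₀⟩
  | @head v w hvw _ ih =>
    obtain ⟨f, h₀, hf, n, hn⟩ := ih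
    refine ⟨fun n => Nat.casesOn n v f, rfl, fun n => ?_, n + 1, hn⟩
    cases n with
    | zero => simpa [h₀] using hvw
    | succ n => exact hf n

theorem reflTransGen_of_path {V : Type*} {E : V → V → Prop} {f : ℕ → V}
    (hf : ∀ n, E (f n) (f (n + 1))) {m n : ℕ} (h : m ≤ n) : ReflTransGen E (f m) (f n) := by
  induction n, h using Nat.le_induction with
  | base => exact .refl
  | succ n _ ih => exact ih.tail (hf n)

/-- The edges of the graph whose vertices are the tuples of states of the stopping automata: there
is a decision that leads from `u` to `v` and for which every deviation of an agent that is not in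
`W` leads to a safe state. -/
def Edge [DecidableEq ι] (goal : ∀ i, DFA (Decision A) (Q i)) (W : Set ι)
    (u v : ∀ i, Option (Q i)) : Prop :=
  ∃ d : Decision A, (∀ i, v i = stopStep (goal i) (u i) d) ∧
    ∀ j ∉ W, ∃ q, u j = some q ∧ ∀ a, (goal j).step q (update d j a) ∈ safeStates (goal j) j

/-- There is a suitable trace iff the graph has a lasso on whose cycle all goals of the agents in `W`
have been reached. -/
theorem exists_trace_iff [DecidableEq ι] {W : Set ι} [Finite ι] [∀ i, Finite (Q i)] :
    (∃ t : ℕ → Decision A,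
    (∀ i ∈ W, TraceSatisfies (goal i) t) ∧ ∀ j ∉ W, ∀ n a,
      (goal j).step ((goal j).eval (tracePrefix t n)) (update (t n) j a) ∈
        safeStates (goal j) j) ↔
    ∃ u, ReflTransGen (Edge goal W) (fun i => some (goal i).start) u ∧ (∀ i ∈ W, u i = none) ∧
      TransGen (Edge goal W) u u := by
  constructor
  · rintro ⟨t, hW, hsafe⟩
    have hnacc : ∀ j ∉ W, ∀ n, (goal j).eval (tracePrefix t (n + 1)) ∉ (goal j).accept := by
      intro j hj n
      have := hsafe j hj n (t n j)
      rw [update_eq_self] at this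
      rw [eval_tracePrefix_succ]
      exact (safeStates_spec this).1
    have hedge : ∀ n, Edge goal W (vertexAt goal t n) (vertexAt goal t (n + 1)) := fun n =>
      ⟨t n, fun i => rfl, fun j hj => ⟨_, vertexAt_of_not_accept fun m _ => hnacc j hj m,
        hsafe j hj n⟩⟩
    have hev : ∃ N, ∀ n ≥ N, ∀ i ∈ W, vertexAt goal t n i = none := by
      have h₁ : ∀ i, ∃ N, ∀ n ≥ N, i ∈ W → vertexAt goal t n i = none := by
        intro i
        by_cases hi : i ∈ W
        · obtain ⟨m, hm⟩ := hW i hi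
          exact ⟨m + 1, fun n hn _ => vertexAt_eq_none_iff.2 ⟨m, hn, hm⟩⟩
        · exact ⟨0, fun _ _ h => absurd h hi⟩
      choose N hN using h₁
      obtain ⟨B, hB⟩ := (Set.finite_range N).bddAbove
      exact ⟨B, fun n hn i hi => hN i n ((hB ⟨i, rfl⟩).trans hn) hi⟩
    obtain ⟨N, hN⟩ := hev
    -- Past time `N` all goals of `W` are reached, and finiteness forces a repeated vertex, which
    -- closes the cycle.
    obtain ⟨a, b, hab, he⟩ :=
      Finite.exists_ne_map_eq_of_infinite fun n => vertexAt goal t (N + n)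
    wlog hlt : a < b generalizing a b
    · exact this b a hab.symm he.symm (by omega)
    refine ⟨vertexAt goal t (N + a), reflTransGen_of_path (m := 0) hedge (Nat.zero_le _),
      hN _ (by omega), ?_⟩
    refine .head' (hedge _) ?_
    have := reflTransGen_of_path hedge (m := N + a + 1) (n := N + b) (by omega)
    rwa [← he] at this
  · rintro ⟨u, hu, hW, huu⟩
    obtain ⟨f, h₀, hf, N, hN⟩ := exists_path_of_reflTransGen hu (exists_path_of_transGen huu)
    choose t ht ht' using hf
    have hv : ∀ n, f n = vertexAt goal t n := by
      intro n
      induction n with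
      | zero => exact h₀
      | succ n ih => funext i; rw [ht, ih, vertexAt]
    refine ⟨t, fun i hi => ?_, fun j hj n a => ?_⟩
    · have := hW i hi
      rw [← hN, hv, vertexAt_eq_none_iff] at this
      obtain ⟨m, _, hm⟩ := this
      exact ⟨m, hm⟩
    -- Every vertex on the path has an outgoing edge, and edges require an unfinished goal for each
    -- agent outside `W`.
    · have hsome : ∀ n, vertexAt goal t n j ≠ none := by
        intro n h
        obtain ⟨q, hq, _⟩ := ht' n j hj
        rw [hv, h] at hq
        cases hq
      have hnacc : ∀ m < n, (goal j).eval (tracePrefix t (m + 1)) ∉ (goal j).accept :=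
        fun m hm h => hsome n (vertexAt_eq_none_iff.2 ⟨m, hm, h⟩)
      obtain ⟨q, hq, hqa⟩ := ht' n j hj
      rw [hv, vertexAt_of_not_accept hnacc] at hq
      rw [Option.some.inj hq]
      exact hqa a

end Lasso

/-! ### Bit strings as lists of numbers -/

/-- One step of the computation of the length of a block of ones: the first component of the state
counts down to `1` when the block is reached, the second one counts the ones of the block. -/
noncomputable def blkStep (b : Prop) (s : ℕ × ℕ) : ℕ × ℕ :=
  open Classical in
  if b then (if s.1 = 1 then (s.1, s.2 + 1) else s) else (s.1 - 1, s.2)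

/-- The number of ones in the block with index `i` of the bit string `word X`. -/
noncomputable def blk (X i : ℕ) : ℕ :=
  ((word X).foldl (fun s (b : Bool) => blkStep (b = true) s) (i + 1, 0)).2

/-- One step of the computation of the number of zeros. -/
noncomputable def cntStep (b : Prop) (s : ℕ) : ℕ := open Classical in if b then s else s + 1

/-- The number of zeros in the bit string `word X`. -/
noncomputable def cnt (X : ℕ) : ℕ := (word X).foldl (fun s (b : Bool) => cntStep (b = true) s) 0

/-- The bit string `word X` ends with a one. -/
def Unfinished (X : ℕ) : Prop := (word X).foldl (fun _ (b : Bool) => b = true) False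

theorem foldl_blkStep_le (w : List Bool) (s : ℕ × ℕ) :
    (w.foldl (fun s (b : Bool) => blkStep (b = true) s) s).1 ≤ s.1 ∧
    (w.foldl (fun s (b : Bool) => blkStep (b = true) s) s).2 ≤ s.2 + w.length := by
  induction w generalizing s with
  | nil => simp
  | cons b w ih =>
    have h := ih (blkStep (b = true) s)
    have h₁ : (blkStep (b = true) s).1 ≤ s.1 ∧ (blkStep (b = true) s).2 ≤ s.2 + 1 := by
      unfold blkStep
      split
      · split <;> simp
      · simp
    simp only [List.foldl_cons, List.length_cons]
    omega

theorem blk_le (X i : ℕ) : blk X i ≤ len X := by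
  have := (foldl_blkStep_le (word X) (i + 1, 0)).2
  simpa [len, blk] using this

theorem foldl_blkStep_replicate (n : ℕ) (s : ℕ × ℕ) :
    (List.replicate n true).foldl (fun s (b : Bool) => blkStep (b = true) s) s =
      if s.1 = 1 then (s.1, s.2 + n) else s := by
  induction n generalizing s with
  | zero => simp
  | succ n ih =>
    rw [List.replicate_succ, List.foldl_cons, ih]
    by_cases h : s.1 = 1 <;> simp [blkStep, h]
    omega

theorem bitsOfNats_cons (n : ℕ) (l : List ℕ) :
    bitsOfNats (n :: l) = List.replicate n true ++ false :: bitsOfNats l := by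
  simp [bitsOfNats]

/-- Once the wanted block is over the counter is `0`, and truncated subtraction keeps it there, so
nothing more is counted. -/
theorem foldl_blkStep_zero (l : List ℕ) (c : ℕ) :
    (bitsOfNats l).foldl (fun s (b : Bool) => blkStep (b = true) s) (0, c) = (0, c) := by
  induction l with
  | nil => rfl
  | cons n l ih =>
    rw [bitsOfNats_cons, List.foldl_append, foldl_blkStep_replicate]
    simpa [blkStep] using ih

theorem foldl_blkStep_bitsOfNats (l : List ℕ) (i : ℕ) :
    ((bitsOfNats l).foldl (fun s (b : Bool) => blkStep (b = true) s) (i + 1, 0)).2 =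
      l.getD i 0 := by
  induction l generalizing i with
  | nil => simp [bitsOfNats]
  | cons n l ih =>
    rw [bitsOfNats_cons, List.foldl_append, foldl_blkStep_replicate, List.foldl_cons]
    cases i with
    | zero =>
      have e : blkStep (false = true) (0 + 1, 0 + n) = (0, n) := by simp [blkStep]
      rw [if_pos rfl, e, foldl_blkStep_zero]
      rfl
    | succ i => simpa [blkStep] using ih i

theorem foldl_cnt (l : List ℕ) (c : ℕ) : (bitsOfNats l).foldl
    (fun s (b : Bool) => cntStep (b = true) s) c = c + l.length := by
  induction l generalizing c with
  | nil => simp [bitsOfNats]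
  | cons n l ih =>
    have h : ∀ n c, (List.replicate n true).foldl
        (fun s (b : Bool) => cntStep (b = true) s) c = c := by
      intro n c
      induction n with
      | zero => rfl
      | succ n ih => simpa [List.replicate_succ, cntStep] using ih
    rw [bitsOfNats_cons, List.foldl_append, h, List.foldl_cons, ih]
    simp [cntStep]; omega

theorem blk_bitsOfNats (l : List ℕ) (i : ℕ) : blk (val (bitsOfNats l)) i = l.getD i 0 := by
  rw [blk, word_val, foldl_blkStep_bitsOfNats]

theorem cnt_bitsOfNats (l : List ℕ) : cnt (val (bitsOfNats l)) = l.length := by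
  rw [cnt, word_val, foldl_cnt, Nat.zero_add]

theorem bitsOfNats_append (l l' : List ℕ) :
    bitsOfNats (l ++ l') = bitsOfNats l ++ bitsOfNats l' := by simp [bitsOfNats]

theorem exists_bitsOfNats_append (w : List Bool) :
    ∃ l n, w = bitsOfNats l ++ List.replicate n true := by
  induction w using List.reverseRecOn with
  | nil => exact ⟨[], 0, rfl⟩
  | append_singleton w b ih =>
    obtain ⟨l, n, rfl⟩ := ih
    cases b
    · refine ⟨l ++ [n], 0, ?_⟩
      rw [bitsOfNats_append, bitsOfNats_cons]
      simp [bitsOfNats]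
    · exact ⟨l, n + 1, by rw [List.replicate_succ']; simp⟩

/-- Every bit string is a sequence of blocks followed by some ones, and the trailing ones are absent
iff it does not end with a one. -/
theorem not_unfinished_iff (w : List Bool) : ¬ Unfinished (val w) ↔ ∃ l, w = bitsOfNats l := by
  rw [Unfinished, word_val]
  constructor
  · intro h
    obtain ⟨l, n, rfl⟩ := exists_bitsOfNats_append w
    cases n with
    | zero => exact ⟨l, by simp⟩
    | succ n =>
      rw [List.replicate_succ', ← List.append_assoc, List.foldl_append] at h
      simp at h
  · rintro ⟨l, rfl⟩
    induction l using List.reverseRecOn with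
    | nil => simp [bitsOfNats]
    | append_singleton l n _ => simp [bitsOfNats]

theorem eq_map_blk (l : List ℕ) :
    l = (List.range (cnt (val (bitsOfNats l)))).map (blk (val (bitsOfNats l))) := by
  rw [cnt_bitsOfNats]
  refine List.ext_getElem (by simp) fun i h _ => ?_
  rw [List.getElem_map, List.getElem_range, blk_bitsOfNats, List.getD_eq_getElem _ _ h]

theorem bitsOfNats_injective : Injective bitsOfNats := by
  intro l l' h
  rw [eq_map_blk l, eq_map_blk l', h]

section

variable {β : Type} [Enc β]

@[fun_prop]
theorem PolySpace.blk {f g : β → ℕ} (hf : PolySpace f) (hg : PolySpace g) :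
    PolySpace fun x => blk (f x) (g x) := by
  refine PolySpace.snd (PolySpace.foldl (g := fun _ b s => blkStep b s)
    (B := fun x => g x + 1 + IteratedGames.len (f x)) ?_ (by fun_prop) hf (by fun_prop) ?_)
  · unfold blkStep; fun_prop
  · intro x w hw m hm
    have h := foldl_blkStep_le w (g x + 1, 0)
    rcases List.mem_append.1 hm with hm | hm
    · obtain rfl := List.mem_singleton.1 hm
      omega
    · obtain rfl := List.mem_singleton.1 hm
      omega

@[fun_prop]
theorem PolySpace.cnt {f : β → ℕ} (hf : PolySpace f) : PolySpace fun x => cnt (f x) := by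
  refine PolySpace.foldl (g := fun _ b s => cntStep b s) (i := fun _ => 0)
    (B := fun x => IteratedGames.len (f x)) ?_ (by fun_prop) hf (by fun_prop) ?_
  · unfold cntStep; fun_prop
  · intro x w hw m hm
    obtain rfl := List.mem_singleton.1 hm
    refine le_trans ?_ hw
    have : ∀ (w : List Bool) (c : ℕ),
        w.foldl (fun s (b : Bool) => cntStep (b = true) s) c ≤ c + w.length := by
      intro w
      induction w with
      | nil => simp
      | cons b w ih =>
        intro c
        have h₁ := ih c
        have h₂ := ih (c + 1)
        cases b <;> simp [cntStep] at * <;> omega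
    simpa using this w 0

@[fun_prop]
theorem PolySpace.unfinished {f : β → ℕ} (hf : PolySpace f) :
    PolySpace fun x => Unfinished (f x) := by
  refine PolySpace.foldl (σ := Prop) (g := fun _ b _ => b) (i := fun _ => False) (B := fun _ => 1)
    (by fun_prop) (by fun_prop) hf (by fun_prop) ?_
  intro x w hw m hm
  obtain rfl := List.mem_singleton.1 hm
  exact indicator_le _

end

/-! ### The instance that is encoded by a number

The functions below read the instance off the bit string `word X`. -/

/-- The number of actions of agent `j`. -/
noncomputable def actN (X j : ℕ) : ℕ := blk X (1 + j)

/-- The weight of the action of agent `j` in the code of a decision. -/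
noncomputable def wtN (X j : ℕ) : ℕ := Nat.rec 1 (fun i s => s * actN X i) (min j (len X))

/-- The number of decisions. -/
noncomputable def decN (X : ℕ) : ℕ := wtN X (blk X 0)

/-- The position at which the automaton of agent `i` starts. -/
noncomputable def offN (X i : ℕ) : ℕ :=
  Nat.rec (1 + blk X 0) (fun _ o => o + (2 + blk X o + blk X o * decN X)) i

/-- The number of states of the automaton of agent `i`. -/
noncomputable def stN (X i : ℕ) : ℕ := blk X (offN X i)

/-- The initial state of the automaton of agent `i`. -/
noncomputable def startN (X i : ℕ) : ℕ := blk X (offN X i + 1)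

/-- The indicator of the accepting states of the automaton of agent `i`. -/
noncomputable def accN (X i q : ℕ) : ℕ := blk X (offN X i + 2 + q)

/-- The transition function of the automaton of agent `i`. -/
noncomputable def delN (X i q l : ℕ) : ℕ := blk X (offN X i + 2 + stN X i + (q * decN X + l))

/-- The indicator of `W`. -/
noncomputable def memN (X i : ℕ) : ℕ := blk X (offN X (blk X 0) + i)

/-- The bit string `word X` encodes an instance. -/
def ValidN (X : ℕ) : Prop :=
  ¬ Unfinished X ∧ cnt X = offN X (blk X 0) + blk X 0 ∧
  ∀ i, i < blk X 0 → 0 < actN X i ∧ startN X i < stN X i ∧ memN X i ≤ 1 ∧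
    ∀ q, q < stN X i → accN X i q ≤ 1 ∧ ∀ l, l < decN X → delN X i q l < stN X i

/-- The code of the decision in which the action of `j` in the decision with code `l` is replaced
by `a`. -/
noncomputable def subN (X l j a : ℕ) : ℕ := l - l / wtN X j % actN X j * wtN X j + a * wtN X j

/-- The base in which tuples of states are encoded. -/
noncomputable def baseN (X : ℕ) : ℕ := 2 ^ (len (2 * X + 1) * len 1)

/-- The bound for the codes of tuples and sets of states. -/
noncomputable def bndN (X : ℕ) : ℕ := 2 ^ (len (2 * X + 1) * len (2 * X + 1))

/-- The state `q` of the automaton of `j` is safe. -/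
def safeN (X j q : ℕ) : Prop :=
  ∃ S, S < bndN X ∧ dig 2 S q = 1 ∧ ∀ p, p < stN X j → dig 2 S p = 1 →
    accN X j p ≠ 1 ∧ ∃ l, l < decN X ∧ ∀ a, a < actN X j → dig 2 S (delN X j p (subN X l j a)) = 1

/-- One step of the stopping automaton of agent `i`. -/
noncomputable def stopStepN (X i q l : ℕ) : ℕ :=
  open Classical in
  if q < stN X i ∧ accN X i (delN X i q l) ≠ 1 then delN X i q l else stN X i

/-- The edges of the graph on the codes of tuples of states. -/
def EdgeN (X u v : ℕ) : Prop :=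
  u < bndN X ∧ v < bndN X ∧ ∃ l, l < decN X ∧
    (∀ i, i < blk X 0 → dig (baseN X) v i = stopStepN X i (dig (baseN X) u i) l) ∧
    ∀ j, j < blk X 0 → memN X j = 0 → dig (baseN X) u j < stN X j ∧
      ∀ a, a < actN X j → safeN X j (delN X j (dig (baseN X) u j) (subN X l j a))

/-- The graph has a lasso on which all goals of the agents in `W` are reached. -/
def WinN (X : ℕ) : Prop :=
  ∃ s, s < bndN X ∧ (∀ i, i < blk X 0 → dig (baseN X) s i = startN X i) ∧
    ∃ u, u < bndN X ∧ ReflTransGen (EdgeN X) s u ∧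
      (∀ i, i < blk X 0 → memN X i = 1 → stN X i ≤ dig (baseN X) u i) ∧
      ∃ w, w < bndN X ∧ EdgeN X u w ∧ ReflTransGen (EdgeN X) w u

section

variable {β : Type} [Enc β] {f g h k : β → ℕ}

@[fun_prop]
theorem PolySpace.actN (hf : PolySpace f) (hg : PolySpace g) :
    PolySpace fun x => actN (f x) (g x) := by
  unfold IteratedGames.actN; fun_prop

theorem baseN_eq (X : ℕ) : baseN X = 2 ^ (len X + 1) := by
  rw [baseN, len_two_mul_add_one, show len 1 = 1 from rfl, Nat.mul_one]

theorem lt_baseN (X : ℕ) : X + 1 < baseN X := baseN_eq X ▸ lt_two_pow_len X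

theorem len_lt_baseN (X : ℕ) : len X < baseN X := by
  have := lt_baseN X
  have := len_le X
  omega

theorem bndN_eq (X : ℕ) : bndN X = baseN X ^ (len X + 1) := by
  rw [bndN, baseN_eq, len_two_mul_add_one, pow_mul]

theorem one_le_baseN (X : ℕ) : 1 ≤ baseN X := by
  have := lt_baseN X
  omega

/-- Agents and states are at most `len X` in number by `blk_le`, so `bndN X` bounds the codes of all
tuples and, by the next lemma, of all sets of states. -/
theorem pow_le_bndN (X : ℕ) {k : ℕ} (hk : k ≤ len X) : baseN X ^ k ≤ bndN X := by
  rw [bndN_eq]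
  exact Nat.pow_le_pow_right (one_le_baseN X) (by omega)

theorem two_pow_le_bndN (X : ℕ) {k : ℕ} (hk : k ≤ len X) : 2 ^ k ≤ bndN X := by
  refine (Nat.pow_le_pow_left ?_ k).trans (pow_le_bndN X hk)
  have := lt_baseN X
  omega

theorem wtN_succ (X j : ℕ) (hj : j < len X) : wtN X (j + 1) = wtN X j * actN X j := by
  rw [wtN, wtN, Nat.min_eq_left hj.le, Nat.min_eq_left (Nat.succ_le_of_lt hj)]

theorem wtN_eq_prod (X j : ℕ) (hj : j ≤ len X) : wtN X j = ∏ i ∈ Finset.range j, actN X i := by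
  induction j with
  | zero => simp [wtN]
  | succ j ih => rw [wtN_succ X j hj, ih (by omega), Finset.prod_range_succ]

theorem rec_actN_le (X j : ℕ) : (Nat.rec 1 (fun i s => s * actN X i) j : ℕ) ≤ baseN X ^ j := by
  induction j with
  | zero => simp
  | succ j ih =>
    rw [pow_succ]
    exact Nat.mul_le_mul ih ((blk_le X _).trans (len_lt_baseN X).le)

@[fun_prop]
theorem PolySpace.baseN (hf : PolySpace f) : PolySpace fun x => baseN (f x) := by
  unfold IteratedGames.baseN; fun_prop

@[fun_prop]
theorem PolySpace.bndN (hf : PolySpace f) : PolySpace fun x => bndN (f x) := by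
  unfold IteratedGames.bndN; fun_prop

-- Space has to be bounded for all numbers, not only for valid codes. Hence the cut-off at `len X`
-- in `wtN`, without which the product could become too long; real instances have at most `len X`
-- agents.
@[fun_prop]
theorem PolySpace.wtN (hf : PolySpace f) (hg : PolySpace g) :
    PolySpace fun x => wtN (f x) (g x) := by
  refine PolySpace.rec_bounded (σ := ℕ) (g := fun x i s => s * IteratedGames.actN (f x) i)
    (i := fun _ => 1) (n := fun x => min (g x) (IteratedGames.len (f x)))
    (B := fun x => IteratedGames.bndN (f x)) (by fun_prop) (by fun_prop) (by fun_prop)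
    (by fun_prop) fun x j hj m hm => ?_
  obtain rfl := List.mem_singleton.1 hm
  exact (rec_actN_le (f x) j).trans (pow_le_bndN _ (hj.trans (min_le_right _ _)))

@[fun_prop]
theorem PolySpace.decN (hf : PolySpace f) : PolySpace fun x => decN (f x) := by
  unfold IteratedGames.decN; fun_prop

theorem offN_le (X i : ℕ) : offN X i ≤ 1 + len X + i * (2 + len X + len X * decN X) := by
  induction i with
  | zero =>
    have := blk_le X 0
    change 1 + blk X 0 ≤ _
    omega
  | succ i ih =>
    have h₁ := blk_le X (offN X i)
    have h₂ := Nat.mul_le_mul_right (decN X) h₁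
    have h₃ : offN X (i + 1) =
      offN X i + (2 + blk X (offN X i) + blk X (offN X i) * decN X) := rfl
    rw [h₃, Nat.succ_mul]
    omega

@[fun_prop]
theorem PolySpace.offN (hf : PolySpace f) (hg : PolySpace g) :
    PolySpace fun x => offN (f x) (g x) := by
  refine PolySpace.rec_bounded (σ := ℕ) (g := fun x _ o => o + (2 + IteratedGames.blk (f x) o +
      IteratedGames.blk (f x) o * IteratedGames.decN (f x)))
    (i := fun x => 1 + IteratedGames.blk (f x) 0) (n := g)
    (B := fun x => 1 + IteratedGames.len (f x) + g x * (2 + IteratedGames.len (f x) +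
      IteratedGames.len (f x) * IteratedGames.decN (f x)))
    (by fun_prop) (by fun_prop) (by fun_prop) (by fun_prop) fun x j hj m hm => ?_
  obtain rfl := List.mem_singleton.1 hm
  refine (offN_le (f x) j).trans ?_
  have := Nat.mul_le_mul_right (2 + IteratedGames.len (f x) +
    IteratedGames.len (f x) * IteratedGames.decN (f x)) hj
  omega

@[fun_prop]
theorem PolySpace.stN (hf : PolySpace f) (hg : PolySpace g) :
    PolySpace fun x => stN (f x) (g x) := by
  unfold IteratedGames.stN; fun_prop

@[fun_prop]
theorem PolySpace.startN (hf : PolySpace f) (hg : PolySpace g) :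
    PolySpace fun x => startN (f x) (g x) := by
  unfold IteratedGames.startN; fun_prop

@[fun_prop]
theorem PolySpace.accN (hf : PolySpace f) (hg : PolySpace g) (hh : PolySpace h) :
    PolySpace fun x => accN (f x) (g x) (h x) := by
  unfold IteratedGames.accN; fun_prop

@[fun_prop]
theorem PolySpace.delN (hf : PolySpace f) (hg : PolySpace g) (hh : PolySpace h)
    (hk : PolySpace k) : PolySpace fun x => delN (f x) (g x) (h x) (k x) := by
  unfold IteratedGames.delN; fun_prop

@[fun_prop]
theorem PolySpace.memN (hf : PolySpace f) (hg : PolySpace g) :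
    PolySpace fun x => memN (f x) (g x) := by
  unfold IteratedGames.memN; fun_prop

@[fun_prop]
theorem PolySpace.subN (hf : PolySpace f) (hg : PolySpace g) (hh : PolySpace h)
    (hk : PolySpace k) : PolySpace fun x => subN (f x) (g x) (h x) (k x) := by
  unfold IteratedGames.subN; fun_prop

@[fun_prop]
theorem PolySpace.validN (hf : PolySpace f) : PolySpace fun x => ValidN (f x) := by
  unfold ValidN; fun_prop

-- All sets of states are tried: their number may be exponential, but each is a number below `bndN`.
@[fun_prop]
theorem PolySpace.safeN (hf : PolySpace f) (hg : PolySpace g) (hh : PolySpace h) :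
    PolySpace fun x => safeN (f x) (g x) (h x) := by
  unfold IteratedGames.safeN; fun_prop

@[fun_prop]
theorem PolySpace.stopStepN (hf : PolySpace f) (hg : PolySpace g) (hh : PolySpace h)
    (hk : PolySpace k) : PolySpace fun x => stopStepN (f x) (g x) (h x) (k x) := by
  unfold IteratedGames.stopStepN; fun_prop

@[fun_prop]
theorem PolySpace.edgeN (hf : PolySpace f) (hg : PolySpace g) (hh : PolySpace h) :
    PolySpace fun x => EdgeN (f x) (g x) (h x) := by
  unfold EdgeN; fun_prop

@[fun_prop]
theorem PolySpace.reflTransGen_edgeN (hf : PolySpace f) (hg : PolySpace g) (hh : PolySpace h) :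
    PolySpace fun x => ReflTransGen (EdgeN (f x)) (g x) (h x) :=
  PolySpace.reflTransGen (E := fun x => EdgeN (f x)) (N := fun x => IteratedGames.bndN (f x))
    (by fun_prop) (by fun_prop) hg hh fun _ _ _ h => ⟨h.1, h.2.1⟩

@[fun_prop]
theorem PolySpace.winN (hf : PolySpace f) : PolySpace fun x => WinN (f x) := by
  unfold WinN; fun_prop

end

/-! ### Correctness of the encoding -/

/-- The list agrees with the values of `D` from position `o` on. -/
def Matches (D : ℕ → ℕ) : ℕ → List ℕ → Prop
  | _, [] => True
  | o, a :: l => a = D o ∧ Matches D (o + 1) l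

theorem matches_append {D : ℕ → ℕ} {o : ℕ} {l l' : List ℕ} :
    Matches D o (l ++ l') ↔ Matches D o l ∧ Matches D (o + l.length) l' := by
  induction l generalizing o with
  | nil => simp [Matches]
  | cons a l ih =>
    rw [List.cons_append, Matches, Matches, ih, List.length_cons, and_assoc,
      show o + 1 + l.length = o + (l.length + 1) by omega]

theorem matches_ofFn {D : ℕ → ℕ} {o n : ℕ} {f : Fin n → ℕ} :
    Matches D o (List.ofFn f) ↔ ∀ i : Fin n, f i = D (o + i) := by
  induction n generalizing o with
  | zero => simp [Matches]
  | succ n ih =>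
    rw [List.ofFn_succ, Matches, ih, Fin.forall_fin_succ]
    simp only [Fin.val_zero, Fin.val_succ, Nat.add_zero]
    simp only [Nat.add_assoc, Nat.add_comm 1]

/-- The offsets are computed from the data themselves, so the next one is known to be right only
once the current block matches. -/
theorem matches_flatten_ofFn {D : ℕ → ℕ} {n : ℕ} (g : Fin n → List ℕ) (offs : ℕ → ℕ)
    (h : ∀ i : Fin n, Matches D (offs i) (g i) → offs (i + 1) = offs i + (g i).length) :
    (Matches D (offs 0) (List.ofFn g).flatten ↔ ∀ i : Fin n, Matches D (offs i) (g i)) ∧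
    ((∀ i : Fin n, Matches D (offs i) (g i)) →
      offs n = offs 0 + (List.ofFn g).flatten.length) := by
  induction n generalizing offs with
  | zero => simp [Matches]
  | succ n ih =>
    obtain ⟨h₁, h₂⟩ := ih (fun i => g i.succ) (fun i => offs (i + 1)) fun i hi => by
      have := h i.succ hi
      simpa using this
    have h₀ := h 0
    simp only [Fin.val_zero, Nat.zero_add] at h₀ h₁ h₂
    rw [List.ofFn_succ, List.flatten_cons, matches_append, Fin.forall_fin_succ]
    simp only [Fin.val_zero, Fin.val_succ, List.length_append]
    refine ⟨and_congr_right fun hm => ?_, fun ⟨hm, hms⟩ => ?_⟩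
    · rw [← h₀ hm]; exact h₁
    · rw [h₂ hms, h₀ hm]; omega

theorem eq_map_range_iff {D : ℕ → ℕ} {n : ℕ} {l : List ℕ} :
    l = (List.range n).map D ↔ Matches D 0 l ∧ n = l.length := by
  have key : ∀ l o, Matches D o l ↔ l = (List.range' o l.length).map D := by
    intro l
    induction l with
    | nil => simp [Matches]
    | cons a l ih => intro o; simp [Matches, ih, List.range'_succ]
  rw [key, ← List.range_eq_range']
  constructor
  · intro h
    have : l.length = n := by rw [h]; simp
    exact ⟨by rw [this]; exact h, this.symm⟩
  · rintro ⟨h, rfl⟩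
    exact h

theorem length_dfaData {k m : ℕ} {a : Fin k → ℕ}
    (M : DFA (Decision fun j => Fin (a j)) (Fin m)) :
    (dfaData M).length = 2 + m + m * ∏ j, a j := by
  simp [dfaData, List.length_flatten, List.map_ofFn, Function.comp_def]
  omega

theorem matches_dfaData {D : ℕ → ℕ} {o k m : ℕ} {a : Fin k → ℕ}
    {M : DFA (Decision fun j => Fin (a j)) (Fin m)} : Matches D o (dfaData M) ↔
      m = D o ∧ (M.start : ℕ) = D (o + 1) ∧
      (∀ q : Fin m, indicator (q ∈ M.accept) = D (o + 2 + q)) ∧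
      ∀ (q : Fin m) (l : Fin (∏ j, a j)),
        (M.step q (finPiFinEquiv.symm l) : ℕ) = D (o + 2 + m + (q * (∏ j, a j) + l)) := by
  have h := (matches_flatten_ofFn (D := D) (fun q : Fin m => List.ofFn fun l : Fin (∏ j, a j) =>
    (M.step q (finPiFinEquiv.symm l) : ℕ)) (fun i => o + 2 + m + i * ∏ j, a j)
    (fun i _ => by rw [List.length_ofFn, Nat.succ_mul]; omega)).1
  simp only [Nat.zero_mul, Nat.add_zero] at h
  unfold dfaData
  rw [List.append_assoc, matches_append, matches_append, matches_ofFn]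
  simp only [Matches, and_true, List.length_cons, List.length_nil, List.length_ofFn, Nat.zero_add,
    Nat.reduceAdd, and_assoc]
  rw [h]
  simp only [matches_ofFn, Nat.add_assoc]

/-- The number `X` describes the instance `(G, W)`. -/
structure Codes (X : ℕ) (G : IBG) (W : Set (Fin G.k)) : Prop where
  k_eq : G.k = blk X 0
  act : ∀ j, G.actions j = actN X j
  st : ∀ i, G.states i = stN X i
  start : ∀ i, ((G.goal i).start : ℕ) = startN X i
  acc : ∀ i q, indicator (q ∈ (G.goal i).accept) = accN X i q
  del : ∀ i q (l : Fin (∏ j, G.actions j)),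
    ((G.goal i).step q (finPiFinEquiv.symm l) : ℕ) = delN X i q l
  mem : ∀ i, indicator (i ∈ W) = memN X i

theorem wtN_eq_of_act {X : ℕ} {G : IBG} (hk : G.k = blk X 0)
    (hact : ∀ j, G.actions j = actN X j) (b : Fin G.k) :
    ∏ j : Fin b, G.actions (Fin.castLE b.is_lt.le j) = wtN X b := by
  rw [wtN_eq_prod, Finset.prod_range]
  · exact Finset.prod_congr rfl fun j _ => hact _
  · have := blk_le X 0
    omega

theorem decN_eq_of_act {X : ℕ} {G : IBG} (hk : G.k = blk X 0)
    (hact : ∀ j, G.actions j = actN X j) : ∏ j, G.actions j = decN X := by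
  rw [decN, wtN_eq_prod _ _ (blk_le X 0), ← hk, Finset.prod_range]
  exact Finset.prod_congr rfl fun j _ => hact _

theorem instanceData_eq_iff {X : ℕ} {G : IBG} {W : Set (Fin G.k)} :
    instanceData G W = (List.range (cnt X)).map (blk X) ↔
      Codes X G W ∧ cnt X = offN X (blk X 0) + blk X 0 := by
  have e₁ : Matches (blk X) 0 (instanceData G W) ↔ G.k = blk X 0 ∧
      (∀ j, G.actions j = actN X j) ∧
      Matches (blk X) (1 + G.k) (List.ofFn fun i => dfaData (G.goal i)).flatten ∧
      ∀ i : Fin G.k, indicator (i ∈ W) =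
        blk X (1 + G.k + (List.ofFn fun i => dfaData (G.goal i)).flatten.length + i) := by
    unfold instanceData
    rw [matches_append, matches_append, matches_append, matches_ofFn, matches_ofFn]
    simp only [Matches, and_true, List.length_append, List.length_cons, List.length_nil,
      List.length_ofFn, Nat.zero_add, and_assoc, actN]
  rw [eq_map_range_iff, e₁]
  have hlen : (instanceData G W).length =
      1 + G.k + (List.ofFn fun i => dfaData (G.goal i)).flatten.length + G.k := by
    unfold instanceData
    rw [List.length_append, List.length_append, List.length_append, List.length_ofFn,
      List.length_ofFn, List.length_singleton]
  have key : ∀ (hk : G.k = blk X 0) (hact : ∀ j, G.actions j = actN X j),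
      (Matches (blk X) (1 + G.k) (List.ofFn fun i => dfaData (G.goal i)).flatten ↔
        ∀ i : Fin G.k, Matches (blk X) (offN X i) (dfaData (G.goal i))) ∧
      ((∀ i : Fin G.k, Matches (blk X) (offN X i) (dfaData (G.goal i))) → offN X (blk X 0) =
        1 + G.k + (List.ofFn fun i => dfaData (G.goal i)).flatten.length) := by
    intro hk hact
    have := matches_flatten_ofFn (D := blk X) (fun i => dfaData (G.goal i)) (offN X)
      fun i hi => by
        rw [length_dfaData, decN_eq_of_act hk hact, (matches_dfaData.1 hi).1]
        rfl
    have h₀ : offN X 0 = 1 + G.k := by rw [hk]; rfl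
    rwa [h₀, show offN X G.k = offN X (blk X 0) by rw [hk]] at this
  constructor
  · rintro ⟨⟨hk, hact, hdfa, hW⟩, hcnt⟩
    obtain ⟨h₁, h₂⟩ := key hk hact
    have hd := h₁.1 hdfa
    rw [← h₂ hd] at hW hlen
    refine ⟨⟨hk, hact, fun i => (matches_dfaData.1 (hd i)).1,
      fun i => (matches_dfaData.1 (hd i)).2.1, fun i => (matches_dfaData.1 (hd i)).2.2.1,
      fun i q l => ?_, hW⟩, by rw [hcnt, hlen, ← hk]⟩
    rw [(matches_dfaData.1 (hd i)).2.2.2, delN, stN, ← decN_eq_of_act hk hact,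
      ← (matches_dfaData.1 (hd i)).1]
  · rintro ⟨h, hcnt⟩
    obtain ⟨h₁, h₂⟩ := key h.k_eq h.act
    have hd : ∀ i : Fin G.k, Matches (blk X) (offN X i) (dfaData (G.goal i)) := by
      refine fun i => matches_dfaData.2 ⟨h.st i, h.start i, h.acc i, fun q l => ?_⟩
      rw [h.del, delN, ← decN_eq_of_act h.k_eq h.act, ← h.st]
    refine ⟨⟨h.k_eq, h.act, h₁.2 hd, fun i => ?_⟩, ?_⟩
    · rw [← h₂ hd, h.mem]; rfl
    · rw [hlen, ← h₂ hd, hcnt, ← h.k_eq]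

/-- The range checks in `ValidN` are exactly what turns the numbers read off `X` into elements of
the types `Fin`. -/
theorem ValidN.exists_codes {X : ℕ} (hX : ValidN X) : ∃ G W, Codes X G W := by
  obtain ⟨_, _, hX⟩ := hX
  have hdec : ∏ j : Fin (blk X 0), actN X j = decN X := by
    rw [decN, wtN_eq_prod _ _ (blk_le X 0), Finset.prod_range]
  let G : IBG :=
    { k := blk X 0
      actions := fun i => actN X i
      actions_pos := fun i => (hX i i.2).1
      states := fun i => stN X i
      goal := fun i =>
        { step := fun q d => ⟨delN X i q (finPiFinEquiv d), ((hX i i.2).2.2.2 q q.2).2 _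
            (hdec ▸ (finPiFinEquiv d).2)⟩
          start := ⟨startN X i, (hX i i.2).2.1⟩
          accept := {q | accN X i q = 1} } }
  refine ⟨G, {i | memN X i = 1}, rfl, fun _ => rfl, fun _ => rfl, fun _ => rfl, ?_, ?_, ?_⟩
  · intro i q
    have h₁ := ((hX i i.2).2.2.2 q q.2).1
    by_cases h : accN X i q = 1
    · rw [h]; exact indicator_true h
    · rw [show accN X i q = 0 by omega]; exact indicator_false h
  · intro i q l
    change delN X i q (finPiFinEquiv (finPiFinEquiv.symm l)) = _
    rw [Equiv.apply_symm_apply]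
  · intro i
    have h₁ := (hX i i.2).2.2.1
    by_cases h : memN X i = 1
    · rw [h]; exact indicator_true h
    · rw [show memN X i = 0 by omega]; exact indicator_false h

/-! ### Correctness of the reduction -/

section Correctness

variable {X : ℕ} {G : IBG} {W : Set (Fin G.k)}

/-- The code of a decision. -/
def letter (d : Decision fun j => Fin (G.actions j)) : ℕ := finPiFinEquiv d

theorem Codes.letter_lt (h : Codes X G W) (d : Decision fun j => Fin (G.actions j)) :
    letter d < decN X :=
  decN_eq_of_act h.k_eq h.act ▸ (finPiFinEquiv d).2

theorem Codes.exists_letter_eq (h : Codes X G W) {l : ℕ} (hl : l < decN X) :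
    ∃ d : Decision fun j => Fin (G.actions j), letter d = l := by
  rw [← decN_eq_of_act h.k_eq h.act] at hl
  exact ⟨finPiFinEquiv.symm ⟨l, hl⟩, congrArg Fin.val (finPiFinEquiv.apply_symm_apply ⟨l, hl⟩)⟩

theorem Codes.step_eq (h : Codes X G W) (i : Fin G.k) (q : Fin (G.states i))
    (d : Decision fun j => Fin (G.actions j)) :
    ((G.goal i).step q d : ℕ) = delN X i q (letter d) := by
  have := h.del i q (finPiFinEquiv d)
  rwa [Equiv.symm_apply_apply] at this

/-- In the mixed radix sum only the summand of `j` changes; `subN` removes the old one and adds the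
new one. -/
theorem Codes.letter_update (h : Codes X G W) (d : Decision fun j => Fin (G.actions j))
    (j : Fin G.k) (a : Fin (G.actions j)) : letter (update d j a) = subN X (letter d) j a := by
  have hw := wtN_eq_of_act h.k_eq h.act j
  have e : ∀ f : Decision fun j => Fin (G.actions j), letter f = (f j : ℕ) * wtN X j +
      ∑ i ∈ Finset.univ.erase j, (f i : ℕ) * ∏ b : Fin i, G.actions (Fin.castLE i.is_lt.le b) := by
    intro f
    rw [letter, finPiFinEquiv_apply, ← Finset.add_sum_erase _ _ (Finset.mem_univ j), hw]
  have e₁ : letter d / wtN X j % actN X j = d j := by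
    rw [← hw, ← h.act j]
    exact congrArg Fin.val (congrFun (finPiFinEquiv.symm_apply_apply d) j)
  rw [subN, e₁, e d, e (update d j a), update_self, Nat.add_sub_cancel_left, Nat.add_comm]
  congr 1
  exact Finset.sum_congr rfl fun i hi => by rw [update_of_ne (Finset.ne_of_mem_erase hi)]

theorem Codes.mem_accept_iff (h : Codes X G W) (i : Fin G.k) (q : Fin (G.states i)) :
    q ∈ (G.goal i).accept ↔ accN X i q = 1 := by
  rw [← h.acc, indicator_eq_one]

theorem Codes.forall_state_iff (h : Codes X G W) (i : Fin G.k) {P : ℕ → Prop} :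
    (∀ q < stN X i, P q) ↔ ∀ q : Fin (G.states i), P q := by
  rw [← h.st]
  exact ⟨fun H q => H q q.2, fun H q hq => H ⟨q, hq⟩⟩

theorem Codes.forall_action_iff (h : Codes X G W) (j : Fin G.k) {P : ℕ → Prop} :
    (∀ a < actN X j, P a) ↔ ∀ a : Fin (G.actions j), P a := by
  rw [← h.act]
  exact ⟨fun H q => H q q.2, fun H q hq => H ⟨q, hq⟩⟩

theorem Codes.exists_letter_iff (h : Codes X G W) {P : ℕ → Prop} :
    (∃ l < decN X, P l) ↔ ∃ d : Decision fun j => Fin (G.actions j), P (letter d) := by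
  constructor
  · rintro ⟨l, hl, hP⟩
    obtain ⟨d, rfl⟩ := h.exists_letter_eq hl
    exact ⟨d, hP⟩
  · rintro ⟨d, hP⟩
    exact ⟨_, h.letter_lt d, hP⟩

theorem Codes.forall_agent_iff (h : Codes X G W) {P : ℕ → Prop} :
    (∀ i < blk X 0, P i) ↔ ∀ i : Fin G.k, P i := by
  rw [← h.k_eq]
  exact ⟨fun H q => H q q.2, fun H q hq => H ⟨q, hq⟩⟩

theorem Codes.safeN_iff (h : Codes X G W) (j : Fin G.k) (q : Fin (G.states j)) :
    safeN X j q ↔ q ∈ safeStates (G.goal j) j := by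
  have key : ∀ S : ℕ, (∀ p < stN X j, dig 2 S p = 1 → accN X j p ≠ 1 ∧ ∃ l < decN X,
      ∀ a < actN X j, dig 2 S (delN X j p (subN X l j a)) = 1) ↔
      ∀ p : Fin (G.states j), dig 2 S p = 1 → p ∉ (G.goal j).accept ∧
        ∃ d : Decision fun j => Fin (G.actions j), ∀ a,
          dig 2 S ((G.goal j).step p (update d j a)) = 1 := by
    intro S
    rw [h.forall_state_iff]
    refine forall_congr' fun p => imp_congr_right fun _ => ?_
    rw [h.mem_accept_iff, h.exists_letter_iff]
    refine and_congr_right fun _ => exists_congr fun d => ?_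
    rw [h.forall_action_iff]
    refine forall_congr' fun a => ?_
    rw [h.step_eq, h.letter_update]
  constructor
  · rintro ⟨S, _, hq, hS⟩
    exact ⟨{p | dig 2 S p = 1}, hq, (key S).1 hS⟩
  · rintro ⟨S, hq, hS⟩
    -- The characteristic function of `S`, written as binary digits.
    obtain ⟨m, hm, hdig⟩ := exists_dig 2 (stN X j)
      (fun p => indicator (∃ p' ∈ S, (p' : ℕ) = p)) fun p _ => Nat.lt_succ_of_le (indicator_le _)
    have hd : ∀ p : Fin (G.states j), dig 2 m p = 1 ↔ p ∈ S := fun p => by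
      rw [hdig p (h.st j ▸ p.2), indicator_eq_one]
      exact ⟨fun ⟨p', hp', e⟩ => Fin.ext e ▸ hp', fun hp => ⟨p, hp, rfl⟩⟩
    refine ⟨m, hm.trans_le (two_pow_le_bndN X (blk_le X _)), (hd q).2 hq, (key m).2 ?_⟩
    simpa only [hd] using hS

/-- The optional state with code `q`; the code of `none` is the number of states. -/
def optState (n q : ℕ) : Option (Fin n) := if hq : q < n then some ⟨q, hq⟩ else none

/-- The code of an optional state. -/
def stateCode {n : ℕ} : Option (Fin n) → ℕ
  | none => n
  | some q => q

@[simp]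
theorem optState_stateCode {n : ℕ} (o : Option (Fin n)) : optState n (stateCode o) = o := by
  cases o <;> simp [optState, stateCode]

theorem stateCode_le {n : ℕ} (o : Option (Fin n)) : stateCode o ≤ n := by
  cases o with
  | none => exact le_rfl
  | some q => exact q.2.le

theorem stateCode_optState {n q : ℕ} (hq : q ≤ n) : stateCode (optState n q) = q := by
  unfold optState
  split
  · rfl
  · change n = q
    omega

theorem optState_eq_none {n q : ℕ} : optState n q = none ↔ n ≤ q := by
  unfold optState
  split <;> simp <;> omega

theorem optState_eq_some {n q : ℕ} {p : Fin n} : optState n q = some p ↔ q = p := by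
  unfold optState
  split
  · rw [Option.some.injEq, Fin.ext_iff]
  · have := p.2
    simp only [reduceCtorEq, false_iff]
    omega

theorem Codes.stopStepN_eq (h : Codes X G W) (i : Fin G.k) (q : ℕ)
    (d : Decision fun j => Fin (G.actions j)) : stopStepN X i q (letter d) =
      stateCode (stopStep (G.goal i) (optState (G.states i) q) d) := by
  unfold stopStepN optState
  rw [← h.st]
  by_cases hq : q < G.states i
  · have hs : delN X i q (letter d) = (G.goal i).step ⟨q, hq⟩ d := (h.step_eq i ⟨q, hq⟩ d).symm
    rw [dif_pos hq, stopStep, Option.bind_some, h.mem_accept_iff, hs]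
    by_cases ha : accN X i ((G.goal i).step ⟨q, hq⟩ d) = 1
    · simp [ha, stateCode]
    · simp [ha, hq, stateCode]
  · simp [hq, stopStep, stateCode]

/-- The tuple of states that is encoded by `u`. -/
noncomputable def tuple (X : ℕ) (G : IBG) (u : ℕ) (i : Fin G.k) : Option (Fin (G.states i)) :=
  optState (G.states i) (dig (baseN X) u i)

theorem Codes.notMem_iff (h : Codes X G W) (i : Fin G.k) : i ∉ W ↔ memN X i = 0 := by
  rw [← h.mem, indicator_eq_zero]

theorem Codes.mem_iff (h : Codes X G W) (i : Fin G.k) : i ∈ W ↔ memN X i = 1 := by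
  rw [← h.mem, indicator_eq_one]

/-- Every digit from `G.states i` on decodes to `none`, but `EdgeN` produces only canonical digits
in its target; hence the extra condition on `v`. -/
theorem Codes.edgeN_iff (h : Codes X G W) {u v : ℕ} : EdgeN X u v ↔ u < bndN X ∧ v < bndN X ∧
    (∀ i : Fin G.k, dig (baseN X) v i ≤ G.states i) ∧
      Edge G.goal W (tuple X G u) (tuple X G v) := by
  unfold EdgeN Edge
  refine and_congr_right fun _ => and_congr_right fun _ => ?_
  rw [h.exists_letter_iff, ← exists_and_left]
  refine exists_congr fun d => ?_
  rw [← and_assoc]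
  refine and_congr ?_ ?_
  · rw [h.forall_agent_iff, ← forall_and]
    refine forall_congr' fun i => ?_
    rw [h.stopStepN_eq]
    unfold tuple
    constructor
    · intro e
      rw [e]
      exact ⟨stateCode_le _, optState_stateCode _⟩
    · rintro ⟨hle, e⟩
      rw [← e, stateCode_optState hle]
  · rw [h.forall_agent_iff]
    refine forall_congr' fun j => ?_
    rw [h.notMem_iff]
    refine imp_congr_right fun _ => ?_
    unfold tuple
    simp only [optState_eq_some, h.forall_action_iff]
    constructor
    · rintro ⟨hq, ha⟩
      rw [← h.st] at hq
      refine ⟨⟨_, hq⟩, rfl, fun a => ?_⟩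
      have := ha a
      rw [← h.letter_update] at this
      rw [← h.safeN_iff, h.step_eq]
      exact this
    · rintro ⟨q, hq, ha⟩
      rw [hq, ← h.st]
      refine ⟨q.2, fun a => ?_⟩
      have := ha a
      rwa [← h.safeN_iff, h.step_eq, h.letter_update] at this

theorem Codes.exists_tuple_eq (h : Codes X G W) (U : ∀ i, Option (Fin (G.states i))) :
    ∃ u < bndN X, (∀ i : Fin G.k, dig (baseN X) u i = stateCode (U i)) ∧ tuple X G u = U := by
  obtain ⟨u, hu, hd⟩ := exists_dig (baseN X) G.k
    (fun i => if hi : i < G.k then stateCode (U ⟨i, hi⟩) else 0) fun i hi => by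
      rw [dif_pos hi]
      refine (stateCode_le _).trans_lt ?_
      rw [h.st]
      exact (blk_le X _).trans_lt (len_lt_baseN X)
  have hd' : ∀ i : Fin G.k, dig (baseN X) u i = stateCode (U i) := fun i => by
    rw [hd i i.2, dif_pos i.2]
  refine ⟨u, hu.trans_le (pow_le_bndN X (h.k_eq ▸ blk_le X 0)), hd', funext fun i => ?_⟩
  rw [tuple, hd', optState_stateCode]

theorem Codes.reflTransGen_tuple (h : Codes X G W) {u v : ℕ} (huv : ReflTransGen (EdgeN X) u v) :
    ReflTransGen (Edge G.goal W) (tuple X G u) (tuple X G v) :=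
  huv.lift (tuple X G) fun _ _ e => (h.edgeN_iff.1 e).2.2.2

/-- A chosen code of a tuple of states. -/
noncomputable def Codes.num (h : Codes X G W) (U : ∀ i, Option (Fin (G.states i))) : ℕ :=
  (h.exists_tuple_eq U).choose

theorem Codes.num_lt (h : Codes X G W) (U) : h.num U < bndN X := (h.exists_tuple_eq U).choose_spec.1

theorem Codes.dig_num (h : Codes X G W) (U) (i : Fin G.k) :
    dig (baseN X) (h.num U) i = stateCode (U i) := (h.exists_tuple_eq U).choose_spec.2.1 i

theorem Codes.tuple_num (h : Codes X G W) (U) : tuple X G (h.num U) = U :=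
  (h.exists_tuple_eq U).choose_spec.2.2

theorem Codes.edgeN_num (h : Codes X G W) {U V} (e : Edge G.goal W U V) :
    EdgeN X (h.num U) (h.num V) :=
  h.edgeN_iff.2 ⟨h.num_lt U, h.num_lt V, fun i => h.dig_num V i ▸ stateCode_le _,
    by rwa [h.tuple_num, h.tuple_num]⟩

/-- Codes of tuples are not unique, so walks are transported along `tuple` in one direction and
along the chosen codes `num` in the other. -/
theorem Codes.winN_iff (h : Codes X G W) : WinN X ↔ ∃ π, IsWNE G.goal W π := by
  rw [exists_isWNE_iff, exists_trace_iff]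
  constructor
  · rintro ⟨s, _, hs, u, _, hsu, hu, w, _, huw, hwu⟩
    rw [h.forall_agent_iff] at hs hu
    have hs' : tuple X G s = fun i => some (G.goal i).start := funext fun i => by
      rw [tuple, optState_eq_some, hs, h.start]
    refine ⟨tuple X G u, hs' ▸ h.reflTransGen_tuple hsu, fun i hi => ?_,
      .head' (h.edgeN_iff.1 huw).2.2.2 (h.reflTransGen_tuple hwu)⟩
    rw [tuple, optState_eq_none, h.st]
    exact hu i ((h.mem_iff i).1 hi)
  · rintro ⟨u, hsu, hu, huu⟩
    obtain ⟨w, huw, hwu⟩ := TransGen.head'_iff.1 huu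
    refine ⟨_, h.num_lt _, ?_, _, h.num_lt _, hsu.lift h.num fun _ _ => h.edgeN_num, ?_, _,
      h.num_lt _, h.edgeN_num huw, hwu.lift h.num fun _ _ => h.edgeN_num⟩
    · rw [h.forall_agent_iff]
      exact fun i => (h.dig_num _ i).trans (h.start i)
    · rw [h.forall_agent_iff]
      intro i hi
      rw [h.dig_num, hu i ((h.mem_iff i).2 hi), ← h.st]
      exact le_rfl

theorem Codes.validN (h : Codes X G W) (h₁ : ¬ Unfinished X)
    (h₂ : cnt X = offN X (blk X 0) + blk X 0) : ValidN X := by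
  refine ⟨h₁, h₂, h.forall_agent_iff.2 fun i => ⟨h.act i ▸ G.actions_pos i, ?_,
    h.mem i ▸ indicator_le _, (h.forall_state_iff i).2 fun q => ⟨h.acc i q ▸ indicator_le _,
    fun l hl => ?_⟩⟩⟩
  · rw [← h.start, ← h.st]
    exact Fin.is_lt _
  · obtain ⟨d, rfl⟩ := h.exists_letter_eq hl
    rw [← h.step_eq, ← h.st]
    exact Fin.is_lt _

end Correctness

theorem mem_WNEExistence_iff {x : List Bool} :
    x ∈ WNEExistence ↔ ValidN (val x) ∧ WinN (val x) := by
  constructor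
  · rintro ⟨G, W, rfl, hπ⟩
    obtain ⟨h, hcnt⟩ := instanceData_eq_iff.1 (eq_map_blk (instanceData G W))
    exact ⟨h.validN ((not_unfinished_iff _).2 ⟨_, rfl⟩) hcnt, h.winN_iff.2 hπ⟩
  · rintro ⟨hV, hwin⟩
    obtain ⟨l, rfl⟩ := (not_unfinished_iff x).1 hV.1
    obtain ⟨G, W, h⟩ := hV.exists_codes
    refine ⟨G, W, ?_, h.winN_iff.1 hwin⟩
    rw [encodeInstance, instanceData_eq_iff.2 ⟨h, hV.2.1⟩, ← eq_map_blk]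

/-! ### From programs to Turing machines -/

theorem update_stk_in (i o : List Bool) (f : Fin 3 → List (Option Bool)) (l : List Bool) :
    update (β := fun k => List (SymT k)) (stk i o f) (.inl false) l = stk l o f := by
  funext k
  rcases k with (_ | _) | k
  · exact update_self (β := fun k => List (SymT k)) _ _ _
  · exact update_of_ne (β := fun k => List (SymT k)) (by simp) _ _
  · exact update_of_ne (β := fun k => List (SymT k)) (by simp) _ _

theorem update_stk_out (i o : List Bool) (f : Fin 3 → List (Option Bool)) (l : List Bool) :
    update (β := fun k => List (SymT k)) (stk i o f) (.inl true) l = stk i l f := by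
  funext k
  rcases k with (_ | _) | k
  · exact update_of_ne (β := fun k => List (SymT k)) (by simp) _ _
  · exact update_self (β := fun k => List (SymT k)) _ _ _
  · exact update_of_ne (β := fun k => List (SymT k)) (by simp) _ _

/-- Move a bit from the input stack to the third working stack. -/
def readBit (b : Bool) : CmdS := .pop (.inl false) ;; pushS 2 (some b)

/-- Move the input to the third working stack. -/
def readLoop : CmdS :=
  .loop (.inl false) (fun o => Option.isSome o)
    (.ite (.inl false) (fun o : Option Bool => o == some true) (readBit true) (readBit false))

/-- Move the input to the first working stack. -/
def readInput : CmdS := pushS 0 none ;; readLoop ;; mvBits 2 0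

theorem run_readLoop {B : ℕ} (x : List Bool) (D T : List (Option Bool))
    (hB : x.length + D.length + T.length ≤ B) :
    Run B readLoop (stk x [] ![D, [], T]) (stk [] [] ![D, [], x.reverse.map some ++ T]) := by
  induction x generalizing T with
  | nil => exact .loop_false rfl (by simpa [stSize_stk, fsize, Fin.sum_univ_three] using hB)
  | cons b x ih =>
    rw [List.length_cons] at hB
    have h₁ : Run B (readBit b) (stk (b :: x) [] ![D, [], T])
        (stk x [] ![D, [], some b :: T]) := by
      refine .seq (.pop' (s' := stk x [] ![D, [], T]) ?_ (update_stk_in _ _ _ _))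
        (run_pushS ?_ ?_)
      · simp [stSize_stk, fsize, Fin.sum_univ_three]; omega
      · simp [fsize, Fin.sum_univ_three]; omega
      · funext k; fin_cases k <;> rfl
    have h₂ := ih (some b :: T) (by simp; omega)
    rw [List.reverse_cons, List.map_append, List.append_assoc]
    refine .loop_true (s' := stk x [] ![D, [], some b :: T]) rfl ?_ h₂
    cases b
    · exact .ite_false rfl h₁
    · exact .ite_true rfl h₁

/-- Two moves preserve the orientation, and the input bits above one separator already are the
encoding of `val x`; no conversion takes place. -/
theorem run_readInput {B : ℕ} (x : List Bool) (hB : x.length + 1 ≤ B) :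
    Run B readInput (stk x [] ![[], [], []]) (nst [val x] []) := by
  have h₂ := run_mvBits (B := B) (i := 2) (j := 0) (by decide) x.reverse []
    ![[none], [], x.reverse.map some ++ []] rfl rfl
    (by simp [fsize, Fin.sum_univ_three]; omega)
  refine .seq (run_pushS (f' := ![[none], [], []]) ?_ ?_) (.seq (run_readLoop x _ _ ?_) ?_)
  · simpa [fsize, Fin.sum_univ_three] using hB
  · funext k; fin_cases k <;> rfl
  · simp; omega
  · convert h₂ using 1
    rw [nst_cons, word_val]
    congr 1
    funext k
    fin_cases k <;> simp [Function.update]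

/-- Write the truth value on the data stack to the output stack. -/
def writeOutput : CmdS := iteS 0 isBit (.push (.inl true) true) (.push (.inl true) false)

theorem run_writeOutput {B : ℕ} (p : Prop) [Decidable p] (hB : nsize [indicator p] + 1 ≤ B) :
    ∃ f, Run B writeOutput (nst [indicator p] []) (stk [] [decide p] f) := by
  rw [nst_cons]
  set f := ![(word (indicator p)).map some ++ none :: encW (([] : List ℕ).map word),
    encW (([] : List ℕ).map word), []] with hf
  have hs : fsize f + 1 ≤ B := by
    simpa [hf, fsize, Fin.sum_univ_three, nsize_cons, len] using hB
  refine ⟨f, ?_⟩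
  by_cases hp : p
  · rw [decide_eq_true hp]
    refine .ite_true ?_ (.push' ?_ (update_stk_out _ _ _ _))
    · rw [stk_inr, hf, indicator_true hp]; rfl
    · simpa [stSize_stk] using hs
  · rw [decide_eq_false hp]
    refine .ite_false ?_ (.push' ?_ (update_stk_out _ _ _ _))
    · rw [stk_inr, hf, indicator_false hp]; rfl
    · simpa [stSize_stk] using hs

instance : Fintype (SymT (.inl false)) := inferInstanceAs (Fintype Bool)

/-- The Turing machine that runs a program. -/
def finMachine (c : CmdS) : FinTM2 where
  K := Bool ⊕ Fin 3
  k₀ := .inl false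
  k₁ := .inl true
  Γ := SymT
  Λ := Option (Lbl c)
  main := some (entry c)
  σ := Bool
  initialState := false
  m := machine c

theorem initList_finMachine (c : CmdS) (x : List Bool) :
    initList (finMachine c) x = ⟨some (some (entry c)), false, stk x [] ![[], [], []]⟩ := by
  unfold initList
  refine congrArg (TM2.Cfg.mk _ _) ?_
  funext k
  rcases k with (_ | _) | k
  · rfl
  · rfl
  · fin_cases k <;> rfl

theorem inPSPACE_of_run {L : Set (List Bool)} (c : CmdS) (p : ℕ[X])
    (h : ∀ x : List Bool, ∃ f, ∃ b : Bool, (b = true ↔ x ∈ L) ∧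
      Run (p.eval x.length) c (stk x [] ![[], [], []]) (stk [] [b] f)) : InPSPACE L := by
  refine ⟨⟨finMachine c, Equiv.refl Bool, Equiv.refl Bool⟩, p, ?_, fun x => ?_⟩
  · rintro ((_ | _) | k)
    · exact inferInstanceAs (Finite Bool)
    · exact inferInstanceAs (Finite Bool)
    · exact inferInstanceAs (Finite (Option Bool))
  · obtain ⟨f, b, hb, hrun⟩ := h x
    obtain ⟨v, hv⟩ := hrun.machine_reaches false
    have hinit : initList (finMachine c) (x.map (Equiv.refl Bool).symm) =
        ⟨some (some (entry c)), false, stk x [] ![[], [], []]⟩ := by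
      rw [← initList_finMachine]
      congr 1
      exact List.map_id x
    refine ⟨⟨⟨none, v, stk [] [b] f⟩, ?_, rfl, b, rfl, hb⟩, fun d hd => ?_⟩
    · change StateTransition.Reaches _ (initList (finMachine c) (x.map (Equiv.refl Bool).symm)) _
      rw [hinit]
      exact hv.lift id fun _ _ h => h.1
    · change StateTransition.Reaches _ (initList (finMachine c) (x.map (Equiv.refl Bool).symm)) _
        at hd
      rw [hinit] at hd
      have hle : stSize (TM2.Cfg.stk (K := Bool ⊕ Fin 3) (Γ := SymT) d) ≤ p.eval x.length :=
        SmallStep.size_le hv rfl hrun.size_right hd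
      exact hle

theorem PolySpace.inPSPACE {q : ℕ → Prop} (hq : PolySpace q) : InPSPACE {x | q (val x)} := by
  classical
  obtain ⟨c, p, H⟩ := hq
  -- The number `val x` takes `x.length + 1` symbols with its separator; the remaining terms pay for
  -- reading the input and writing the answer.
  refine inPSPACE_of_run (readInput ;; c ;; writeOutput) (p.comp (X + 1) + X + 3) fun x => ?_
  have h₁ := H (val x) [] []
  have hesz : esz (val x) = x.length + 1 := by rw [esz_nat, IteratedGames.len, word_val]
  rw [enc_nat, enc_prop, List.append_nil, List.append_nil, hesz] at h₁
  have h₂ : nsize [indicator (q (val x))] ≤ 2 := by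
    have : IteratedGames.len (indicator (q (val x))) ≤ 1 := (len_le _).trans (indicator_le _)
    simpa using this
  have hB : (p.comp (X + 1) + X + 3).eval x.length = p.eval (x.length + 1) + x.length + 3 := by
    simp
  rw [hB]
  obtain ⟨f, hf⟩ := run_writeOutput (B := p.eval (x.length + 1) + x.length + 3) (q (val x))
    (by omega)
  refine ⟨f, decide (q (val x)), by simp, .seq (run_readInput x (by omega)) (.seq (h₁.mono ?_) hf)⟩
  simp only [nsize_nil]
  omega

end IteratedGames

theorem theorem5p1 : IteratedGames.InPSPACE IteratedGames.WNEExistence := by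
  have h : IteratedGames.PolySpace fun X => IteratedGames.ValidN X ∧ IteratedGames.WinN X := by
    fun_prop
  have e : IteratedGames.WNEExistence =
      {x | IteratedGames.ValidN (IteratedGames.val x) ∧ IteratedGames.WinN (IteratedGames.val x)} :=
    Set.ext fun _ => IteratedGames.mem_WNEExistence_iff
  exact e ▸ h.inPSPACE
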